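/- **Theorem (adaptive sieving).** Under the heuristic assumption (H) and the Gaussian heuristic (G) below, the adaptive two-list Nguyen–Vidick sieve with spherical locality-sensitive filtering (LSF) solves the closest vector problem (CVP) in dimension $d$ in time $\mathrm T$ and space $\mathrm S$ with $$\mathrm S=(4/3)^{d/2+o(d)}\approx 2^{0.208d+o(d)},\qquad \mathrm T=(3/2)^{d/2+o(d)}\approx 2^{0.292d+o(d)} .$$ In detail, let $p=p(d)$ be called *negligible* if $d^c p(d)\to0$ for every $c$. *Instances.* For each $d$ let a basis of a full-rank lattice $\mathcal L\subset\mathbb R^d$ and a target $t\in\mathbb R^d$ be given. Let $g$ be the radius of a ball of volume $\operatorname{covol}(\mathcal L)$, and let $R_*=\sqrt{4/3}\,(1+d^{-1/2})\,g$. Let also a sampler be given, i.e. a probability distribution on pairs of lists $(L_0,L_t)$ of $N=\lceil d^4(4/3)^{d/2}\rceil$ lattice vectors each, at distance at most $R_0$ from $0$ and from $t$ respectively, drawn at a cost of at most $d^{c}$ operations per vector, where $R_*\le R_0\le 2^{d^{c}}g$ for a constant $c$ and all large $d$. *Algorithm.* Let $\gamma=1-1/d$. Starting with $R=R_0$, as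 long as $R\ge R_*$ the sieve step replaces $(L_0,L_t)$ by $(L_0',L_t')$ and $R$ by $\gamma R$. Here $L_0'$ consists of nonzero differences $w_1-w_2$ with $w_1,w_2\in L_0$, $\|w_1-w_2\|\le\gamma R$, and $L_t'$ of differences $w_1-w_2$ with $w_1\in L_t$, $w_2\in L_0$, $\|(w_1-w_2)-t\|\le\gamma R$; duplicates are dropped and each list is cut off at $N$ vectors. The pairs that are tried are found by spherical LSF: in each of $\lceil(9/8)^{d/2}2^{d^{3/4}}\rceil$ successive rounds a fresh randomly rotated random product code with $m=\lfloor\log_2 d\rfloor+1$ blocks and $\lceil(4/3)^{d/(2m)}\rceil$ random unit vectors per block is drawn; each code word $c$ is a filter, which accepts a vector with direction $v$ if $\langle v,c\rangle\ge\tfrac12$; the filters accepting a vector are found by list decoding of the code (tree search with pruning); and $(w_1,w_2)$ is tried if some filter accepts both $w_2$ and $w_1$ (respectively $w_1-t$). The algorithm returns the vector closest to $t$ among $0$ and all vectors found for the lists $L_t'$. Time counts real arithmetic operations, comparisons, draws of Gaussian reals and memory accesses (including the sampling); space is the maximal number of memory cells (each for a real number, pointer or index) in use at one time. *(H)* At each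 sieve step carried out at a radius $R\ge R_*$, the two lists $L_0$ and $L_t-t$ behave, for the sieve step, like two independent lists of $N$ independent uniformly random vectors from the sphere of radius $R$ around $0$: there is $e(d)=o(d)$ such that for every choice of one sieve step for each $d$, (i) for all bounds $\tau,\sigma$ depending on $d$: if the step applied to the random lists produces two lists of $N$ vectors in time at most $\tau$ and space at most $\sigma$ except with negligible probability, then, applied to the actual lists, it produces two lists of $N$ vectors in time at most $2^{e(d)}\tau$ and space at most $2^{e(d)}\sigma$ except with negligible probability; and (ii) if, after the step applied to the random lists, the best vector known is within $\operatorname{dist}(t,\mathcal L)$ of $t$ except with negligible probability, then so it is for the actual lists. *(G)* $\operatorname{dist}(t,\mathcal L)/g\to1$ as $d\to\infty$. *Conclusion.* There is a function $e(d)=o(d)$ such that, except with negligible probability over the randomness of the sampler and the algorithm, the algorithm returns a lattice vector closest to $t$, its running time lies between $(3/2)^{d/2-e(d)}$ and $(3/2)^{d/2+e(d)}$, and its space lies between $(4/3)^{d/2-e(d)}$ and $(4/3)^{d/2+e(d)}$. Moreover $|\tfrac12\log_2\tfrac43-0.208|<0.0005$ and $|\tfrac12\log_2\tfrac32-0.292|<0.0005$.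 -/

import Mathlib

open MeasureTheory ProbabilityTheory Filter Topology Asymptotics
open scoped ENNReal

noncomputable section

/-! ## Cost model: computations over the reals that count operations and memory cells -/

/-- The outcome of running an algorithm: the value it returns, the number `time` of elementary
operations it performs (real arithmetic, comparisons, drawing one Gaussian real, access to a memory
cell), the maximum `peak` over time of the number of memory cells in use minus the number in use at
the start, and the difference `net` between the numbers of cells in use at the end and at the
start. A cell holds a real number, a pointer or an index. -/
structure Alg (α : Type) where
  val : α
  time : ℕ
  peak : ℤ
  net : ℤ

namespace Alg

/-- Times of consecutive computations add up; the second one runs on top of the cells that the first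
one left in use. -/
instance : Monad Alg where
  pure a := ⟨a, 0, 0, 0⟩
  bind x f :=
    let y := f x.val
    ⟨y.val, x.time + y.time, max x.peak (x.net + y.peak), x.net + y.net⟩

/-- Spend `n` elementary operations. -/
def spend (n : ℕ) : Alg Unit := ⟨(), n, 0, 0⟩

/-- Take `n` memory cells into use and write to them. -/
def alloc (n : ℕ) : Alg Unit := ⟨(), n, n, n⟩

/-- Release `n` memory cells. -/
def free (n : ℕ) : Alg Unit := ⟨(), 0, 0, -n⟩

end Alg

open Alg

namespace Sieve

/-- Euclidean space of dimension `d`. -/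
abbrev E (d : ℕ) : Type := EuclideanSpace ℝ (Fin d)

/-- The vector `v` scaled to length one (and `0` for `v = 0`). -/
def normalized {d : ℕ} (v : E d) : E d := ‖v‖⁻¹ • v

/-! ## Parameters -/

/-- The factor by which one application of the sieve shrinks the radius. -/
def shrink (d : ℕ) : ℝ := 1 - 1 / d

/-- The number of vectors per list. -/
def listSize (d : ℕ) : ℕ := ⌈(d : ℝ) ^ 4 * (4 / 3 : ℝ) ^ ((d : ℝ) / 2)⌉₊

/-- The number of blocks of the random product codes. -/
def numBlocks (d : ℕ) : ℕ := Nat.log 2 d + 1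

/-- The number of words per block: a product code has about `(4/3)^(d/2)` words. -/
def blockSize (d : ℕ) : ℕ := ⌈(4 / 3 : ℝ) ^ ((d : ℝ) / (2 * numBlocks d))⌉₊

/-- The number of product codes that one application of the sieve goes through, one after the
other. -/
def numRounds (d : ℕ) : ℕ :=
  ⌈(9 / 8 : ℝ) ^ ((d : ℝ) / 2) * (2 : ℝ) ^ ((d : ℝ) ^ (3 / 4 : ℝ))⌉₊

/-- A filter with (unit) filter vector `c` accepts the unit vectors `v` with `⟪v, c⟫ ≥ cos (π/3)`. -/
def filterThreshold : ℝ := 1 / 2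

/-! ## Spherical locality-sensitive filters from random product codes -/

/-- The random vectors from which one product code is built: `d` vectors for a random rotation, and
`blockSize d` vectors for each block. -/
abbrev RoundCoins (d : ℕ) : Type :=
  (Fin d → E d) × (Fin (numBlocks d) → Fin (blockSize d) → E d)

/-- All random vectors used by one application of the sieve. -/
abbrev StepCoins (d : ℕ) : Type := Fin (numRounds d) → RoundCoins d

/-- The random vectors of a whole run; component `k` is for the `k`-th application of the sieve. -/
abbrev Coins (d : ℕ) : Type := ℕ → StepCoins d

/-- All vectors are independent standard Gaussian vectors. -/
def roundMeasure (d : ℕ) : Measure (RoundCoins d) :=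
  (Measure.pi fun _ => stdGaussian (E d)).prod
    (Measure.pi fun _ => Measure.pi fun _ => stdGaussian (E d))

instance (d : ℕ) : IsProbabilityMeasure (roundMeasure d) := by
  unfold roundMeasure; infer_instance

def stepMeasure (d : ℕ) : Measure (StepCoins d) := Measure.pi fun _ => roundMeasure d

instance (d : ℕ) : IsProbabilityMeasure (stepMeasure d) := by
  unfold stepMeasure; infer_instance

def coinsMeasure (d : ℕ) : Measure (Coins d) := Measure.infinitePi fun _ => stepMeasure d

instance (d : ℕ) : IsProbabilityMeasure (coinsMeasure d) := by
  unfold coinsMeasure; infer_instance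

/-- The blocks partition the coordinates; block `i` consists of those congruent to `i` modulo
`numBlocks d`. A Gaussian vector, restricted to a block and scaled to length one, is a uniformly
random unit vector of that block. -/
def blockWord {d : ℕ} (i : Fin (numBlocks d)) (g : E d) : E d :=
  normalized (WithLp.toLp 2 fun j : Fin d => if (j : ℕ) % numBlocks d = i then g j else 0)

/-- The part of the filter vectors that the choice of word `b` in block `i` contributes: the word,
scaled by `1 / √numBlocks` and rotated. The filter vector belonging to a choice `β` of one word per
block is `∑ i, codePart ω i (β i)`, a unit vector. -/
def codePart {d : ℕ} (ω : RoundCoins d) (i : Fin (numBlocks d)) (b : Fin (blockSize d)) : E d :=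
  (Real.sqrt (numBlocks d))⁻¹ •
    ∑ j : Fin d, (blockWord i (ω.2 i b)) j • InnerProductSpace.gramSchmidtNormed ℝ ω.1 j

/-- The total number of entries of a table. -/
def numEntries {β : Type} (rows : List (List (β × ℝ))) : ℕ := (rows.map List.length).sum

/-- The largest sum obtainable by choosing one entry per row (all entries being at least `-1`). -/
def maxSum {β : Type} (rows : List (List (β × ℝ))) : ℝ :=
  (rows.map fun row => row.foldr (fun p a => max p.2 a) (-1)).sum

open scoped Classical in
/-- List decoding by a tree search with pruning: all choices of one entry per row with sum at
least `τ`. -/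
def search {β : Type} : List (List (β × ℝ)) → ℝ → Alg (List (List β))
  | [], τ => do
      spend 1
      if τ ≤ 0 then pure [[]] else pure []
  | row :: rows, τ =>
      row.foldlM (fun acc p => do
        spend (numEntries rows + 3)
        if τ - p.2 ≤ maxSum rows then do
          let r ← search rows (τ - p.2)
          spend r.length
          pure (r.map (p.1 :: ·) ++ acc)
        else pure acc) []

/-- A filter is addressed by its choice of one word per block. -/
abbrev Address (d : ℕ) : Type := List (Fin (blockSize d))

/-- The addresses of all filters that accept the direction of `v`. They stay in memory. -/
def decode {d : ℕ} (ω : RoundCoins d) (v : E d) : Alg (List (Address d)) := do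
  spend (3 * d + 2 * d * numBlocks d * blockSize d)
  alloc (d + numBlocks d * blockSize d)
  let addresses ← search ((List.finRange (numBlocks d)).map fun i =>
    (List.finRange (blockSize d)).map fun b => (b, inner ℝ (normalized v) (codePart ω i b)))
      filterThreshold
  alloc (numBlocks d * addresses.length)
  free (d + numBlocks d * blockSize d)
  pure addresses

/-- The buckets of the filters: an array with one list of (pointers to) vectors per filter. -/
abbrev Buckets (d : ℕ) : Type := Address d → List (E d)

open scoped Classical in
/-- Put `w` into the buckets of all filters that accept its direction. The number of stored pointers
is recorded along with the buckets. -/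
def insertVector {d : ℕ} (ω : RoundCoins d) (T : Buckets d × ℕ) (w : E d) :
    Alg (Buckets d × ℕ) := do
  let addresses ← decode ω w
  let T' ← addresses.foldlM (fun (T : Buckets d × ℕ) a => do
    spend (numBlocks d)
    alloc 1
    pure (Function.update T.1 a (w :: T.1 a), T.2 + 1)) T
  free (numBlocks d * addresses.length)
  pure T'

/-- Process with `f` all vectors that share a filter with direction `v`, once for every shared
filter. -/
def forCandidates {d : ℕ} {σ : Type} (ω : RoundCoins d) (T : Buckets d) (v : E d) (s : σ)
    (f : σ → E d → Alg σ) : Alg σ := do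
  let addresses ← decode ω v
  let s' ← addresses.foldlM (fun s a => do
    spend (numBlocks d)
    (T a).foldlM f s) s
  free (numBlocks d * addresses.length)
  pure s'

/-! ## The adaptive two-list sieve -/

/-- The two lists of lattice vectors, close to `0` and close to the target, and the vector closest
to the target among all those seen so far. -/
structure State (d : ℕ) where
  zero : List (E d)
  target : List (E d)
  best : E d

open scoped Classical in
/-- Add `w` to the list `L`, unless it is in it already or the list is full. The lists are kept as
balanced search trees, so that this takes logarithmically many comparisons of vectors. -/
def addVector {d : ℕ} (L : List (E d)) (w : E d) : Alg (List (E d)) := do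
  spend (d * (Nat.log 2 (listSize d) + 2))
  if w ∈ L ∨ listSize d ≤ L.length then pure L
  else do
    alloc d
    pure (w :: L)

open scoped Classical in
/-- The pair `(w₁, w₂)` from the first list times itself. -/
def reduceZero {d : ℕ} (R : ℝ) (w₁ : E d) (out : State d) (w₂ : E d) : Alg (State d) := do
  spend (3 * d + 2)
  if ‖w₁ - w₂‖ ≤ shrink d * R ∧ w₁ - w₂ ≠ 0 then do
    let L ← addVector out.zero (w₁ - w₂)
    pure { out with zero := L }
  else pure out

open scoped Classical in
/-- The pair `(w₁, w₂)` from the second list times the first list. -/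
def reduceTarget {d : ℕ} (R : ℝ) (t w₁ : E d) (out : State d) (w₂ : E d) : Alg (State d) := do
  spend (8 * d + 3)
  if ‖(w₁ - w₂) - t‖ ≤ shrink d * R then do
    let L ← addVector out.target (w₁ - w₂)
    pure ⟨out.zero, L, if ‖(w₁ - w₂) - t‖ < ‖out.best - t‖ then w₁ - w₂ else out.best⟩
  else pure out

/-- Search the pairs with one product code: draw the code, put the vectors of the first list into the
buckets, and compare every vector of either list with the vectors in its buckets. -/
def sieveRound {d : ℕ} (R : ℝ) (t : E d) (inp : State d) (out : State d) (ω : RoundCoins d) :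
    Alg (State d) := do
  let codeCells := d ^ 2 + d * numBlocks d * blockSize d
  spend (3 * d ^ 3 + 3 * d ^ 2 * numBlocks d * blockSize d)
  alloc codeCells
  alloc (blockSize d ^ numBlocks d)
  let T ← inp.zero.foldlM (insertVector ω) ((fun _ => [], 0) : Buckets d × ℕ)
  let out ← inp.zero.foldlM (fun out w₁ =>
    forCandidates ω T.1 w₁ out (reduceZero R w₁)) out
  let out ← inp.target.foldlM (fun out w₁ =>
    forCandidates ω T.1 (w₁ - t) out (reduceTarget R t w₁)) out
  free (codeCells + blockSize d ^ numBlocks d + T.2)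
  pure out

/-- One application of the sieve: it maps lists of vectors at distance at most `R` from `0` and `t`
to lists of vectors at distance at most `shrink d * R`. The input lists are discarded. -/
def sieveStep {d : ℕ} (R : ℝ) (t : E d) (ω : StepCoins d) (inp : State d) : Alg (State d) := do
  let out ← (List.finRange (numRounds d)).foldlM (fun out r => sieveRound R t inp out (ω r))
    (⟨[], [], inp.best⟩ : State d)
  free (d * (inp.zero.length + inp.target.length))
  pure out

/-! ## Instances of the closest vector problem, and the complete algorithm -/

/-- A basis of a full-rank lattice in dimension `d`, a target, and a sampler that draws the two
initial lists of lattice vectors at distance at most `R` from `0` and from the target, where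
`sampleCost` is its number of elementary operations per vector. -/
structure CVPInstance (d : ℕ) where
  basis : Module.Basis (Fin d) ℝ (E d)
  target : E d
  R : ℝ
  sampler : PMF (List (E d) × List (E d))
  sampleCost : ℕ
  length_zero : ∀ l ∈ sampler.support, l.1.length = listSize d
  length_target : ∀ l ∈ sampler.support, l.2.length = listSize d
  mem_zero : ∀ l ∈ sampler.support, ∀ w ∈ l.1,
    w ∈ Submodule.span ℤ (Set.range basis) ∧ ‖w‖ ≤ R
  mem_target : ∀ l ∈ sampler.support, ∀ w ∈ l.2,
    w ∈ Submodule.span ℤ (Set.range basis) ∧ ‖w - target‖ ≤ R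

namespace CVPInstance

variable {d : ℕ} (I : CVPInstance d)

/-- The lattice generated by the basis. -/
def lattice : Submodule ℤ (E d) := Submodule.span ℤ (Set.range I.basis)

/-- The distance from the target to the lattice. -/
def dist : ℝ := Metric.infDist I.target (I.lattice : Set (E d))

/-- `v` is a lattice vector closest to the target. -/
def IsClosest (v : E d) : Prop :=
  v ∈ I.lattice ∧ ∀ w ∈ I.lattice, ‖v - I.target‖ ≤ ‖w - I.target‖

/-- The radius of a ball whose volume is the covolume of the lattice: by the Gaussian heuristic, the
length of a shortest nonzero lattice vector. -/
def gaussRadius : ℝ :=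
  ((volume (ZSpan.fundamentalDomain I.basis)).toReal /
    (volume (Metric.ball (0 : E d) 1)).toReal) ^ (1 / (d : ℝ))

/-- The radius, approximately `√(4/3)` times the length of a shortest vector, at which the sieve
stops. -/
def stopRadius : ℝ := Real.sqrt (4 / 3) * (1 + (d : ℝ) ^ (-(1 / 2) : ℝ)) * I.gaussRadius

/-- The radius after `k` applications of the sieve. -/
def radius (k : ℕ) : ℝ := shrink d ^ k * I.R

/-- The number of applications of the sieve: it is applied as long as the radius is at least
`stopRadius`. -/
def numIter : ℕ := sInf {k | I.radius k < I.stopRadius}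

/-- The computation up to and including the `k`-th application of the sieve, where `l` are the
initial lists and `ω` the random vectors. -/
def sieveIter (l : List (E d) × List (E d)) (ω : Coins d) : ℕ → Alg (State d)
  | 0 => do
      spend (3 * d ^ 3 + 2 * listSize d * I.sampleCost)
      alloc (d * (l.1.length + l.2.length) + d)
      pure ⟨l.1, l.2, 0⟩
  | k + 1 => do
      let s ← sieveIter l ω k
      spend 2
      sieveStep (I.radius k) I.target (ω k) s

/-- The complete algorithm. -/
def solveCVP (l : List (E d) × List (E d)) (ω : Coins d) : Alg (E d) := do
  let s ← I.sieveIter l ω I.numIter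
  pure s.best

/-- The probability, over the sampler and the random vectors of the algorithm, of an event. -/
def prob (event : List (E d) × List (E d) → Coins d → Prop) : ℝ≥0∞ :=
  ∑' l, I.sampler l * coinsMeasure d {ω | event l ω}

end CVPInstance

/-! ## The heuristic assumption -/

/-- The uniform probability measure on the unit sphere. -/
def uniformSphere (d : ℕ) : Measure (Metric.sphere (0 : E d) 1) :=
  ((volume : Measure (E d)).toSphere Set.univ)⁻¹ • (volume : Measure (E d)).toSphere

/-- `listSize d` unit vectors. -/
abbrev UnitVectors (d : ℕ) : Type := Fin (listSize d) → Metric.sphere (0 : E d) 1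

/-- The ideal model: two lists of independent uniformly random unit vectors, and independent random
vectors for one application of the sieve. -/
def modelMeasure (d : ℕ) : Measure ((UnitVectors d × UnitVectors d) × StepCoins d) :=
  ((Measure.pi fun _ => uniformSphere d).prod (Measure.pi fun _ => uniformSphere d)).prod
    (stepMeasure d)

/-- One application of the sieve, with radius `R` and target `t`, to lists of vectors whose
displacements from `0` and from `t` have length `R` and the directions given by `u`. -/
def modelStep {d : ℕ} (R : ℝ) (t : E d) (u : (UnitVectors d × UnitVectors d) × StepCoins d) :
    Alg (State d) :=
  sieveStep R t u.2
    ⟨List.ofFn fun i => R • (u.1.1 i : E d), List.ofFn fun i => t + R • (u.1.2 i : E d), 0⟩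

/-- The application of the sieve to the actual lists that have been produced by `k` previous
applications. -/
def CVPInstance.actualStep {d : ℕ} (I : CVPInstance d) (k : ℕ) (l : List (E d) × List (E d))
    (ω : Coins d) : Alg (State d) :=
  sieveStep (I.radius k) I.target (ω k) (I.sieveIter l ω k).val

/-- An application of the sieve has produced two full lists, in time at most `τ` and with at most `σ`
memory cells. -/
def Productive {d : ℕ} (x : Alg (State d)) (τ σ : ℝ) : Prop :=
  listSize d ≤ x.val.zero.length ∧ listSize d ≤ x.val.target.length ∧
    (x.time : ℝ) ≤ τ ∧ (x.peak : ℝ) ≤ σ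

/-- The best vector after an application of the sieve is within the distance of the target from the
lattice. -/
def CVPInstance.Finds {d : ℕ} (I : CVPInstance d) (x : Alg (State d)) : Prop :=
  ‖x.val.best - I.target‖ ≤ I.dist

/-- Probabilities that decrease faster than every inverse polynomial. -/
def Negligible (p : ℕ → ℝ≥0∞) : Prop :=
  ∀ c : ℕ, Tendsto (fun d : ℕ => (d : ℝ≥0∞) ^ c * p d) atTop (𝓝 0)

/-- The heuristic assumption. At each application of the sieve, at radius at least `stopRadius`, the
two actual lists behave, for the sieve, as lists of independent uniformly random vectors from the
sphere of the current radius around `0` and around the target: what the sieve does with overwhelming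
probability on the random lists, it does with overwhelming probability on the actual lists, up to a
subexponential factor in its costs. -/
def ListsBehaveUniformly (I : ∀ d, CVPInstance d) : Prop :=
  ∃ e : ℕ → ℝ, e =o[atTop] (fun d => (d : ℝ)) ∧
    ∀ k : ℕ → ℕ, (∀ᶠ d in atTop, k d < (I d).numIter) →
      (∀ τ σ : ℕ → ℝ,
        Negligible (fun d => modelMeasure d
          {u | ¬ Productive (modelStep ((I d).radius (k d)) (I d).target u) (τ d) (σ d)}) →
        Negligible (fun d => (I d).prob fun l ω =>
          ¬ Productive ((I d).actualStep (k d) l ω) (2 ^ e d * τ d) (2 ^ e d * σ d))) ∧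
      (Negligible (fun d => modelMeasure d
          {u | ¬ (I d).Finds (modelStep ((I d).radius (k d)) (I d).target u)}) →
        Negligible (fun d => (I d).prob fun l ω => ¬ (I d).Finds ((I d).actualStep (k d) l ω)))

end Sieve

end

/-! ## A calculus for the cost model -/

namespace Alg

variable {α β σ : Type}

/-! By (H) and a union bound over polynomially many steps, everything reduces to one sieve step on
two lists of independent uniform unit vectors, and there to volumes on the sphere, taken up to
subexponential factors. A cap of angle 60° has measure (3/4)^(d/2) (`sphereUniform_cap_le`,
`le_sphereUniform_cap`); two such caps whose centres are 60° apart meet in a wedge of measure about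
(2/3)^(d/2) (`le_sphereUniform_wedge`).

With N = d⁴(4/3)^(d/2) vectors per list, every vector has neighbours slightly inside 60°, that is,
at distance at most γR. One difference for each of the N vectors, almost surely pairwise distinct,
refills the lists (`productive_of_typical`). A filter is itself a cap of angle 60°, so its bucket
holds only polynomially many vectors (`choose_mul_pow_le`), and one round costs (4/3)^(d/2)
(`cost_sieveRound`, `growth_roundTime`). List decoding does not spoil this: pruning follows only
branches that contain a solution, so its time is proportional to its output (`cost_search`). A close
pair shares a filter of one code with probability about (4/3)^(d/2)(2/3)^(d/2) = (8/9)^(d/2); hence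
slightly more than (9/8)^(d/2) rounds find it. The time is (9/8 · 4/3)^(d/2) = (3/2)^(d/2), while
all rounds reuse the same memory.

The words of a product code are not independent. But with probability at least 1/2 the random
rotation spreads x, y and x + y evenly over the blocks (`le_measure_balancedRotations`). Then the
wedge estimate applies in each block separately, and the blocks are independent
(`le_measure_goodWords`). The loss is exp(O(d^(7/10))), less than the surplus factor 2^(d^(3/4)) in
the number of rounds (`eventually_le_numRounds_mul`).

In the last step the radius is just above √(4/3) g. Among the N² pairs one has inner product at
least 13/20, by pairwise independence and Chebyshev's inequality (`listMeasure_prod_no_pair`), so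
some lattice vector lies within √(7/10) R of the target. Since √(7/10 · 4/3) < 1 and the distance to
the lattice is close to g, this vector is a closest one (`sqrt_mul_radius_le_dist`).

The lower bounds are deterministic: every round writes a bucket array with one cell per filter, and
the initial lists must be stored. -/

@[simp] lemma val_bind (x : Alg α) (f : α → Alg β) : (x >>= f).val = (f x.val).val := rfl
@[simp] lemma time_bind (x : Alg α) (f : α → Alg β) :
    (x >>= f).time = x.time + (f x.val).time := rfl
@[simp] lemma peak_bind (x : Alg α) (f : α → Alg β) :
    (x >>= f).peak = max x.peak (x.net + (f x.val).peak) := rfl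
@[simp] lemma net_bind (x : Alg α) (f : α → Alg β) :
    (x >>= f).net = x.net + (f x.val).net := rfl
@[simp] lemma val_pure (a : α) : (pure a : Alg α).val = a := rfl
@[simp] lemma time_pure (a : α) : (pure a : Alg α).time = 0 := rfl
@[simp] lemma peak_pure (a : α) : (pure a : Alg α).peak = 0 := rfl
@[simp] lemma net_pure (a : α) : (pure a : Alg α).net = 0 := rfl

/-- The computation takes time at most `t`, has peak at most `p` and net memory use exactly `n`. -/
structure Cost (x : Alg α) (t : ℕ) (p n : ℤ) : Prop where
  time_le : x.time ≤ t
  peak_le : x.peak ≤ p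
  net_eq : x.net = n

namespace Cost

lemma bind {x : Alg α} {f : α → Alg β} {t t' T : ℕ} {p p' P n n' k : ℤ} (hx : Cost x t p n)
    (hf : Cost (f x.val) t' p' n') (hT : t + t' ≤ T) (hp : p ≤ P) (hp' : n + p' ≤ P)
    (hn : n + n' = k) : Cost (x >>= f) T P k := by
  obtain ⟨a, b, c⟩ := hx
  obtain ⟨a', b', c'⟩ := hf
  exact ⟨by simp; omega, by simp; omega, by simp; omega⟩

lemma mono {x : Alg α} {t T : ℕ} {p P n k : ℤ} (hx : Cost x t p n) (hT : t ≤ T) (hp : p ≤ P)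
    (hn : n = k) : Cost x T P k :=
  ⟨hx.1.trans hT, hx.2.trans hp, hx.3.trans hn⟩

lemma pure (a : α) : Cost (Pure.pure a : Alg α) 0 0 0 := ⟨le_rfl, le_rfl, rfl⟩
lemma spend (n : ℕ) : Cost (Alg.spend n) n 0 0 := ⟨le_rfl, le_rfl, rfl⟩
lemma alloc (n : ℕ) : Cost (Alg.alloc n) n n n := ⟨le_rfl, le_rfl, rfl⟩
lemma free (n : ℕ) : Cost (Alg.free n) 0 0 (-n) := ⟨le_rfl, le_rfl, rfl⟩

end Cost

lemma val_foldlM (f : σ → α → Alg σ) (l : List α) (s : σ) :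
    (l.foldlM f s).val = l.foldl (fun s a => (f s a).val) s := by
  induction l generalizing s with
  | nil => rfl
  | cons a l ih => simp [ih]

/-- A loop with invariant `P` whose memory use is described by the potential `Φ`. -/
lemma Cost.foldlM {f : σ → α → Alg σ} {l : List α} (P : σ → Prop) (Φ : σ → ℤ) (c : α → ℕ) (B : ℤ)
    (hP : ∀ a ∈ l, ∀ s, P s → P (f s a).val)
    (hf : ∀ a ∈ l, ∀ s, P s → Cost (f s a) (c a) (B - Φ s) (Φ (f s a).val - Φ s))
    (hB : ∀ s, P s → Φ s ≤ B) (s : σ) (hs : P s) :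
    P (l.foldlM f s).val ∧
      Cost (l.foldlM f s) (l.map c).sum (B - Φ s) (Φ (l.foldlM f s).val - Φ s) := by
  induction l generalizing s with
  | nil =>
    refine ⟨hs, ?_⟩
    have := hB s hs
    exact (Cost.pure s).mono le_rfl (by omega) (by simp)
  | cons a l ih =>
    have h1 := hf a (by simp) s hs
    have h2 := hP a (by simp) s hs
    obtain ⟨h3, h4⟩ := ih (fun b hb => hP b (by simp [hb])) (fun b hb => hf b (by simp [hb]))
      (f s a).val h2
    rw [List.foldlM_cons]
    refine ⟨h3, h1.bind h4 (by simp) le_rfl (by omega) ?_⟩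
    simp only [val_bind]
    omega

/-- A loop each of whose passes leaves an amount of memory in use that depends only on the element
processed. -/
lemma Cost.foldlM_of_net {f : σ → α → Alg σ} {l : List α} (c n : α → ℕ) (q : ℕ)
    (hf : ∀ a ∈ l, ∀ s, Cost (f s a) (c a) (q + n a) (n a)) (s : σ) :
    Cost (l.foldlM f s) (l.map c).sum (q + (l.map n).sum : ℕ) ((l.map n).sum : ℕ) := by
  induction l generalizing s with
  | nil => exact (Cost.pure s).mono le_rfl (by positivity) (by simp)
  | cons a l ih =>
    rw [List.foldlM_cons]
    refine (hf a (by simp) s).bind (ih (fun b hb => hf b (by simp [hb])) _) (by simp) ?_ ?_ ?_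
    all_goals simp only [List.map_cons, List.sum_cons, Nat.cast_add]; try omega

end Alg

/-! ### Properties that a loop preserves or establishes -/

lemma List.foldl_preserves {α σ : Type} {f : σ → α → σ} {l : List α} {Q : σ → Prop}
    (h : ∀ a ∈ l, ∀ s, Q s → Q (f s a)) {s : σ} (hs : Q s) : Q (l.foldl f s) := by
  induction l generalizing s with
  | nil => exact hs
  | cons a l ih =>
    exact ih (fun b hb => h b (by simp [hb])) (h a (by simp) s hs)

/-- The pass over `a` produces `Q` whatever the state before it, and later passes keep it. `P` is a
side invariant on which both facts may depend. -/
lemma List.foldl_establishes {α σ : Type} {f : σ → α → σ} {l : List α} {P Q : σ → Prop}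
    (hP : ∀ a ∈ l, ∀ s, P s → P (f s a))
    (h : ∀ a ∈ l, ∀ s, P s → Q s → Q (f s a)) {a : α} (ha : a ∈ l)
    (hQ : ∀ s, P s → Q (f s a)) {s : σ} (hs : P s) : Q (l.foldl f s) := by
  induction l generalizing s with
  | nil => simp at ha
  | cons b l ih =>
    have hb := hP b (by simp) s hs
    rcases List.mem_cons.1 ha with rfl | ha
    · exact (List.foldl_preserves (Q := fun s => P s ∧ Q s)
        (fun b hb s hs => ⟨hP b (by simp [hb]) s hs.1, h b (by simp [hb]) s hs.1 hs.2⟩)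
        ⟨hb, hQ s hs⟩).2
    · exact ih (fun b hb => hP b (by simp [hb])) (fun b hb => h b (by simp [hb])) ha hb

lemma List.foldl_append_eq_flatMap {α β : Type} (F : α → List β) (l : List α) (s : List β) :
    l.foldl (fun acc a => F a ++ acc) s = l.reverse.flatMap F ++ s := by
  induction l generalizing s with
  | nil => simp
  | cons a l ih => simp [ih]

namespace Sieve

open Alg

/-! ## List decoding -/

section search

variable {β : Type}

lemma numEntries_cons (row : List (β × ℝ)) (rows) :
    numEntries (row :: rows) = row.length + numEntries rows := by
  simp [numEntries]

lemma maxSum_cons (row : List (β × ℝ)) (rows) :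
    maxSum (row :: rows) = row.foldr (fun p a => max p.2 a) (-1) + maxSum rows := by
  simp [maxSum]

open scoped Classical in
lemma val_search_cons (row : List (β × ℝ)) (rows) (τ : ℝ) :
    (search (row :: rows) τ).val = row.reverse.flatMap fun p =>
      if τ - p.2 ≤ maxSum rows then (search rows (τ - p.2)).val.map (p.1 :: ·) else [] := by
  rw [search, val_foldlM]
  have : ∀ (acc : List (List β)) (p : β × ℝ), ((do
        spend (numEntries rows + 3)
        if τ - p.2 ≤ maxSum rows then do
          let r ← search rows (τ - p.2)
          spend r.length
          pure (r.map (p.1 :: ·) ++ acc)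
        else pure acc : Alg (List (List β)))).val =
      (if τ - p.2 ≤ maxSum rows then (search rows (τ - p.2)).val.map (p.1 :: ·) else []) ++ acc := by
    intro acc p
    split_ifs <;> simp
  simp only [this]
  rw [List.foldl_append_eq_flatMap]
  simp

lemma le_foldr_max {row : List (β × ℝ)} {p : β × ℝ} (hp : p ∈ row) :
    p.2 ≤ row.foldr (fun p a => max p.2 a) (-1) := by
  induction row with
  | nil => simp at hp
  | cons q row ih =>
    rcases List.mem_cons.1 hp with rfl | hp
    · simp
    · simp [ih hp]

lemma exists_eq_foldr_max {row : List (β × ℝ)} (hrow : row ≠ []) (h : ∀ p ∈ row, -1 ≤ p.2) :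
    ∃ p ∈ row, row.foldr (fun p a => max p.2 a) (-1) = p.2 := by
  induction row with
  | nil => simp at hrow
  | cons q row ih =>
    by_cases hr : row = []
    · subst hr; exact ⟨q, by simp, by simpa using h q (by simp)⟩
    · obtain ⟨p, hp, hpe⟩ := ih hr fun p hp => h p (by simp [hp])
      rcases le_total q.2 p.2 with hq | hq
      · exact ⟨p, by simp [hp], by simp [hpe, hq]⟩
      · exact ⟨q, by simp, by simp [hpe, hq]⟩

/-- The pruning test is exact: no row is empty and no entry lies below the default -1, so the
maximum of each row is attained and the maximising choice is itself a solution. A branch that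
survives the test is therefore never a dead end. -/
lemma exists_mem_search {rows : List (List (β × ℝ))} (hne : ∀ row ∈ rows, row ≠ [])
    (h : ∀ row ∈ rows, ∀ p ∈ row, -1 ≤ p.2) {τ : ℝ} (hτ : τ ≤ maxSum rows) :
    (search rows τ).val ≠ [] := by
  induction rows generalizing τ with
  | nil =>
    have : τ ≤ 0 := by simpa [maxSum] using hτ
    simp [search, this]
  | cons row rows ih =>
    obtain ⟨p, hp, hpe⟩ := exists_eq_foldr_max (hne row (by simp)) (h row (by simp))
    rw [maxSum_cons, hpe] at hτ
    have h1 : τ - p.2 ≤ maxSum rows := by linarith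
    have := ih (fun r hr => hne r (by simp [hr])) (fun r hr => h r (by simp [hr])) h1
    rw [val_search_cons]
    obtain ⟨a, ha⟩ := List.exists_mem_of_ne_nil _ this
    intro h0
    rw [List.flatMap_eq_nil_iff] at h0
    have := h0 p (by simpa using hp)
    rw [if_pos h1] at this
    simp at this
    simp [this] at ha

/-- Every branch that is entered contains a solution (`exists_mem_search`), so the work can be
charged to the solutions. The entries that are tested and rejected cost only one scan of their row.
-/
lemma cost_search {rows : List (List (β × ℝ))} (hne : ∀ row ∈ rows, row ≠ [])
    (h : ∀ row ∈ rows, ∀ p ∈ row, -1 ≤ p.2) {n D : ℕ} (hn : ∀ row ∈ rows, row.length ≤ n)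
    (hD : n * (numEntries rows + 3) + 2 ≤ D) (τ : ℝ) :
    Cost (search rows τ) (2 ^ rows.length * D * (1 + (search rows τ).val.length)) 0 0 := by
  classical
  -- The -1 makes the induction close. If C is the constant for the shorter table, a surviving entry
  -- with L ≥ 1 solutions costs at most C(1 + L) + L ≤ (2C + 1)L besides its test, and 2C + 1 is the
  -- constant for the longer table.
  suffices hs : Cost (search rows τ)
      ((2 ^ rows.length * D - 1) * (1 + (search rows τ).val.length)) 0 0 from
    hs.mono (Nat.mul_le_mul_right _ (Nat.sub_le _ _)) le_rfl rfl
  induction rows generalizing τ with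
  | nil =>
    simp only [search, List.length_nil, pow_zero, one_mul]
    split_ifs <;>
    · refine (Cost.spend 1).bind (Cost.pure _) ?_ le_rfl le_rfl rfl
      simp
      omega
  | cons row rows ih =>
    have hne' : ∀ row ∈ rows, row ≠ [] := fun r hr => hne r (by simp [hr])
    have h' : ∀ row ∈ rows, ∀ p ∈ row, -1 ≤ p.2 := fun r hr => h r (by simp [hr])
    rw [numEntries_cons] at hD
    have hD' : n * (numEntries rows + 3) + 2 ≤ D := by nlinarith
    have ih := ih hne' h' (fun r hr => hn r (by simp [hr])) hD'
    set C := 2 ^ rows.length * D - 1 with hC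
    have hpos : 1 ≤ 2 ^ rows.length * D := Nat.mul_pos (by positivity) (by omega)
    have hCs : 2 ^ (row :: rows).length * D - 1 = 2 * C + 1 := by
      rw [List.length_cons, pow_succ, mul_right_comm]; omega
    set F : β × ℝ → List (List β) := fun p =>
      if τ - p.2 ≤ maxSum rows then (search rows (τ - p.2)).val.map (p.1 :: ·) else [] with hF
    have hval : (search (row :: rows) τ).val = row.reverse.flatMap F := val_search_cons row rows τ
    have key := Cost.foldlM (l := row) (f := fun acc p => (do
        spend (numEntries rows + 3)
        if τ - p.2 ≤ maxSum rows then do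
          let r ← search rows (τ - p.2)
          spend r.length
          pure (r.map (p.1 :: ·) ++ acc)
        else pure acc : Alg (List (List β)))) (fun _ => True) (fun _ => 0)
        (fun p => numEntries rows + 3 + (2 * C + 1) * (F p).length) 0 (by simp) ?_ (by simp) []
        trivial
    · rw [search]
      refine key.2.mono ?_ (by simp) (by simp)
      rw [← search, hval, hCs]
      have hl : (row.reverse.flatMap F).length = (row.map fun p => (F p).length).sum := by
        simp [List.length_flatMap, List.sum_reverse]
      rw [hl, List.sum_map_add, List.sum_map_mul_left, List.map_const', List.sum_replicate,
        mul_add, mul_one, smul_eq_mul]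
      gcongr
      have hr := hn row (by simp)
      have h1 : row.length * (numEntries rows + 3) ≤ n * (numEntries rows + 3) :=
        Nat.mul_le_mul_right _ hr
      have h2 : D - 1 ≤ C := by
        rw [hC]; exact Nat.sub_le_sub_right (Nat.le_mul_of_pos_left _ (by positivity)) _
      omega
    · intro p hp acc _
      simp only [hF]
      by_cases hc : τ - p.2 ≤ maxSum rows
      · have h1 := exists_mem_search hne' h' hc
        have h2 : 1 ≤ (search rows (τ - p.2)).val.length := List.length_pos_of_ne_nil h1
        simp only [if_pos hc, List.length_map]
        refine (Cost.spend _).bind ((ih (τ - p.2)).bind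
          ((Cost.spend _).bind (Cost.pure _) le_rfl le_rfl le_rfl rfl)
          le_rfl le_rfl le_rfl rfl) ?_ (by simp) (by simp) (by simp)
        nlinarith
      · simp only [if_neg hc]
        exact (Cost.spend _).bind (Cost.pure _) (by simp) (by simp) (by simp) (by simp)

/-- The tables that are searched: row `i` lists the values `g i b` of the words `b`. -/
noncomputable def tableOf {ι : Type} (g : ι → β → ℝ) (is : List ι) (bs : List β) : List (List (β × ℝ)) :=
  is.map fun i => bs.map fun b => (b, g i b)

lemma mem_search_tableOf {ι : Type} (g : ι → β → ℝ) (is : List ι) (bs : List β) (τ : ℝ)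
    (a : List β) : a ∈ (search (tableOf g is bs) τ).val ↔
      a.length = is.length ∧ (∀ b ∈ a, b ∈ bs) ∧ τ ≤ (List.zipWith g is a).sum := by
  induction is generalizing τ a with
  | nil =>
    by_cases hτ : τ ≤ 0
    · simp only [tableOf, List.map_nil, search, val_bind, if_pos hτ, val_pure, List.mem_singleton,
        List.length_nil, List.length_eq_zero_iff]
      constructor
      · rintro rfl; simpa using hτ
      · exact fun h => h.1
    · simp only [tableOf, List.map_nil, search, val_bind, if_neg hτ, val_pure, List.not_mem_nil,
        List.length_nil, List.length_eq_zero_iff, false_iff, not_and]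
      rintro rfl; simpa using hτ
  | cons i is ih =>
    -- Pruning loses nothing: `maxSum` bounds the sum of every choice of one entry per row.
    have hb : ∀ a τ, a ∈ (search (tableOf g is bs) τ).val → τ ≤ maxSum (tableOf g is bs) := by
      intro a τ ha
      rw [ih] at ha
      refine ha.2.2.trans ?_
      have hl := ha.1
      have hm := ha.2.1
      clear ha ih
      induction is generalizing a with
      | nil => simp [tableOf, maxSum]
      | cons j is ih' =>
        match a, hl with
        | b :: a, hl =>
          have := ih' a (by simpa using hl) (fun b hb => hm b (by simp [hb]))
          simp only [tableOf, List.map_cons] at this ⊢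
          rw [maxSum_cons, List.zipWith_cons_cons, List.sum_cons]
          refine add_le_add ?_ this
          exact le_foldr_max (p := (b, g j b)) (List.mem_map.2 ⟨b, hm b (by simp), rfl⟩)
    have : tableOf g (i :: is) bs = (bs.map fun b => (b, g i b)) :: tableOf g is bs := rfl
    rw [this, val_search_cons, List.mem_flatMap]
    simp only [List.mem_reverse, List.mem_map, exists_exists_and_eq_and]
    constructor
    · rintro ⟨b, hbm, hab⟩
      split_ifs at hab with hc
      · obtain ⟨a', ha', rfl⟩ := List.mem_map.1 hab
        obtain ⟨h1, h2, h3⟩ := (ih _ _).1 ha'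
        refine ⟨by simpa using h1, by simpa [hbm] using h2, ?_⟩
        rw [List.zipWith_cons_cons, List.sum_cons]
        linarith
      · simp at hab
    · rintro ⟨h1, h2, h3⟩
      match a, h1 with
      | b :: a, h1 =>
        rw [List.zipWith_cons_cons, List.sum_cons] at h3
        have ha : a ∈ (search (tableOf g is bs) (τ - g i b)).val :=
          (ih _ _).2 ⟨by simpa using h1, fun b hb => h2 b (by simp [hb]), by linarith⟩
        refine ⟨b, h2 b (by simp), ?_⟩
        rw [if_pos (hb _ _ ha)]
        exact List.mem_map.2 ⟨a, ha, rfl⟩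

/-- Needed so that a vector enters a bucket at most once, and bucket sizes count positions of the
list. -/
lemma nodup_search_tableOf {ι : Type} (g : ι → β → ℝ) (is : List ι) {bs : List β} (hbs : bs.Nodup)
    (τ : ℝ) : (search (tableOf g is bs) τ).val.Nodup := by
  classical
  induction is generalizing τ with
  | nil =>
    simp only [tableOf, List.map_nil, search, val_bind]
    split_ifs <;> simp
  | cons i is ih =>
    have : tableOf g (i :: is) bs = (bs.map fun b => (b, g i b)) :: tableOf g is bs := rfl
    rw [this, val_search_cons, List.nodup_flatMap]
    constructor
    · intro p _
      split_ifs
      · exact (ih _).map (List.cons_injective)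
      · simp
    · rw [List.pairwise_reverse, List.pairwise_map]
      refine hbs.imp ?_
      intro b c hbc
      simp only [Function.onFun]
      intro x hx hy
      split_ifs at hx hy <;> simp at hx hy
      obtain ⟨u, -, rfl⟩ := hx
      obtain ⟨v, -, h⟩ := hy
      exact hbc (List.cons.inj h).1

end search

/-! ## Filters and buckets -/

section filters

variable {d : ℕ}

/-- The values by which the search for filters that accept the direction of `v` is guided. -/
noncomputable def partValue (ω : RoundCoins d) (v : E d) (i : Fin (numBlocks d)) (b : Fin (blockSize d)) : ℝ :=
  inner ℝ (normalized v) (codePart ω i b)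

/-- The addresses of the filters that accept the direction of `v`. -/
noncomputable def accepting (ω : RoundCoins d) (v : E d) : List (Address d) := (decode ω v).val

lemma accepting_eq (ω : RoundCoins d) (v : E d) :
    accepting ω v = (search (tableOf (partValue ω v) (List.finRange (numBlocks d))
      (List.finRange (blockSize d))) filterThreshold).val := rfl

lemma nodup_accepting (ω : RoundCoins d) (v : E d) : (accepting ω v).Nodup :=
  nodup_search_tableOf _ _ (List.nodup_finRange _) _

lemma _root_.List.zipWith_finRange_ofFn {n : ℕ} {β γ : Type} (g : Fin n → β → γ) (f : Fin n → β) :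
    List.zipWith g (List.finRange n) (List.ofFn f) = List.ofFn fun i => g i (f i) := by
  refine List.ext_getElem (by simp) fun i h1 h2 => by simp

lemma mem_accepting (ω : RoundCoins d) (v : E d) (a : Address d) :
    a ∈ accepting ω v ↔ ∃ β : Fin (numBlocks d) → Fin (blockSize d), a = List.ofFn β ∧
      1 / 2 ≤ ∑ i, partValue ω v i (β i) := by
  rw [accepting_eq, mem_search_tableOf, List.length_finRange]
  constructor
  · rintro ⟨h1, -, h3⟩
    refine ⟨fun i => a.get (i.cast h1.symm), ?_, ?_⟩
    · refine List.ext_getElem (by simp [h1]) fun i h1 h2 => by simp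
    · have : a = List.ofFn fun i => a.get (i.cast h1.symm) :=
        List.ext_getElem (by simp [h1]) fun i h1 h2 => by simp
      rw [this, List.zipWith_finRange_ofFn, List.sum_ofFn] at h3
      exact h3
  · rintro ⟨β, rfl, h⟩
    refine ⟨by simp, by simp, ?_⟩
    rwa [List.zipWith_finRange_ofFn, List.sum_ofFn]

/-- All addresses. -/
noncomputable def addresses (d : ℕ) : Finset (Address d) :=
  (Finset.univ : Finset (Fin (numBlocks d) → Fin (blockSize d))).map
    ⟨List.ofFn, List.ofFn_injective⟩

lemma card_addresses : (addresses d).card = blockSize d ^ numBlocks d := by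
  simp [addresses]

lemma mem_addresses_of_mem_accepting {ω : RoundCoins d} {v : E d} {a : Address d}
    (h : a ∈ accepting ω v) : a ∈ addresses d := by
  obtain ⟨β, rfl, -⟩ := (mem_accepting ω v a).1 h
  simp [addresses]

open scoped Classical in
lemma length_accepting (ω : RoundCoins d) (v : E d) :
    (accepting ω v).length = ∑ a ∈ addresses d, if a ∈ accepting ω v then 1 else 0 := by
  rw [← List.toFinset_card_of_nodup (nodup_accepting ω v), Finset.card_eq_sum_ones,
    ← Finset.sum_filter]
  refine Finset.sum_congr ?_ fun _ _ => rfl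
  ext a
  simp only [List.mem_toFinset, Finset.mem_filter]
  exact ⟨fun h => ⟨mem_addresses_of_mem_accepting h, h⟩, fun h => h.2⟩

lemma length_accepting_le (ω : RoundCoins d) (v : E d) :
    (accepting ω v).length ≤ blockSize d ^ numBlocks d := by
  classical
  rw [length_accepting, ← card_addresses, Finset.card_eq_sum_ones]
  exact Finset.sum_le_sum fun a _ => by split_ifs <;> simp

open scoped Classical in
/-- The number of vectors of a list that a filter accepts. -/
noncomputable def bucketSize (ω : RoundCoins d) (l : List (E d)) (a : Address d) : ℕ :=
  l.countP fun w => a ∈ accepting ω w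

/-- Double counting of the incidences between vectors and filters. -/
lemma sum_length_accepting_le (ω : RoundCoins d) (l : List (E d)) {s : ℕ}
    (hs : ∀ a, bucketSize ω l a ≤ s) :
    (l.map fun w => (accepting ω w).length).sum ≤ s * blockSize d ^ numBlocks d := by
  classical
  have h1 : (l.map fun w => (accepting ω w).length).sum = ∑ a ∈ addresses d, bucketSize ω l a := by
    clear hs
    induction l with
    | nil => simp [bucketSize]
    | cons w l ih =>
      rw [List.map_cons, List.sum_cons, ih, length_accepting, ← Finset.sum_add_distrib]
      refine Finset.sum_congr rfl fun a _ => ?_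
      simp only [bucketSize, List.countP_cons, decide_eq_true_eq]
      omega
  rw [h1, mul_comm, ← card_addresses, ← smul_eq_mul]
  exact Finset.sum_le_card_nsmul _ _ _ fun a _ => hs a

lemma norm_normalized_le (v : E d) : ‖normalized v‖ ≤ 1 := by
  rw [normalized, norm_smul, norm_inv, norm_norm]
  exact inv_mul_le_one

/-- The normalized Gram–Schmidt vectors are orthogonal and each has length 1 or, in degenerate
cases, 0. The inequality thus holds for every outcome of the coins, and cost bounds need no
exceptional null set. -/
lemma norm_sum_gramSchmidtNormed_sq_le (f : Fin d → E d) (x : E d) :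
    ‖∑ j, x j • InnerProductSpace.gramSchmidtNormed ℝ f j‖ ^ 2 ≤ ‖x‖ ^ 2 := by
  rw [← real_inner_self_eq_norm_sq, EuclideanSpace.real_norm_sq_eq, sum_inner]
  refine Finset.sum_le_sum fun i _ => ?_
  rw [inner_sum, Finset.sum_eq_single i]
  · rw [real_inner_smul_left, real_inner_smul_right, real_inner_self_eq_norm_sq]
    have : ‖InnerProductSpace.gramSchmidtNormed ℝ f i‖ ≤ 1 := by
      by_cases h : InnerProductSpace.gramSchmidtNormed ℝ f i = 0
      · simp [h]
      · exact (InnerProductSpace.gramSchmidtNormed_unit_length' h).le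
    have h2 : ‖InnerProductSpace.gramSchmidtNormed ℝ f i‖ ^ 2 ≤ 1 :=
      pow_le_one₀ (norm_nonneg _) this
    nlinarith [sq_nonneg (x i)]
  · intro j _ hj
    rw [real_inner_smul_left, real_inner_smul_right]
    have : inner ℝ (InnerProductSpace.gramSchmidtNormed ℝ f i)
        (InnerProductSpace.gramSchmidtNormed ℝ f j) = 0 := by
      simp [InnerProductSpace.gramSchmidtNormed, real_inner_smul_left, real_inner_smul_right,
        InnerProductSpace.gramSchmidt_orthogonal ℝ f hj.symm]
    simp [this]
  · simp

lemma numBlocks_pos : 0 < numBlocks d := Nat.succ_pos _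

lemma norm_codePart_le (ω : RoundCoins d) (i : Fin (numBlocks d)) (b : Fin (blockSize d)) :
    ‖codePart ω i b‖ ≤ 1 := by
  rw [codePart, norm_smul, norm_inv, Real.norm_of_nonneg (Real.sqrt_nonneg _)]
  have h1 : ‖∑ j : Fin d, (blockWord i (ω.2 i b)) j •
      InnerProductSpace.gramSchmidtNormed ℝ ω.1 j‖ ≤ 1 := by
    have h2 := norm_sum_gramSchmidtNormed_sq_le ω.1 (blockWord i (ω.2 i b))
    exact (pow_le_pow_iff_left₀ (norm_nonneg _) (norm_nonneg _) two_ne_zero).1 h2 |>.trans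
      (norm_normalized_le _)
  have h3 : (1 : ℝ) ≤ Real.sqrt (numBlocks d) :=
    Real.one_le_sqrt.2 (by exact_mod_cast numBlocks_pos)
  exact mul_le_one₀ (inv_le_one_of_one_le₀ h3) (norm_nonneg _) h1

/-- Matches the default value -1 in `maxSum`; this is what makes pruning exact. -/
lemma neg_one_le_partValue (ω : RoundCoins d) (v : E d) (i : Fin (numBlocks d))
    (b : Fin (blockSize d)) : -1 ≤ partValue ω v i b := by
  have h1 := abs_real_inner_le_norm (normalized v) (codePart ω i b)
  have h2 : ‖normalized v‖ * ‖codePart ω i b‖ ≤ 1 :=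
    mul_le_one₀ (norm_normalized_le v) (norm_nonneg _) (norm_codePart_le ω i b)
  exact (abs_le.1 (h1.trans h2)).1

lemma blockSize_pos : 0 < blockSize d := Nat.ceil_pos.2 (by positivity)

/-- The time per reported filter that list decoding takes, up to polynomial factors. -/
noncomputable def decodeTime (d : ℕ) : ℕ :=
  2 ^ numBlocks d * (blockSize d * (numBlocks d * blockSize d + 3) + 2) +
    4 * d + (2 * d + 2) * (numBlocks d * blockSize d) + numBlocks d

lemma cost_decode (ω : RoundCoins d) (v : E d) :
    Cost (decode ω v) (decodeTime d * (1 + (accepting ω v).length))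
      (d + numBlocks d * blockSize d + numBlocks d * (accepting ω v).length)
      (numBlocks d * (accepting ω v).length) := by
  have hlen : numEntries (tableOf (partValue ω v) (List.finRange (numBlocks d))
      (List.finRange (blockSize d))) = numBlocks d * blockSize d := by
    simp [numEntries, tableOf, Function.comp_def]
  obtain ⟨h1, h2, h3⟩ := cost_search (rows := tableOf (partValue ω v)
    (List.finRange (numBlocks d)) (List.finRange (blockSize d))) (n := blockSize d)
    (D := blockSize d * (numBlocks d * blockSize d + 3) + 2)
    (by simp [tableOf, blockSize_pos.ne'])
    (by
      intro row hrow p hp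
      obtain ⟨i, -, rfl⟩ := List.mem_map.1 hrow
      obtain ⟨b, -, rfl⟩ := List.mem_map.1 hp
      exact neg_one_le_partValue ω v i b)
    (by simp [tableOf]) (by rw [hlen]) filterThreshold
  rw [← accepting_eq, show (tableOf (partValue ω v) (List.finRange (numBlocks d))
      (List.finRange (blockSize d))).length = numBlocks d by simp [tableOf]] at h1
  set S := search (tableOf (partValue ω v) (List.finRange (numBlocks d))
    (List.finRange (blockSize d))) filterThreshold with hS
  have hA : S.val = accepting ω v := rfl
  -- The three components of the cost are computed literally, since the value of the search occurs
  -- in the memory that is allocated after it.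
  have ht : (decode ω v).time = (3 * d + 2 * d * numBlocks d * blockSize d) +
      ((d + numBlocks d * blockSize d) + (S.time + (numBlocks d * S.val.length + (0 + 0)))) := rfl
  have hn : (decode ω v).net = 0 + (((d + numBlocks d * blockSize d : ℕ) : ℤ) +
      (S.net + (((numBlocks d * S.val.length : ℕ) : ℤ) +
      (-((d + numBlocks d * blockSize d : ℕ) : ℤ) + 0)))) := rfl
  have hp : (decode ω v).peak = max 0 (0 + max ((d + numBlocks d * blockSize d : ℕ) : ℤ)
      (((d + numBlocks d * blockSize d : ℕ) : ℤ) + max S.peak (S.net +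
      max ((numBlocks d * S.val.length : ℕ) : ℤ) (((numBlocks d * S.val.length : ℕ) : ℤ) +
      max 0 (-((d + numBlocks d * blockSize d : ℕ) : ℤ) + 0))))) := rfl
  rw [hA] at ht hn hp
  refine ⟨?_, ?_, ?_⟩
  · rw [ht, decodeTime]
    set L := (accepting ω v).length
    set m := numBlocks d
    set M := blockSize d
    have : 2 ^ m * (M * (m * M + 3) + 2) * (1 + L) + (4 * d + (2 * d + 2) * (m * M) + m) * (1 + L) =
      (2 ^ m * (M * (m * M + 3) + 2) + 4 * d + (2 * d + 2) * (m * M) + m) * (1 + L) := by ring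
    rw [← this]
    have h4 : 4 * d + (2 * d + 2) * (m * M) + m * L ≤
        (4 * d + (2 * d + 2) * (m * M) + m) * (1 + L) := by
      nlinarith [Nat.zero_le (4 * d * L), Nat.zero_le ((2 * d + 2) * (m * M) * L)]
    nlinarith
  · rw [hp]; push_cast; have : (0:ℤ) ≤ numBlocks d * (accepting ω v).length := by positivity
    have : (0:ℤ) ≤ numBlocks d * blockSize d := by positivity
    omega
  · rw [hn]; push_cast; omega

/-! ### Filling the buckets -/

/-- The effect of recording a vector in a bucket. -/
lemma cost_insertVector (ω : RoundCoins d) (T : Buckets d × ℕ) (w : E d) :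
    (insertVector ω T w).val.2 = T.2 + (accepting ω w).length ∧
      (∀ a, (insertVector ω T w).val.1 a = if a ∈ accepting ω w then w :: T.1 a else T.1 a) ∧
      Cost (insertVector ω T w)
        ((decodeTime d + numBlocks d + 1) * (1 + (accepting ω w).length))
        (d + numBlocks d * blockSize d + (numBlocks d + 1) * (accepting ω w).length)
        (accepting ω w).length := by
  classical
  set step : Buckets d × ℕ → Address d → Alg (Buckets d × ℕ) := fun T a => do
    spend (numBlocks d)
    alloc 1
    pure (Function.update T.1 a (w :: T.1 a), T.2 + 1) with hstep
  have hval : (insertVector ω T w).val =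
      (accepting ω w).foldl (fun T a => (Function.update T.1 a (w :: T.1 a), T.2 + 1)) T := by
    have : (insertVector ω T w).val = ((accepting ω w).foldlM step T).val := by
      unfold insertVector; rfl
    rw [this, val_foldlM]
    rfl
  have hfold : ∀ (l : List (Address d)), l.Nodup → ∀ T : Buckets d × ℕ,
      (l.foldl (fun T a => (Function.update T.1 a (w :: T.1 a), T.2 + 1)) T).2 = T.2 + l.length ∧
      ∀ a, (l.foldl (fun (T : Buckets d × ℕ) a =>
        (Function.update T.1 a (w :: T.1 a), T.2 + 1)) T).1 a =
          if a ∈ l then w :: T.1 a else T.1 a := by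
    intro l hl
    induction l with
    | nil => simp
    | cons b l ih =>
      intro T
      obtain ⟨h1, h2⟩ := ih hl.of_cons (Function.update T.1 b (w :: T.1 b), T.2 + 1)
      have hb : b ∉ l := (List.nodup_cons.1 hl).1
      rw [List.foldl_cons]
      refine ⟨by rw [h1, List.length_cons]; dsimp only; omega, fun a => ?_⟩
      rw [h2]
      by_cases hab : a = b
      · subst hab; simp [hb]
      · simp [hab]
  obtain ⟨h2, h1⟩ := hfold _ (nodup_accepting ω w) T
  rw [hval]
  refine ⟨h2, h1, ?_⟩
  have hloop := Cost.foldlM_of_net (l := accepting ω w) (f := step) (fun _ => numBlocks d + 1)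
    (fun _ => 1) 0 (fun a _ s => (Cost.spend _).bind ((Cost.alloc 1).bind (Cost.pure _) le_rfl
      (P := 1) le_rfl (by simp) rfl) (by simp) (by simp) (by simp) (by simp)) T
  simp only [List.map_const', List.sum_replicate, smul_eq_mul, mul_one, zero_add] at hloop
  have hdec := cost_decode ω w
  unfold insertVector
  refine hdec.bind (hloop.bind ((Cost.free _).bind (Cost.pure _) le_rfl (p := 0) (P := 0) le_rfl
    ?_ rfl) le_rfl (P := (accepting ω w).length) le_rfl ?_ rfl) ?_ ?_ ?_ ?_
  · simp
    positivity
  · simp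
  · have : (decodeTime d + numBlocks d + 1) * (1 + (accepting ω w).length) =
      decodeTime d * (1 + (accepting ω w).length) + (numBlocks d + 1) * (1 + (accepting ω w).length)
      := by ring
    rw [this]
    nlinarith
  · have : (0 : ℤ) ≤ (accepting ω w).length := by positivity
    have hd : (0 : ℤ) ≤ numBlocks d * blockSize d := by positivity
    linarith
  · have hd : (0 : ℤ) ≤ numBlocks d * blockSize d := by positivity
    linarith
  · simp only [accepting]; push_cast; ring

lemma cost_insertVectors (ω : RoundCoins d) (l : List (E d)) :
    (l.foldlM (insertVector ω) ((fun _ => [], 0) : Buckets d × ℕ)).val.2 =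
        (l.map fun w => (accepting ω w).length).sum ∧
      (∀ a, (l.foldlM (insertVector ω) ((fun _ => [], 0) : Buckets d × ℕ)).val.1 a =
        (l.filter fun w => a ∈ accepting ω w).reverse) ∧
      Cost (l.foldlM (insertVector ω) ((fun _ => [], 0) : Buckets d × ℕ))
        ((decodeTime d + numBlocks d + 1) *
          (l.length + (l.map fun w => (accepting ω w).length).sum))
        (d + numBlocks d * blockSize d + numBlocks d * blockSize d ^ numBlocks d +
          (l.map fun w => (accepting ω w).length).sum)
        (l.map fun w => (accepting ω w).length).sum := by
  classical
  have hfold : ∀ T : Buckets d × ℕ, (l.foldlM (insertVector ω) T).val.2 =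
        T.2 + (l.map fun w => (accepting ω w).length).sum ∧
      (∀ a, (l.foldlM (insertVector ω) T).val.1 a =
        (l.filter fun w => a ∈ accepting ω w).reverse ++ T.1 a) := by
    induction l with
    | nil => simp
    | cons w l ih =>
      intro T
      obtain ⟨h1, h2, -⟩ := cost_insertVector ω T w
      obtain ⟨h3, h4⟩ := ih (insertVector ω T w).val
      rw [List.foldlM_cons, val_bind]
      refine ⟨by rw [h3, h1, List.map_cons, List.sum_cons]; omega, fun a => ?_⟩
      rw [h4, h2, List.filter_cons]
      by_cases ha : a ∈ accepting ω w <;> simp [ha]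
  refine ⟨by simpa using (hfold (fun _ => [], 0)).1,
    fun a => by simpa using (hfold (fun _ => [], 0)).2 a, ?_⟩
  have := Cost.foldlM_of_net (l := l) (f := insertVector ω)
    (fun w => (decodeTime d + numBlocks d + 1) * (1 + (accepting ω w).length))
    (fun w => (accepting ω w).length)
    (d + numBlocks d * blockSize d + numBlocks d * blockSize d ^ numBlocks d)
    (fun w _ T => (cost_insertVector ω T w).2.2.mono le_rfl (by
      have h : (((accepting ω w).length : ℕ) : ℤ) ≤ ((blockSize d ^ numBlocks d : ℕ) : ℤ) :=
        Int.ofNat_le.2 (length_accepting_le ω w)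
      have := mul_le_mul_of_nonneg_left h (Int.natCast_nonneg (numBlocks d))
      push_cast at this ⊢
      linarith) rfl) ((fun _ => [], 0) : Buckets d × ℕ)
  refine this.mono ?_ (by push_cast; rfl) rfl
  rw [List.sum_map_mul_left, List.sum_map_add]
  simp

open scoped Classical in
lemma length_bucket (ω : RoundCoins d) (l : List (E d)) (a : Address d) :
    ((l.foldlM (insertVector ω) ((fun _ => [], 0) : Buckets d × ℕ)).val.1 a).length =
      bucketSize ω l a := by
  rw [(cost_insertVectors ω l).2.1, List.length_reverse, bucketSize, List.countP_eq_length_filter]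

lemma mem_bucket (ω : RoundCoins d) (l : List (E d)) (a : Address d) (w : E d) :
    w ∈ (l.foldlM (insertVector ω) ((fun _ => [], 0) : Buckets d × ℕ)).val.1 a ↔
      w ∈ l ∧ a ∈ accepting ω w := by
  rw [(cost_insertVectors ω l).2.1]
  simp

/-! ### Processing candidates -/

lemma val_forCandidates {σ : Type} (ω : RoundCoins d) (T : Buckets d) (v : E d) (s : σ)
    (f : σ → E d → Alg σ) : (forCandidates ω T v s f).val =
      (accepting ω v).foldl (fun s a => (T a).foldl (fun s w => (f s w).val) s) s := by
  have : (forCandidates ω T v s f).val = ((accepting ω v).foldlM (fun s a => do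
    spend (numBlocks d)
    (T a).foldlM f s) s).val := by unfold forCandidates; rfl
  rw [this, val_foldlM]
  simp [val_foldlM]

lemma forCandidates_preserves {σ : Type} {ω : RoundCoins d} {T : Buckets d} {v : E d} {s : σ}
    {f : σ → E d → Alg σ} {P : σ → Prop}
    (hP : ∀ a, ∀ w ∈ T a, ∀ s, P s → P (f s w).val) (hs : P s) :
    P (forCandidates ω T v s f).val := by
  rw [val_forCandidates]
  exact List.foldl_preserves (fun a _ s hs => List.foldl_preserves (fun w hw => hP a w hw) hs) hs

lemma forCandidates_establishes {σ : Type} {ω : RoundCoins d} {T : Buckets d} {v : E d} {s : σ}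
    {f : σ → E d → Alg σ} {P Q : σ → Prop} (hP : ∀ a, ∀ w ∈ T a, ∀ s, P s → P (f s w).val)
    (h : ∀ a, ∀ w ∈ T a, ∀ s, P s → Q s → Q (f s w).val) {a : Address d} (ha : a ∈ accepting ω v)
    {w : E d} (hw : w ∈ T a) (hQ : ∀ s, P s → Q (f s w).val) (hs : P s) :
    Q (forCandidates ω T v s f).val := by
  rw [val_forCandidates]
  refine List.foldl_establishes (P := P)
    (fun a _ s hs => List.foldl_preserves (fun w hw => hP a w hw) hs) ?_ ha ?_ hs
  · intro a _ s hs hq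
    exact (List.foldl_preserves (Q := fun s => P s ∧ Q s)
      (fun w hw s hs => ⟨hP a w hw s hs.1, h a w hw s hs.1 hs.2⟩) ⟨hs, hq⟩).2
  · intro s hs
    exact List.foldl_establishes (P := P) (fun w hw => hP a w hw) (h a) hw hQ hs

/-- The potential `Φ` counts the cells of the state and never exceeds `B`. On top of it come the
table for decoding and the addresses, which stay in memory during the loop; there are at most as
many of them as filters. -/
lemma cost_forCandidates {σ : Type} {ω : RoundCoins d} {T : Buckets d} (v : E d) {s : σ}
    {f : σ → E d → Alg σ} (P : σ → Prop) (Φ : σ → ℤ) (B : ℤ) {c k : ℕ}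
    (hT : ∀ a, (T a).length ≤ k)
    (hP : ∀ a, ∀ w ∈ T a, ∀ s, P s → P (f s w).val)
    (hf : ∀ a, ∀ w ∈ T a, ∀ s, P s → Cost (f s w) c (B - Φ s) (Φ (f s w).val - Φ s))
    (hB : ∀ s, P s → Φ s ≤ B) (hs : P s) :
    Cost (forCandidates ω T v s f)
      ((decodeTime d + numBlocks d + c * k) * (1 + (accepting ω v).length))
      (B + (d + numBlocks d * blockSize d + numBlocks d * blockSize d ^ numBlocks d) - Φ s)
      (Φ (forCandidates ω T v s f).val - Φ s) := by
  have hloop := (Cost.foldlM (l := accepting ω v) (f := fun s a => do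
    spend (numBlocks d)
    (T a).foldlM f s) P Φ (fun _ => numBlocks d + c * k) B
    (fun a _ s hs => by
      rw [val_bind, val_foldlM]
      exact List.foldl_preserves (hP a) hs)
    (fun a _ s hs => by
      have := (Cost.foldlM P Φ (fun _ => c) B (hP a) (hf a) hB s hs).2
      refine (Cost.spend _).bind this ?_ ?_ (by simp) (by simp)
      · simp only [List.map_const', List.sum_replicate, smul_eq_mul]
        have := Nat.mul_le_mul_left c (hT a)
        linarith
      · have := hB s hs; omega) hB s hs).2
  simp only [List.map_const', List.sum_replicate, smul_eq_mul] at hloop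
  have hdec := cost_decode ω v
  have hL : (((accepting ω v).length : ℕ) : ℤ) ≤ ((blockSize d ^ numBlocks d : ℕ) : ℤ) :=
    Int.ofNat_le.2 (length_accepting_le ω v)
  have hL' := mul_le_mul_of_nonneg_left hL (Int.natCast_nonneg (numBlocks d))
  have hBs := hB s hs
  have hd : (0 : ℤ) ≤ numBlocks d * blockSize d := by positivity
  push_cast at hL'
  have hval : ((forCandidates ω T v s f).val : σ) = ((accepting ω v).foldlM (fun s a => do
    spend (numBlocks d)
    (T a).foldlM f s) s).val := by unfold forCandidates; rfl
  rw [hval]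
  unfold forCandidates
  refine hdec.bind (hloop.bind ((Cost.free _).bind (Cost.pure _) le_rfl (p := 0) (P := 0) le_rfl
    ?_ rfl) le_rfl (P := max (B - Φ s) (Φ ((accepting ω v).foldlM (fun s a => do
    spend (numBlocks d)
    (T a).foldlM f s) s).val - Φ s)) (le_max_left _ _) ?_ rfl) ?_ ?_ ?_ ?_
  · simp
    positivity
  · rw [add_zero]; exact le_max_right _ _
  · simp only [add_zero]
    nlinarith [Nat.zero_le (numBlocks d + c * k)]
  · linarith
  · have : Φ ((accepting ω v).foldlM (fun s a => do
      spend (numBlocks d)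
      (T a).foldlM f s) s).val ≤ B := by
      apply hB
      rw [val_foldlM]
      refine List.foldl_preserves (fun a _ s hs => ?_) hs
      rw [val_bind, val_foldlM]
      exact List.foldl_preserves (hP a) hs
    rw [max_eq_left (by linarith)]
    linarith
  · simp only [accepting]; push_cast; ring

end filters

end Sieve

namespace Sieve

open Alg

/-! ## The sieve step -/

section step

variable {d : ℕ}

/-- Both lists have at most the intended size. -/
noncomputable def Fits (s : State d) : Prop := s.zero.length ≤ listSize d ∧ s.target.length ≤ listSize d

/-- The number of cells that the lists occupy. -/
noncomputable def cells (s : State d) : ℤ := d * (s.zero.length + s.target.length)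

lemma cells_le {s : State d} (hs : Fits s) : cells s ≤ 2 * d * listSize d := by
  have h1 : (s.zero.length : ℤ) ≤ listSize d := by exact_mod_cast hs.1
  have h2 : (s.target.length : ℤ) ≤ listSize d := by exact_mod_cast hs.2
  have := mul_le_mul_of_nonneg_left (add_le_add h1 h2) (Int.natCast_nonneg d)
  rw [cells]; linarith

lemma cells_nonneg (s : State d) : 0 ≤ cells s := by rw [cells]; positivity

/-- The time for one pair of vectors. -/
noncomputable def pairTime (d : ℕ) : ℕ := 9 * d + 3 + d * (Nat.log 2 (listSize d) + 2)

open scoped Classical in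
lemma val_addVector (L : List (E d)) (w : E d) : (addVector L w).val =
    if w ∈ L ∨ listSize d ≤ L.length then L else w :: L := by
  unfold addVector; split_ifs <;> simp

lemma cost_addVector (L : List (E d)) (w : E d) :
    Cost (addVector L w) (d * (Nat.log 2 (listSize d) + 2) + d)
      (d * (addVector L w).val.length - d * L.length)
      (d * (addVector L w).val.length - d * L.length) := by
  rw [val_addVector]
  unfold addVector
  split_ifs with h
  · exact (Cost.spend _).bind (Cost.pure _) (by omega) (by simp) (by simp) (by simp)
  · refine (Cost.spend _).bind ((Cost.alloc d).bind (Cost.pure _) le_rfl (P := d) le_rfl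
      (by simp) rfl) (by omega) ?_ ?_ ?_
    all_goals simp; ring_nf; try simp

lemma length_addVector_le {L : List (E d)} (h : L.length ≤ listSize d) (w : E d) :
    (addVector L w).val.length ≤ listSize d := by
  rw [val_addVector]
  split_ifs with hc
  · exact h
  · push Not at hc; simpa using hc.2

open scoped Classical in
lemma val_reduceZero (R : ℝ) (w₁ : E d) (out : State d) (w₂ : E d) :
    (reduceZero R w₁ out w₂).val = if ‖w₁ - w₂‖ ≤ shrink d * R ∧ w₁ - w₂ ≠ 0 then
      { out with zero := (addVector out.zero (w₁ - w₂)).val } else out := by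
  unfold reduceZero; split_ifs <;> simp

open scoped Classical in
lemma val_reduceTarget (R : ℝ) (t w₁ : E d) (out : State d) (w₂ : E d) :
    (reduceTarget R t w₁ out w₂).val = if ‖(w₁ - w₂) - t‖ ≤ shrink d * R then
      ⟨out.zero, (addVector out.target (w₁ - w₂)).val,
        if ‖(w₁ - w₂) - t‖ < ‖out.best - t‖ then w₁ - w₂ else out.best⟩ else out := by
  unfold reduceTarget; split_ifs <;> simp

lemma fits_reduceZero (R : ℝ) (w₁ w₂ : E d) {out : State d} (h : Fits out) :
    Fits (reduceZero R w₁ out w₂).val := by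
  rw [val_reduceZero]
  split_ifs
  · exact ⟨length_addVector_le h.1 _, h.2⟩
  · exact h

lemma fits_reduceTarget (R : ℝ) (t w₁ w₂ : E d) {out : State d} (h : Fits out) :
    Fits (reduceTarget R t w₁ out w₂).val := by
  rw [val_reduceTarget]
  split_ifs <;> first | exact ⟨h.1, length_addVector_le h.2 _⟩ | exact h

lemma cost_reduceZero (R : ℝ) (w₁ w₂ : E d) {out : State d} (h : Fits out) :
    Cost (reduceZero R w₁ out w₂) (pairTime d) (2 * d * listSize d - cells out)
      (cells (reduceZero R w₁ out w₂).val - cells out) := by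
  have hb := cells_le (fits_reduceZero R w₁ w₂ h)
  have hb' := cells_le h
  rw [val_reduceZero] at *
  unfold reduceZero
  split_ifs with hc
  · rw [if_pos hc] at hb
    have := cost_addVector out.zero (w₁ - w₂)
    simp only [cells] at hb hb' ⊢
    refine (Cost.spend _).bind (this.bind (Cost.pure _) le_rfl
      (P := 2 * d * listSize d - d * (out.zero.length + out.target.length)) ?_ ?_ rfl) ?_ ?_ ?_ ?_
    · linarith
    · linarith
    · rw [pairTime]; omega
    · linarith
    · linarith
    · ring
  · exact (Cost.spend _).bind (Cost.pure _) (by rw [pairTime]; omega) (by linarith) (by linarith)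
      (by ring)

lemma cost_reduceTarget (R : ℝ) (t w₁ w₂ : E d) {out : State d} (h : Fits out) :
    Cost (reduceTarget R t w₁ out w₂) (pairTime d) (2 * d * listSize d - cells out)
      (cells (reduceTarget R t w₁ out w₂).val - cells out) := by
  have hb := cells_le (fits_reduceTarget R t w₁ w₂ h)
  have hb' := cells_le h
  rw [val_reduceTarget] at *
  by_cases hc : ‖(w₁ - w₂) - t‖ ≤ shrink d * R
  · rw [if_pos hc] at hb ⊢
    unfold reduceTarget
    rw [if_pos hc]
    have := cost_addVector out.target (w₁ - w₂)
    simp only [cells] at hb hb' ⊢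
    refine (Cost.spend _).bind (this.bind (Cost.pure _) le_rfl
      (P := 2 * d * listSize d - d * (out.zero.length + out.target.length)) ?_ ?_ rfl) ?_ ?_ ?_ ?_
    · linarith
    · linarith
    · rw [pairTime]; omega
    · linarith
    · linarith
    · ring
  · rw [if_neg hc]
    unfold reduceTarget
    rw [if_neg hc]
    exact (Cost.spend _).bind (Cost.pure _) (by rw [pairTime]; omega) (by linarith) (by linarith)
      (by ring)

/-! ### One round -/

/-- The bucket array for the first list. -/
noncomputable def bucketsOf (ω : RoundCoins d) (l : List (E d)) : Buckets d :=
  (l.foldlM (insertVector ω) ((fun _ => [], 0) : Buckets d × ℕ)).val.1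

/-- The state after the comparisons within the first list. -/
noncomputable def afterZero (R : ℝ) (inp out : State d) (ω : RoundCoins d) : Alg (State d) :=
  inp.zero.foldlM (fun out w₁ =>
    forCandidates ω (bucketsOf ω inp.zero) w₁ out (reduceZero R w₁)) out

/-- The state after the comparisons of the second list with the first. -/
noncomputable def afterTarget (R : ℝ) (t : E d) (inp out : State d) (ω : RoundCoins d) : Alg (State d) :=
  inp.target.foldlM (fun out w₁ =>
    forCandidates ω (bucketsOf ω inp.zero) (w₁ - t) out (reduceTarget R t w₁)) out

lemma val_sieveRound (R : ℝ) (t : E d) (inp out : State d) (ω : RoundCoins d) :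
    (sieveRound R t inp out ω).val =
      (afterTarget R t inp (afterZero R inp out ω).val ω).val := by
  unfold sieveRound; rfl

lemma sieveRound_preserves {R : ℝ} {t : E d} {inp out : State d} {ω : RoundCoins d}
    {P : State d → Prop}
    (hz : ∀ w₁ ∈ inp.zero, ∀ w₂ ∈ inp.zero, ∀ s, P s → P (reduceZero R w₁ s w₂).val)
    (ht : ∀ w₁ ∈ inp.target, ∀ w₂ ∈ inp.zero, ∀ s, P s → P (reduceTarget R t w₁ s w₂).val)
    (h : P out) : P (sieveRound R t inp out ω).val := by
  rw [val_sieveRound, afterTarget, val_foldlM]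
  refine List.foldl_preserves (fun w₁ h₁ s hs => forCandidates_preserves
    (fun a w₂ h₂ s hs => ht w₁ h₁ w₂ ((mem_bucket ω _ a w₂).1 h₂).1 s hs) hs) ?_
  rw [afterZero, val_foldlM]
  exact List.foldl_preserves (fun w₁ h₁ s hs => forCandidates_preserves
    (fun a w₂ h₂ s hs => hz w₁ h₁ w₂ ((mem_bucket ω _ a w₂).1 h₂).1 s hs) hs) h

/-- Processing `w₁`, the first loop looks into bucket `a` and meets `w₂` there. Neither the rest of
that loop nor the second loop destroys `Q`. -/
lemma sieveRound_establishes_zero {R : ℝ} {t : E d} {inp out : State d} {ω : RoundCoins d}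
    {Q : State d → Prop}
    (hz : ∀ w₁ ∈ inp.zero, ∀ w₂ ∈ inp.zero, ∀ s, Q s → Q (reduceZero R w₁ s w₂).val)
    (ht : ∀ w₁ ∈ inp.target, ∀ w₂ ∈ inp.zero, ∀ s, Q s → Q (reduceTarget R t w₁ s w₂).val)
    {w₁ w₂ : E d} (h₁ : w₁ ∈ inp.zero) (h₂ : w₂ ∈ inp.zero) {a : Address d}
    (ha₁ : a ∈ accepting ω w₁) (ha₂ : a ∈ accepting ω w₂)
    (hQ : ∀ s, Q (reduceZero R w₁ s w₂).val) : Q (sieveRound R t inp out ω).val := by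
  rw [val_sieveRound, afterTarget, val_foldlM]
  refine List.foldl_preserves (fun w₁ h₁ s hs => forCandidates_preserves
    (fun a w₂ h₂ s hs => ht w₁ h₁ w₂ ((mem_bucket ω _ a w₂).1 h₂).1 s hs) hs) ?_
  rw [afterZero, val_foldlM]
  refine List.foldl_establishes (P := fun _ => True) (fun _ _ _ _ => trivial)
    (fun w₁ h₁ s _ hs => forCandidates_preserves (T := bucketsOf ω inp.zero)
    (fun a w₂ h₂ s hs => hz w₁ h₁ w₂ ((mem_bucket ω _ a w₂).1 h₂).1 s hs) hs) h₁ ?_ trivial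
  exact (fun s _ => forCandidates_establishes (T := bucketsOf ω inp.zero) (v := w₁) (P := fun _ => True) (fun _ _ _ _ _ => trivial)
      (fun a w₂ h₂ s _ hs => hz w₁ h₁ w₂ ((mem_bucket ω _ a w₂).1 h₂).1 s hs) ha₁
      ((mem_bucket ω _ a w₂).2 ⟨h₂, ha₂⟩) (fun s _ => hQ s) trivial)

lemma sieveRound_establishes_target {R : ℝ} {t : E d} {inp out : State d} {ω : RoundCoins d}
    {Q : State d → Prop}
    (ht : ∀ w₁ ∈ inp.target, ∀ w₂ ∈ inp.zero, ∀ s, Q s → Q (reduceTarget R t w₁ s w₂).val)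
    {w₁ w₂ : E d} (h₁ : w₁ ∈ inp.target) (h₂ : w₂ ∈ inp.zero) {a : Address d}
    (ha₁ : a ∈ accepting ω (w₁ - t)) (ha₂ : a ∈ accepting ω w₂)
    (hQ : ∀ s, Q (reduceTarget R t w₁ s w₂).val) : Q (sieveRound R t inp out ω).val := by
  rw [val_sieveRound, afterTarget, val_foldlM]
  refine List.foldl_establishes (P := fun _ => True) (fun _ _ _ _ => trivial)
    (fun w₁ h₁ s _ hs => forCandidates_preserves (T := bucketsOf ω inp.zero)
    (fun a w₂ h₂ s hs => ht w₁ h₁ w₂ ((mem_bucket ω _ a w₂).1 h₂).1 s hs) hs) h₁ ?_ trivial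
  exact (fun s _ => forCandidates_establishes (T := bucketsOf ω inp.zero) (v := w₁ - t) (P := fun _ => True) (fun _ _ _ _ _ => trivial)
      (fun a w₂ h₂ s _ hs => ht w₁ h₁ w₂ ((mem_bucket ω _ a w₂).1 h₂).1 s hs) ha₁
      ((mem_bucket ω _ a w₂).2 ⟨h₂, ha₂⟩) (fun s _ => hQ s) trivial)

/-- A bound for the time of one round if no bucket has more than `k` vectors. -/
noncomputable def roundTime (d k : ℕ) : ℕ :=
  3 * d ^ 3 + 3 * d ^ 2 * numBlocks d * blockSize d + (d ^ 2 + d * numBlocks d * blockSize d) +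
    blockSize d ^ numBlocks d + (decodeTime d + numBlocks d + 1) *
      (listSize d + k * blockSize d ^ numBlocks d) +
    2 * ((decodeTime d + numBlocks d + pairTime d * k) *
      (listSize d + k * blockSize d ^ numBlocks d))

/-- A bound for the working memory of one round if no bucket has more than `k` vectors. -/
noncomputable def roundSpace (d k : ℕ) : ℕ :=
  (d ^ 2 + d * numBlocks d * blockSize d) + blockSize d ^ numBlocks d +
    k * blockSize d ^ numBlocks d +
    (d + numBlocks d * blockSize d + numBlocks d * blockSize d ^ numBlocks d)

/-- The output lists are accounted for by the potential `cells`, which is at most `2 * d * listSize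
d`. The code, the bucket array, the stored pointers and the memory for decoding are released within
the round, so they enter the peak and not the net use. -/
lemma cost_sieveRound {R : ℝ} {t : E d} {inp out : State d} {ω : RoundCoins d} {k : ℕ}
    (hinp : Fits inp) (hout : Fits out) (hz : ∀ a, bucketSize ω inp.zero a ≤ k)
    (ht : ∀ a, bucketSize ω (inp.target.map (· - t)) a ≤ k) :
    Cost (sieveRound R t inp out ω) (roundTime d k)
      (2 * d * listSize d + roundSpace d k - cells out)
      (cells (sieveRound R t inp out ω).val - cells out) := by
  obtain ⟨hT1, -, hT3⟩ := cost_insertVectors ω inp.zero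
  have hS := sum_length_accepting_le ω inp.zero hz
  have hS' := sum_length_accepting_le ω _ ht
  rw [List.map_map, Function.comp_def] at hS'
  set S := (inp.zero.map fun w => (accepting ω w).length).sum with hSdef
  set S' := (inp.target.map fun w => (accepting ω (w - t)).length).sum with hSdef'
  set K := k * blockSize d ^ numBlocks d with hK
  set B : ℤ := 2 * d * listSize d +
    (d + numBlocks d * blockSize d + numBlocks d * blockSize d ^ numBlocks d) with hB
  have hBc : ∀ s : State d, Fits s → cells s ≤ B := fun s hs => (cells_le hs).trans
    (by rw [hB]; exact le_add_of_nonneg_right (by positivity))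
  have hlen : ∀ a, (bucketsOf ω inp.zero a).length ≤ k := fun a => by
    rw [bucketsOf, length_bucket]; exact hz a
  obtain ⟨hf1, hc1⟩ := Cost.foldlM (l := inp.zero) (f := fun out w₁ =>
    forCandidates ω (bucketsOf ω inp.zero) w₁ out (reduceZero R w₁)) Fits cells
    (fun w => (decodeTime d + numBlocks d + pairTime d * k) * (1 + (accepting ω w).length)) B
    (fun w₁ _ s hs => forCandidates_preserves (fun a w₂ _ s hs => fits_reduceZero R w₁ w₂ hs) hs)
    (fun w₁ _ s hs => cost_forCandidates w₁ Fits cells (2 * d * listSize d) hlen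
      (fun a w₂ _ s hs => fits_reduceZero R w₁ w₂ hs)
      (fun a w₂ _ s hs => cost_reduceZero R w₁ w₂ hs) (fun s hs => cells_le hs) hs) hBc out hout
  change Fits (afterZero R inp out ω).val at hf1
  obtain ⟨hf2, hc2⟩ := Cost.foldlM (l := inp.target) (f := fun out w₁ =>
    forCandidates ω (bucketsOf ω inp.zero) (w₁ - t) out (reduceTarget R t w₁)) Fits cells
    (fun w => (decodeTime d + numBlocks d + pairTime d * k) *
      (1 + (accepting ω (w - t)).length)) B
    (fun w₁ _ s hs => forCandidates_preserves
      (fun a w₂ _ s hs => fits_reduceTarget R t w₁ w₂ hs) hs)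
    (fun w₁ _ s hs => cost_forCandidates (w₁ - t) Fits cells (2 * d * listSize d) hlen
      (fun a w₂ _ s hs => fits_reduceTarget R t w₁ w₂ hs)
      (fun a w₂ _ s hs => cost_reduceTarget R t w₁ w₂ hs) (fun s hs => cells_le hs) hs) hBc _ hf1
  rw [List.sum_map_mul_left, List.sum_map_add] at hc1 hc2
  simp only [List.map_const', List.sum_replicate, smul_eq_mul, mul_one] at hc1 hc2
  rw [← hSdef] at hc1
  rw [← hSdef'] at hc2
  change Cost (afterZero R inp out ω) _ _ (cells (afterZero R inp out ω).val - _) at hc1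
  change Cost (afterTarget R t inp (afterZero R inp out ω).val ω) _ _
    (cells (afterTarget R t inp (afterZero R inp out ω).val ω).val - _) at hc2
  change Fits (afterTarget R t inp (afterZero R inp out ω).val ω).val at hf2
  rw [val_sieveRound]
  set o1 := (afterZero R inp out ω).val with ho1
  set o2 := (afterTarget R t inp o1 ω).val with ho2
  have e1 := cells_le hf1
  have e2 := cells_le hf2
  have e0 := cells_le hout
  have g0 := cells_nonneg out
  have g1 := cells_nonneg o1
  have g2 := cells_nonneg o2
  have hinp1 := hinp.1
  have hinp2 := hinp.2
  set q := d ^ 2 + d * numBlocks d * blockSize d with hq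
  set W := d + numBlocks d * blockSize d + numBlocks d * blockSize d ^ numBlocks d with hW
  have hBW : B = 2 * d * listSize d + W := by rw [hB, hW]; push_cast; ring
  have hSZ : (S : ℤ) ≤ K := by exact_mod_cast hS
  have hRS : (roundSpace d k : ℤ) = q + (blockSize d ^ numBlocks d : ℕ) + K + W := by
    rw [roundSpace, ← hK, ← hq, ← hW]; push_cast; ring
  have hTT : (d + numBlocks d * blockSize d + numBlocks d * blockSize d ^ numBlocks d +
      (S : ℤ)) = W + S := by rw [hW]; push_cast; ring
  rw [hTT] at hT3
  have hfree : Cost (do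
      free (q + blockSize d ^ numBlocks d + (inp.zero.foldlM (insertVector ω)
        ((fun _ => [], 0) : Buckets d × ℕ)).val.2)
      pure o2 : Alg (State d)) 0 0 (-((q + blockSize d ^ numBlocks d + S : ℕ) : ℤ)) := by
    rw [hT1]
    exact (Cost.free _).bind (Cost.pure _) le_rfl le_rfl (by omega) (by simp)
  -- The round is assembled from its end backwards, each stage with a peak relative to the cells in
  -- use when it begins.
  have hb4 := hc2.bind (f := fun o => do
      free (q + blockSize d ^ numBlocks d + (inp.zero.foldlM (insertVector ω)
        ((fun _ => [], 0) : Buckets d × ℕ)).val.2)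
      pure o) hfree le_rfl (P := B - cells o1) le_rfl (by omega) rfl
  have hb3 := hc1.bind (f := fun o => (do
      let out ← afterTarget R t inp o ω
      free (q + blockSize d ^ numBlocks d + (inp.zero.foldlM (insertVector ω)
        ((fun _ => [], 0) : Buckets d × ℕ)).val.2)
      pure out : Alg (State d))) hb4 le_rfl (P := B - cells out) le_rfl (by omega) rfl
  have hb2 := hT3.bind (f := fun T => (do
      let out ← inp.zero.foldlM (fun out w₁ =>
        forCandidates ω T.1 w₁ out (reduceZero R w₁)) out
      let out ← inp.target.foldlM (fun out w₁ =>
        forCandidates ω T.1 (w₁ - t) out (reduceTarget R t w₁)) out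
      free (q + blockSize d ^ numBlocks d + T.2)
      pure out : Alg (State d))) hb3 le_rfl (P := K + B - cells out) (by omega) (by omega) rfl
  have hb1 := (Cost.alloc (blockSize d ^ numBlocks d)).bind (f := fun _ => _) hb2 le_rfl
    (P := (blockSize d ^ numBlocks d : ℕ) + K + B - cells out) (by omega) (by omega) rfl
  have hb0 := (Cost.alloc q).bind (f := fun _ => _) hb1 le_rfl
    (P := q + (blockSize d ^ numBlocks d : ℕ) + K + B - cells out) (by omega) (by omega) rfl
  have hb := (Cost.spend (3 * d ^ 3 + 3 * d ^ 2 * numBlocks d * blockSize d)).bind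
    (f := fun _ => _) hb0 le_rfl
    (P := q + (blockSize d ^ numBlocks d : ℕ) + K + B - cells out) (by omega) (by omega) rfl
  unfold sieveRound
  refine Cost.mono hb ?_ (by omega) (by push_cast; ring)
  rw [roundTime, ← hK, ← hq]
  have m1 : (decodeTime d + numBlocks d + 1) * (inp.zero.length + S) ≤
      (decodeTime d + numBlocks d + 1) * (listSize d + K) := by gcongr
  have m2 : (decodeTime d + numBlocks d + pairTime d * k) * (inp.zero.length + S) ≤
      (decodeTime d + numBlocks d + pairTime d * k) * (listSize d + K) := by gcongr
  have m3 : (decodeTime d + numBlocks d + pairTime d * k) * (inp.target.length + S') ≤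
      (decodeTime d + numBlocks d + pairTime d * k) * (listSize d + K) := by gcongr
  omega

/-! ### All rounds -/

/-- The output lists and the best vector after all rounds of a step. -/
lemma val_sieveStep (R : ℝ) (t : E d) (ω : StepCoins d) (inp : State d) :
    (sieveStep R t ω inp).val = (List.finRange (numRounds d)).foldl
      (fun out r => (sieveRound R t inp out (ω r)).val) ⟨[], [], inp.best⟩ := by
  rw [← val_foldlM]; rfl

lemma sieveStep_preserves {R : ℝ} {t : E d} {inp : State d} {ω : StepCoins d} {P : State d → Prop}
    (hz : ∀ w₁ ∈ inp.zero, ∀ w₂ ∈ inp.zero, ∀ s, P s → P (reduceZero R w₁ s w₂).val)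
    (ht : ∀ w₁ ∈ inp.target, ∀ w₂ ∈ inp.zero, ∀ s, P s → P (reduceTarget R t w₁ s w₂).val)
    (h : P ⟨[], [], inp.best⟩) : P (sieveStep R t ω inp).val := by
  rw [val_sieveStep]
  exact List.foldl_preserves (fun r _ s hs => sieveRound_preserves hz ht hs) h

lemma fits_sieveStep (R : ℝ) (t : E d) (inp : State d) (ω : StepCoins d) :
    Fits (sieveStep R t ω inp).val :=
  sieveStep_preserves (fun w₁ _ w₂ _ _ hs => fits_reduceZero R w₁ w₂ hs)
    (fun w₁ _ w₂ _ _ hs => fits_reduceTarget R t w₁ w₂ hs) ⟨Nat.zero_le _, Nat.zero_le _⟩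

/-- A filter accepts both vectors. -/
def Collide (ω : RoundCoins d) (v w : E d) : Prop := ∃ a, a ∈ accepting ω v ∧ a ∈ accepting ω w

/-- `addVector` rejects a new vector only when the list is full, and lists never shrink. So the
difference is either present at the end or was crowded out by a full list, which is just as good. -/
lemma mem_zero_sieveStep {R : ℝ} {t : E d} {inp : State d} {ω : StepCoins d} {w₁ w₂ : E d}
    (h₁ : w₁ ∈ inp.zero) (h₂ : w₂ ∈ inp.zero) (hle : ‖w₁ - w₂‖ ≤ shrink d * R)
    (hne : w₁ - w₂ ≠ 0) (hc : ∃ r, Collide (ω r) w₁ w₂) :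
    w₁ - w₂ ∈ (sieveStep R t ω inp).val.zero ∨
      listSize d ≤ (sieveStep R t ω inp).val.zero.length := by
  classical
  obtain ⟨r, a, ha₁, ha₂⟩ := hc
  rw [val_sieveStep]
  have hadd : ∀ (L : List (E d)) (w : E d), (w₁ - w₂ ∈ L ∨ listSize d ≤ L.length) →
      (w₁ - w₂ ∈ (addVector L w).val ∨ listSize d ≤ (addVector L w).val.length) := by
    intro L w h
    rw [val_addVector]
    split_ifs with hc
    · exact h
    · push Not at hc
      rcases h with h | h
      · exact Or.inl (by simp [h])
      · omega
  have hz : ∀ u₁ ∈ inp.zero, ∀ u₂ ∈ inp.zero, ∀ s : State d,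
      (w₁ - w₂ ∈ s.zero ∨ listSize d ≤ s.zero.length) →
      (w₁ - w₂ ∈ (reduceZero R u₁ s u₂).val.zero ∨
        listSize d ≤ (reduceZero R u₁ s u₂).val.zero.length) := by
    intro u₁ _ u₂ _ s hs
    rw [val_reduceZero]
    split_ifs
    · exact hadd _ _ hs
    · exact hs
  have ht : ∀ u₁ ∈ inp.target, ∀ u₂ ∈ inp.zero, ∀ s : State d,
      (w₁ - w₂ ∈ s.zero ∨ listSize d ≤ s.zero.length) →
      (w₁ - w₂ ∈ (reduceTarget R t u₁ s u₂).val.zero ∨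
        listSize d ≤ (reduceTarget R t u₁ s u₂).val.zero.length) := by
    intro u₁ _ u₂ _ s hs
    rw [val_reduceTarget]
    split_ifs <;> exact hs
  refine List.foldl_establishes (f := fun out r => (sieveRound R t inp out (ω r)).val)
    (P := fun _ => True) (Q := fun s : State d => w₁ - w₂ ∈ s.zero ∨ listSize d ≤ s.zero.length)
    (fun _ _ _ _ => trivial) (fun r _ s _ hs => sieveRound_preserves hz ht hs)
    (List.mem_finRange r) (fun s _ => sieveRound_establishes_zero hz ht h₁ h₂ ha₁ ha₂ ?_) trivial
  intro s
  rw [val_reduceZero, if_pos ⟨hle, hne⟩]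
  simp only [val_addVector]
  split_ifs with h
  · exact h
  · simp

/-- The best vector is updated even when the list is full; hence the bound on its distance holds
without an alternative. -/
lemma mem_target_sieveStep {R : ℝ} {t : E d} {inp : State d} {ω : StepCoins d} {w₁ w₂ : E d}
    (h₁ : w₁ ∈ inp.target) (h₂ : w₂ ∈ inp.zero) (hle : ‖(w₁ - w₂) - t‖ ≤ shrink d * R)
    (hc : ∃ r, Collide (ω r) (w₁ - t) w₂) :
    (w₁ - w₂ ∈ (sieveStep R t ω inp).val.target ∨
      listSize d ≤ (sieveStep R t ω inp).val.target.length) ∧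
    ‖(sieveStep R t ω inp).val.best - t‖ ≤ ‖(w₁ - w₂) - t‖ := by
  classical
  obtain ⟨r, a, ha₁, ha₂⟩ := hc
  rw [val_sieveStep]
  have ht : ∀ u₁ ∈ inp.target, ∀ u₂ ∈ inp.zero, ∀ s : State d,
      ((w₁ - w₂ ∈ s.target ∨ listSize d ≤ s.target.length) ∧
        ‖s.best - t‖ ≤ ‖(w₁ - w₂) - t‖) →
      ((w₁ - w₂ ∈ (reduceTarget R t u₁ s u₂).val.target ∨
        listSize d ≤ (reduceTarget R t u₁ s u₂).val.target.length) ∧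
        ‖(reduceTarget R t u₁ s u₂).val.best - t‖ ≤ ‖(w₁ - w₂) - t‖) := by
    intro u₁ _ u₂ _ s hs
    rw [val_reduceTarget]
    split_ifs with h h'
    · refine ⟨?_, h'.le.trans hs.2⟩
      simp only [val_addVector]
      split_ifs with hc
      · exact hs.1
      · push Not at hc
        rcases hs.1 with h | h
        · exact Or.inl (by simp [h])
        · omega
    · refine ⟨?_, hs.2⟩
      simp only [val_addVector]
      split_ifs with hc
      · exact hs.1
      · push Not at hc
        rcases hs.1 with h | h
        · exact Or.inl (by simp [h])
        · omega
    · exact hs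
  refine List.foldl_establishes (f := fun out r => (sieveRound R t inp out (ω r)).val)
    (P := fun _ => True) (Q := fun s : State d => (w₁ - w₂ ∈ s.target ∨ listSize d ≤ s.target.length) ∧
        ‖s.best - t‖ ≤ ‖(w₁ - w₂) - t‖)
    (fun _ _ _ _ => trivial) (fun r _ s _ hs => sieveRound_preserves ?_ ht hs)
    (List.mem_finRange r) (fun s _ => sieveRound_establishes_target ht h₁ h₂ ha₁ ha₂ ?_) trivial
  · intro u₁ _ u₂ _ s hs
    rw [val_reduceZero]
    split_ifs <;> exact hs
  intro s
  rw [val_reduceTarget, if_pos hle]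
  refine ⟨?_, ?_⟩
  · simp only [val_addVector]
    split_ifs with h
    · exact h
    · simp
  · dsimp only
    split_ifs with h
    · exact le_rfl
    · exact not_lt.1 h

lemma sieveStep_mem {R : ℝ} {t : E d} {inp : State d} {ω : StepCoins d}
    (L : Submodule ℤ (E d)) (hz : ∀ w ∈ inp.zero, w ∈ L) (ht : ∀ w ∈ inp.target, w ∈ L)
    (hb : inp.best ∈ L) :
    (∀ w ∈ (sieveStep R t ω inp).val.zero, w ∈ L) ∧
      (∀ w ∈ (sieveStep R t ω inp).val.target, w ∈ L) ∧ (sieveStep R t ω inp).val.best ∈ L := by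
  classical
  have hadd : ∀ (l : List (E d)) (w : E d), (∀ u ∈ l, u ∈ L) → w ∈ L →
      ∀ u ∈ (addVector l w).val, u ∈ L := by
    intro l w hl hw
    rw [val_addVector]
    split_ifs
    · exact hl
    · simpa [hw] using hl
  refine sieveStep_preserves (P := fun s => (∀ w ∈ s.zero, w ∈ L) ∧ (∀ w ∈ s.target, w ∈ L) ∧
    s.best ∈ L) ?_ ?_ ⟨by simp, by simp, hb⟩
  · intro w₁ h₁ w₂ h₂ s hs
    rw [val_reduceZero]
    split_ifs
    · exact ⟨hadd _ _ hs.1 (L.sub_mem (hz _ h₁) (hz _ h₂)), hs.2⟩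
    · exact hs
  · intro w₁ h₁ w₂ h₂ s hs
    rw [val_reduceTarget]
    have := L.sub_mem (ht _ h₁) (hz _ h₂)
    split_ifs
    · exact ⟨hs.1, hadd _ _ hs.2.1 this, this⟩
    · exact ⟨hs.1, hadd _ _ hs.2.1 this, hs.2.2⟩
    · exact hs

/-- Here time and space part: the time of a round is multiplied by the number of rounds, whereas the
working memory is counted once because each round releases it. -/
lemma cost_sieveStep {R : ℝ} {t : E d} {inp : State d} {ω : StepCoins d} {k : ℕ}
    (hinp : Fits inp) (hz : ∀ r a, bucketSize (ω r) inp.zero a ≤ k)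
    (ht : ∀ r a, bucketSize (ω r) (inp.target.map (· - t)) a ≤ k) :
    Cost (sieveStep R t ω inp) (numRounds d * roundTime d k)
      (2 * d * listSize d + roundSpace d k)
      (cells (sieveStep R t ω inp).val - cells inp) := by
  have hloop := (Cost.foldlM (l := List.finRange (numRounds d))
    (f := fun out r => sieveRound R t inp out (ω r)) Fits cells (fun _ => roundTime d k)
    (2 * d * listSize d + roundSpace d k)
    (fun r _ s hs => sieveRound_preserves (fun w₁ _ w₂ _ _ hs => fits_reduceZero R w₁ w₂ hs)
      (fun w₁ _ w₂ _ _ hs => fits_reduceTarget R t w₁ w₂ hs) hs)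
    (fun r _ s hs => cost_sieveRound hinp hs (hz r) (ht r))
    (fun s hs => (cells_le hs).trans (by simp)) ⟨[], [], inp.best⟩
    ⟨Nat.zero_le _, Nat.zero_le _⟩).2
  have h0 : cells (⟨[], [], inp.best⟩ : State d) = 0 := by simp [cells]
  have hv : (sieveStep R t ω inp).val = ((List.finRange (numRounds d)).foldlM
    (fun out r => sieveRound R t inp out (ω r)) (⟨[], [], inp.best⟩ : State d)).val := rfl
  simp only [List.map_const', List.sum_replicate, smul_eq_mul, List.length_finRange] at hloop
  have hf := cells_le (fits_sieveStep R t inp ω)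
  rw [hv] at hf ⊢
  rw [h0, sub_zero, sub_zero] at hloop
  unfold sieveStep
  refine hloop.bind ((Cost.free _).bind (Cost.pure _) le_rfl (P := 0) le_rfl (p' := 0) ?_ rfl)
    le_rfl le_rfl ?_ ?_
  · rw [add_zero, neg_nonpos]; positivity
  · have : (0 : ℤ) ≤ roundSpace d k := by positivity
    linarith
  · rw [cells, cells]; push_cast; ring

lemma bucketSize_le_length (ω : RoundCoins d) (l : List (E d)) (a : Address d) :
    bucketSize ω l a ≤ l.length := List.countP_le_length

lemma net_sieveStep {R : ℝ} {t : E d} {inp : State d} {ω : StepCoins d} (hinp : Fits inp) :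
    (sieveStep R t ω inp).net = cells (sieveStep R t ω inp).val - cells inp :=
  -- The net use does not depend on the bucket bound, so the trivial bound by the length of the list
  -- serves.
  (cost_sieveStep (k := listSize d) hinp
    (fun _ _ => (bucketSize_le_length _ _ _).trans hinp.1)
    (fun _ _ => (bucketSize_le_length _ _ _).trans (by simpa using hinp.2))).net_eq

/-- Each round writes an array with one cell per filter, whatever the input. -/
lemma le_time_sieveStep (R : ℝ) (t : E d) (inp : State d) (ω : StepCoins d) :
    numRounds d * blockSize d ^ numBlocks d ≤ (sieveStep R t ω inp).time := by
  have h : ∀ (l : List (Fin (numRounds d))) (s : State d), l.length * blockSize d ^ numBlocks d ≤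
      (l.foldlM (fun out r => sieveRound R t inp out (ω r)) s).time := by
    intro l
    induction l with
    | nil => simp
    | cons r l ih =>
      intro s
      rw [List.foldlM_cons, time_bind, List.length_cons, add_mul, one_mul, add_comm]
      refine add_le_add ?_ (ih _)
      unfold sieveRound
      simp only [time_bind, alloc]
      omega
  have := h (List.finRange (numRounds d)) ⟨[], [], inp.best⟩
  rw [List.length_finRange] at this
  exact this.trans (Nat.le_add_right _ _)

end step

/-! ## The whole run -/

namespace CVPInstance

variable {d : ℕ} (I : CVPInstance d) {l : List (E d) × List (E d)} (ω : Coins d)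

lemma val_sieveIter_succ (k : ℕ) :
    (I.sieveIter l ω (k + 1)).val = (I.actualStep k l ω).val := rfl

/-- The summand `d` in the last clause stands for the cells of the best vector. -/
lemma sieveIter_invariant (hl : l ∈ I.sampler.support) (k : ℕ) :
    Fits (I.sieveIter l ω k).val ∧
      (∀ w ∈ (I.sieveIter l ω k).val.zero, w ∈ I.lattice) ∧
      (∀ w ∈ (I.sieveIter l ω k).val.target, w ∈ I.lattice) ∧
      (I.sieveIter l ω k).val.best ∈ I.lattice ∧
      (I.sieveIter l ω k).net = cells (I.sieveIter l ω k).val + d := by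
  induction k with
  | zero =>
    refine ⟨⟨(I.length_zero l hl).le, (I.length_target l hl).le⟩,
      fun w hw => (I.mem_zero l hl w hw).1, fun w hw => (I.mem_target l hl w hw).1,
      I.lattice.zero_mem, ?_⟩
    simp [sieveIter, cells, alloc, spend]
  | succ k ih =>
    obtain ⟨h1, h2, h3, h4, h5⟩ := ih
    obtain ⟨g1, g2, g3⟩ := sieveStep_mem (R := I.radius k) (t := I.target) (ω := ω k)
      I.lattice h2 h3 h4
    refine ⟨fits_sieveStep _ _ _ _, g1, g2, g3, ?_⟩
    have : (I.sieveIter l ω (k + 1)).net = (I.sieveIter l ω k).net + (0 +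
      (sieveStep (I.radius k) I.target (ω k) (I.sieveIter l ω k).val).net) := rfl
    rw [this, net_sieveStep h1, h5, val_sieveIter_succ, actualStep]
    ring

lemma time_sieveIter_succ (k : ℕ) : (I.sieveIter l ω (k + 1)).time =
    (I.sieveIter l ω k).time + (2 + (I.actualStep k l ω).time) := rfl

lemma peak_sieveIter_succ (k : ℕ) : (I.sieveIter l ω (k + 1)).peak =
    max (I.sieveIter l ω k).peak
      ((I.sieveIter l ω k).net + max 0 (0 + (I.actualStep k l ω).peak)) := rfl

lemma time_sieveIter_zero : (I.sieveIter l ω 0).time =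
    (3 * d ^ 3 + 2 * listSize d * I.sampleCost) + ((d * (l.1.length + l.2.length) + d) + 0) := rfl

lemma peak_sieveIter_zero : (I.sieveIter l ω 0).peak = max 0 (0 +
    max ((d * (l.1.length + l.2.length) + d : ℕ) : ℤ)
      (((d * (l.1.length + l.2.length) + d : ℕ) : ℤ) + 0)) := rfl

lemma time_sieveIter_le (hl : l ∈ I.sampler.support) {k : ℕ} {τ : ℝ}
    (h : ∀ j < k, ((I.actualStep j l ω).time : ℝ) ≤ τ) :
    ((I.sieveIter l ω k).time : ℝ) ≤
      3 * d ^ 3 + 2 * listSize d * I.sampleCost + (2 * d * listSize d + d) + k * (2 + τ) := by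
  induction k with
  | zero =>
    rw [time_sieveIter_zero, I.length_zero l hl, I.length_target l hl]
    push_cast
    apply le_of_eq; ring
  | succ k ih =>
    have := ih fun j hj => h j (by omega)
    have hk := h k (by omega)
    rw [time_sieveIter_succ]
    push_cast
    linarith

lemma peak_sieveIter_le (hl : l ∈ I.sampler.support) {k : ℕ} {σ : ℝ} (hσ : 0 ≤ σ)
    (h : ∀ j < k, ((I.actualStep j l ω).peak : ℝ) ≤ σ) :
    ((I.sieveIter l ω k).peak : ℝ) ≤ 2 * d * listSize d + d + σ := by
  induction k with
  | zero =>
    rw [peak_sieveIter_zero, I.length_zero l hl, I.length_target l hl]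
    push_cast
    simp only [zero_add, add_zero, max_self]
    refine max_le (by positivity) ?_
    linarith
  | succ k ih =>
    have := ih fun j hj => h j (by omega)
    have hk := h k (by omega)
    obtain ⟨h1, -, -, -, h5⟩ := I.sieveIter_invariant ω hl k
    have hc : (cells (I.sieveIter l ω k).val : ℝ) ≤ 2 * d * listSize d := by
      exact_mod_cast cells_le h1
    rw [peak_sieveIter_succ, h5]
    push_cast
    refine max_le this ?_
    rw [zero_add]
    have := max_le hσ hk
    linarith

lemma le_peak_sieveIter (hl : l ∈ I.sampler.support) (k : ℕ) :
    (2 * d * listSize d : ℝ) ≤ (I.sieveIter l ω k).peak := by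
  induction k with
  | zero =>
    rw [peak_sieveIter_zero, I.length_zero l hl, I.length_target l hl]
    push_cast
    refine le_max_of_le_right ?_
    rw [zero_add, add_zero, max_self]
    have : (0 : ℝ) ≤ d := by positivity
    linarith
  | succ k ih =>
    rw [peak_sieveIter_succ]
    push_cast
    exact ih.trans (le_max_left _ _)

lemma le_time_sieveIter_succ (k : ℕ) :
    numRounds d * blockSize d ^ numBlocks d ≤ (I.sieveIter l ω (k + 1)).time := by
  rw [time_sieveIter_succ]
  have := le_time_sieveStep (I.radius k) I.target (I.sieveIter l ω k).val (ω k)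
  rw [actualStep]
  omega

lemma time_solveCVP : (I.solveCVP l ω).time = (I.sieveIter l ω I.numIter).time := rfl

lemma peak_solveCVP : (I.solveCVP l ω).peak =
    max (I.sieveIter l ω I.numIter).peak ((I.sieveIter l ω I.numIter).net + 0) := rfl

lemma val_solveCVP : (I.solveCVP l ω).val = (I.sieveIter l ω I.numIter).val.best := rfl

lemma isClosest_of_norm_le {v : E d} (hv : v ∈ I.lattice) (h : ‖v - I.target‖ ≤ I.dist) :
    I.IsClosest v := by
  refine ⟨hv, fun w hw => h.trans ?_⟩
  rw [CVPInstance.dist, ← dist_eq_norm, dist_comm]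
  exact Metric.infDist_le_dist_of_mem hw

end CVPInstance

end Sieve

/-! ## Resampling one coordinate of a product measure -/

namespace MeasureTheory.Measure

variable {ι : Type*} [Fintype ι] [DecidableEq ι] {X : ι → Type*} [∀ i, MeasurableSpace (X i)]
  (μ : ∀ i, Measure (X i)) [∀ i, IsProbabilityMeasure (μ i)]

lemma measurable_update_pair (i : ι) :
    Measurable fun p : (∀ i, X i) × X i => Function.update p.1 i p.2 := by
  refine measurable_pi_lambda _ fun j => ?_
  by_cases h : j = i
  · subst h; simpa using measurable_snd
  · simp only [Function.update_of_ne h]; fun_prop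

/-- Replacing one coordinate by an independent copy does not change the distribution. This is the
device for conditioning on the other coordinates. -/
lemma pi_map_update (i : ι) :
    ((Measure.pi μ).prod (μ i)).map (fun p => Function.update p.1 i p.2) = Measure.pi μ := by
  symm
  refine Measure.pi_eq fun s hs => ?_
  rw [Measure.map_apply (measurable_update_pair i) (MeasurableSet.univ_pi hs)]
  have : (fun p : (∀ i, X i) × X i => Function.update p.1 i p.2) ⁻¹' Set.univ.pi s =
      (Set.univ.pi (Function.update s i Set.univ)) ×ˢ s i := by
    ext p
    simp only [Set.mem_preimage, Set.mem_pi, Set.mem_univ, forall_true_left, Set.mem_prod]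
    constructor
    · intro h
      refine ⟨fun j => ?_, by simpa using h i⟩
      by_cases hj : j = i
      · subst hj; simp
      · simpa [hj] using h j
    · rintro ⟨h1, h2⟩ j
      by_cases hj : j = i
      · subst hj; simpa using h2
      · simpa [hj] using h1 j
  rw [this, Measure.prod_prod, Measure.pi_pi, ← Finset.mul_prod_erase _ _ (Finset.mem_univ i),
    ← Finset.mul_prod_erase Finset.univ (fun j => μ j (s j)) (Finset.mem_univ i)]
  simp only [Function.update_self, measure_univ, one_mul]
  rw [mul_comm]
  congr 1
  refine Finset.prod_congr rfl fun j hj => ?_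
  rw [Function.update_of_ne (Finset.ne_of_mem_erase hj)]

/-- Here all coordinates but `i` are held fixed; in the primed version it is coordinate `i` that is
held fixed. -/
lemma pi_apply_eq_lintegral_update (i : ι) {A : Set (∀ i, X i)} (hA : MeasurableSet A) :
    Measure.pi μ A = ∫⁻ ω, μ i {x | Function.update ω i x ∈ A} ∂Measure.pi μ := by
  conv_lhs => rw [← pi_map_update μ i]
  rw [Measure.map_apply (measurable_update_pair i) hA,
    Measure.prod_apply (measurable_update_pair i hA)]
  rfl

lemma pi_apply_eq_lintegral_update' (i : ι) {A : Set (∀ i, X i)} (hA : MeasurableSet A) :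
    Measure.pi μ A = ∫⁻ x, Measure.pi μ {ω | Function.update ω i x ∈ A} ∂μ i := by
  conv_lhs => rw [← pi_map_update μ i]
  rw [Measure.map_apply (measurable_update_pair i) hA,
    Measure.prod_apply_symm (measurable_update_pair i hA)]
  rfl

end MeasureTheory.Measure

namespace Sieve

/-! ## Rotation-invariant distributions -/

section rotation

variable {V : Type*} [NormedAddCommGroup V] [InnerProductSpace ℝ V]

lemma exists_linearIsometryEquiv_apply_eq {x y : V} (h : ‖x‖ = ‖y‖) :
    ∃ f : V ≃ₗᵢ[ℝ] V, f x = y :=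
  ⟨(Submodule.span ℝ {x - y})ᗮ.reflection, Submodule.reflection_sub h⟩

variable [FiniteDimensional ℝ V] [MeasurableSpace V] [BorelSpace V]

/-- A measure that is invariant under all linear isometries. -/
def RotationInvariant (μ : Measure V) : Prop := ∀ f : V ≃ₗᵢ[ℝ] V, μ.map f = μ

lemma RotationInvariant.charFun_eq {μ : Measure V} (hμ : RotationInvariant μ) {s t : V}
    (h : ‖s‖ = ‖t‖) : charFun μ s = charFun μ t := by
  obtain ⟨f, rfl⟩ := exists_linearIsometryEquiv_apply_eq h
  conv_rhs => rw [← hμ f]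
  rw [charFun_apply, charFun_apply, integral_map f.continuous.aemeasurable
    (by apply Continuous.aestronglyMeasurable; fun_prop)]
  simp

/-- A random vector `X` all of whose characters have the same mean along all directions of the unit
sphere is distributed like any rotation-invariant unit vector. -/
lemma charFun_eq_of_rotationInvariant {μ ν : Measure V} [IsProbabilityMeasure μ]
    [IsProbabilityMeasure ν] (hμ : RotationInvariant μ) (hν : RotationInvariant ν)
    (hμ1 : ∀ᵐ x ∂μ, ‖x‖ = 1) (hν1 : ∀ᵐ x ∂ν, ‖x‖ = 1) (t : V) : charFun μ t = charFun ν t := by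
  -- The characteristic function of μ depends on the norm of its argument only, so it may be
  -- averaged over ν-random directions. By Fubini the resulting double integral is symmetric in μ
  -- and ν.
  have key : ∀ {μ ν : Measure V} [IsProbabilityMeasure μ] [IsProbabilityMeasure ν],
      RotationInvariant μ → (∀ᵐ x ∂ν, ‖x‖ = 1) → charFun μ t =
        ∫ y, ∫ x, Complex.exp (inner ℝ x (‖t‖ • y) * Complex.I) ∂μ ∂ν := by
    intro μ ν _ _ hμ hν1
    have : ∀ᵐ y ∂ν, ∫ x, Complex.exp (inner ℝ x (‖t‖ • y) * Complex.I) ∂μ = charFun μ t := by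
      filter_upwards [hν1] with y hy
      rw [← charFun_apply]
      exact hμ.charFun_eq (by rw [norm_smul, hy, norm_norm, mul_one])
    rw [integral_congr_ae this]
    simp
  rw [key hμ hν1, key hν hμ1, integral_integral_swap]
  · refine integral_congr_ae (Eventually.of_forall fun x => integral_congr_ae
      (Eventually.of_forall fun y => ?_))
    simp only [inner_smul_right]
    rw [real_inner_comm]
  · refine Integrable.of_bound (C := 1) (by apply Continuous.aestronglyMeasurable; fun_prop)
      (Eventually.of_forall fun p => ?_)
    simp only [Function.uncurry]
    rw [Complex.norm_exp_ofReal_mul_I]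

lemma RotationInvariant.eq {μ ν : Measure V} [IsProbabilityMeasure μ]
    [IsProbabilityMeasure ν] (hμ : RotationInvariant μ) (hν : RotationInvariant ν)
    (hμ1 : ∀ᵐ x ∂μ, ‖x‖ = 1) (hν1 : ∀ᵐ x ∂ν, ‖x‖ = 1) : μ = ν :=
  Measure.ext_of_charFun (funext (charFun_eq_of_rotationInvariant hμ hν hμ1 hν1))

/-- The vector `x` scaled to length one. -/
noncomputable def direction (x : V) : V := ‖x‖⁻¹ • x

omit [FiniteDimensional ℝ V] in
lemma measurable_direction [SecondCountableTopology V] : Measurable (direction : V → V) := by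
  unfold direction; fun_prop

lemma norm_direction {x : V} (hx : x ≠ 0) : ‖direction x‖ = 1 := by
  rw [direction, norm_smul, norm_inv, norm_norm, inv_mul_cancel₀ (norm_ne_zero_iff.2 hx)]

/-- The uniform distribution on the unit sphere: the direction of a random point of the ball. -/
noncomputable def sphereUniform (V : Type*) [NormedAddCommGroup V] [InnerProductSpace ℝ V]
    [FiniteDimensional ℝ V] [MeasurableSpace V] [BorelSpace V] : Measure V :=
  ((volume (Metric.ball (0 : V) 1))⁻¹ • volume.restrict (Metric.ball (0 : V) 1)).map direction

lemma sphereUniform_apply {A : Set V} (hA : MeasurableSet A) : sphereUniform V A =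
    (volume (Metric.ball (0 : V) 1))⁻¹ * volume {x ∈ Metric.ball (0 : V) 1 | direction x ∈ A} := by
  rw [sphereUniform, Measure.map_apply measurable_direction hA, Measure.smul_apply,
    Measure.restrict_apply (measurable_direction hA), smul_eq_mul, Set.inter_comm]
  rfl

instance : IsProbabilityMeasure (sphereUniform V) := by
  refine ⟨?_⟩
  rw [sphereUniform_apply MeasurableSet.univ]
  simp only [Set.mem_univ, and_true, Set.ofPred_mem_eq]
  exact ENNReal.inv_mul_cancel (Metric.measure_ball_pos _ _ one_pos).ne' measure_ball_lt_top.ne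

lemma RotationInvariant.direction {μ : Measure V} (hμ : RotationInvariant μ) :
    RotationInvariant (μ.map direction) := by
  intro f
  rw [Measure.map_map f.continuous.measurable measurable_direction]
  conv_rhs => rw [← hμ f]
  rw [Measure.map_map measurable_direction f.continuous.measurable]
  congr 1
  ext x
  simp [Sieve.direction]

lemma rotationInvariant_sphereUniform : RotationInvariant (sphereUniform V) := by
  refine RotationInvariant.direction fun f => ?_
  rw [Measure.map_smul]
  congr 1
  have h := (f.measurePreserving (E := V)).restrict_preimage (s := Metric.ball (0 : V) 1)
    measurableSet_ball
  have : f ⁻¹' Metric.ball (0 : V) 1 = Metric.ball 0 1 := by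
    ext x; simp
  rw [this] at h
  exact h.map_eq

lemma ae_norm_sphereUniform [Nontrivial V] : ∀ᵐ x ∂(sphereUniform V), ‖x‖ = 1 := by
  rw [sphereUniform, ae_map_iff measurable_direction.aemeasurable
    (measurableSet_eq_fun (by fun_prop) measurable_const)]
  refine Measure.ae_smul_measure (ae_restrict_of_ae ?_) _
  have : ∀ᵐ x : V, x ≠ 0 := by
    rw [ae_iff]; simp
  filter_upwards [this] with x hx
  exact norm_direction hx

lemma rotationInvariant_stdGaussian : RotationInvariant (stdGaussian V) :=
  fun f => stdGaussian_map f

/-- The marginal along `x` is a Gaussian of positive variance and has no atoms. -/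
lemma stdGaussian_inner_eq_zero {x : V} (hx : x ≠ 0) :
    stdGaussian V {g | inner ℝ x g = 0} = 0 := by
  have h := IsGaussian.map_eq_gaussianReal (μ := stdGaussian V) (innerSL ℝ x)
  have h2 : stdGaussian V {g | inner ℝ x g = 0} =
      (stdGaussian V).map (innerSL ℝ x) {0} := by
    rw [Measure.map_apply (by fun_prop) (measurableSet_singleton _)]
    rfl
  have hv : Var[innerSL ℝ x; stdGaussian V].toNNReal ≠ 0 := by
    rw [variance_dual_stdGaussian]
    simpa using hx
  rw [h2, h]
  have := nullSingletonClass_gaussianReal (μ := ∫ y, innerSL ℝ x y ∂stdGaussian V) hv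
  exact measure_singleton _

lemma stdGaussian_ae_ne_zero [Nontrivial V] : ∀ᵐ g ∂(stdGaussian V), g ≠ 0 := by
  obtain ⟨x, hx⟩ := exists_ne (0 : V)
  rw [ae_iff]
  refine measure_mono_null (fun g hg => ?_) (stdGaussian_inner_eq_zero hx)
  simp only [ne_eq, not_not, Set.mem_ofPred_eq] at hg
  simp [hg]

lemma map_direction_stdGaussian [Nontrivial V] :
    (stdGaussian V).map direction = sphereUniform V := by
  have : IsProbabilityMeasure ((stdGaussian V).map (direction : V → V)) :=
    Measure.isProbabilityMeasure_map measurable_direction.aemeasurable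
  refine RotationInvariant.eq rotationInvariant_stdGaussian.direction
    rotationInvariant_sphereUniform ?_ ae_norm_sphereUniform
  rw [ae_map_iff measurable_direction.aemeasurable
    (measurableSet_eq_fun (by fun_prop) measurable_const)]
  filter_upwards [stdGaussian_ae_ne_zero] with x hx
  exact norm_direction hx

lemma isProbabilityMeasure_uniformSphere {d : ℕ} (hd : 0 < d) :
    IsProbabilityMeasure (uniformSphere d) := by
  have : Nonempty (Fin d) := ⟨⟨0, hd⟩⟩
  refine ⟨?_⟩
  rw [uniformSphere, Measure.smul_apply, smul_eq_mul]
  refine ENNReal.inv_mul_cancel ?_ (measure_ne_top _ _)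
  rw [Measure.measure_univ_ne_zero]
  exact Measure.toSphere_ne_zero _

/-- `toSphere` gives a set the volume of the cone over it, times the dimension. The dimension
cancels on normalizing, and the cone is, up to the origin, the set of points of the ball with
direction in the set. -/
lemma map_coe_uniformSphere {d : ℕ} (hd : 0 < d) :
    (uniformSphere d).map ((↑) : Metric.sphere (0 : E d) 1 → E d) = sphereUniform (E d) := by
  have : Nonempty (Fin d) := ⟨⟨0, hd⟩⟩
  ext A hA
  rw [Measure.map_apply measurable_subtype_coe hA, sphereUniform_apply hA, uniformSphere,
    Measure.smul_apply, smul_eq_mul, Measure.toSphere_apply_univ,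
    Measure.toSphere_apply' _ (measurable_subtype_coe hA)]
  have hfin : (Module.finrank ℝ (E d) : ℝ≥0∞) ≠ 0 := by
    simp [hd.ne']
  rw [ENNReal.mul_inv (Or.inl hfin) (Or.inl (ENNReal.natCast_ne_top _)), mul_mul_mul_comm,
    ENNReal.inv_mul_cancel hfin (ENNReal.natCast_ne_top _), one_mul]
  congr 1
  refine measure_congr (eventuallyEq_set.2 ?_)
  have : ∀ᵐ x : E d, x ≠ 0 := by rw [ae_iff]; simp
  filter_upwards [this] with x hx
  have hpos : 0 < ‖x‖ := norm_pos_iff.2 hx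
  simp only [Set.mem_smul, Set.mem_image, Set.mem_preimage, mem_ball_zero_iff]
  constructor
  · rintro ⟨r, hr, y, ⟨z, hz, rfl⟩, rfl⟩
    have hz1 : ‖(z : E d)‖ = 1 := by simp
    have : direction (r • (z : E d)) = z := by
      rw [direction, norm_smul, hz1, mul_one, smul_smul, Real.norm_of_nonneg hr.1.le,
        inv_mul_cancel₀ hr.1.ne', one_smul]
    rw [this, norm_smul, hz1, mul_one, Real.norm_of_nonneg hr.1.le]
    exact ⟨hr.2, hz⟩
  · rintro ⟨h1, h2⟩
    refine ⟨‖x‖, ⟨hpos, h1⟩, direction x, ⟨⟨direction x, by simp [norm_direction hx]⟩, h2, rfl⟩, ?_⟩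
    rw [direction, smul_smul, mul_inv_cancel₀ hpos.ne', one_smul]

end rotation

/-! ## The random rotation -/

section gramSchmidt

open InnerProductSpace

variable {d : ℕ}

/-- Orthogonal projections commute with isometries. As Gaussian vectors are rotation-invariant, so
is the frame built from them. -/
lemma gramSchmidt_isometry (f : E d ≃ₗᵢ[ℝ] E d) (ω : Fin d → E d) (n : Fin d) :
    gramSchmidt ℝ (fun j => f (ω j)) n = f (gramSchmidt ℝ ω n) := by
  induction n using WellFoundedLT.induction with
  | ind n ih =>
    rw [gramSchmidt_def, gramSchmidt_def ℝ ω, map_sub, map_sum]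
    congr 1
    refine Finset.sum_congr rfl fun i hi => ?_
    rw [ih i (Finset.mem_Iio.1 hi), Submodule.starProjection_singleton,
      Submodule.starProjection_singleton, map_smul]
    simp

lemma gramSchmidtNormed_isometry (f : E d ≃ₗᵢ[ℝ] E d) (ω : Fin d → E d) (n : Fin d) :
    gramSchmidtNormed ℝ (fun j => f (ω j)) n = f (gramSchmidtNormed ℝ ω n) := by
  simp [gramSchmidtNormed, gramSchmidt_isometry]

lemma measurable_gramSchmidt (n : Fin d) :
    Measurable fun ω : Fin d → E d => gramSchmidt ℝ ω n := by
  induction n using WellFoundedLT.induction with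
  | ind n ih =>
    have h : (fun ω : Fin d → E d => gramSchmidt ℝ ω n) = fun ω => ω n - ∑ i ∈ Finset.Iio n,
        (inner ℝ (gramSchmidt ℝ ω i) (ω n) / ‖gramSchmidt ℝ ω i‖ ^ 2) • gramSchmidt ℝ ω i := by
      ext1 ω
      rw [gramSchmidt_def]
      simp_rw [Submodule.starProjection_singleton]
      rfl
    rw [h]
    refine Measurable.sub (measurable_pi_apply n) (Finset.measurable_sum _ fun i hi => ?_)
    have := ih i (Finset.mem_Iio.1 hi)
    exact ((this.inner (measurable_pi_apply n)).div (this.norm.pow_const 2)).smul this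

lemma measurable_gramSchmidtNormed (n : Fin d) :
    Measurable fun ω : Fin d → E d => gramSchmidtNormed ℝ ω n := by
  have : (fun ω : Fin d → E d => gramSchmidtNormed ℝ ω n) =
      fun ω => ‖gramSchmidt ℝ ω n‖⁻¹ • gramSchmidt ℝ ω n := rfl
  rw [this]
  exact (measurable_gramSchmidt n).norm.inv.smul (measurable_gramSchmidt n)

/-- Given the other vectors, vector `n` would have to lie in the span of the earlier ones. This has
dimension below `d`, hence lies in a hyperplane, which is a Gaussian null set. -/
lemma ae_gramSchmidt_ne_zero (n : Fin d) :
    ∀ᵐ ω ∂(Measure.pi fun _ : Fin d => stdGaussian (E d)), gramSchmidt ℝ ω n ≠ 0 := by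
  rw [ae_iff]
  have hA : MeasurableSet {ω : Fin d → E d | ¬ gramSchmidt ℝ ω n ≠ 0} := by
    simp only [not_not]
    exact measurable_gramSchmidt n (measurableSet_singleton 0)
  rw [Measure.pi_apply_eq_lintegral_update _ n hA, lintegral_eq_zero_iff' ]
  · refine Eventually.of_forall fun ω => ?_
    set W := Submodule.span ℝ (ω '' Set.Iio n) with hW
    have hlt : Module.finrank ℝ W < Module.finrank ℝ (E d) := by
      have h1 : W = Submodule.span ℝ (((Finset.Iio n).image ω : Finset (E d)) : Set (E d)) := by
        simp [hW]
      rw [h1]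
      refine (finrank_span_finset_le_card _).trans_lt (Finset.card_image_le.trans_lt ?_)
      simp
    have hne : Wᗮ ≠ ⊥ := by
      intro h
      rw [Submodule.orthogonal_eq_bot_iff] at h
      rw [h, finrank_top] at hlt
      exact lt_irrefl _ hlt
    obtain ⟨x, hx, hx0⟩ := Submodule.exists_mem_ne_zero_of_ne_bot hne
    refine measure_mono_null (fun g hg => ?_) (stdGaussian_inner_eq_zero hx0)
    simp only [ne_eq, not_not, Set.mem_ofPred_eq] at hg ⊢
    have h1 := gramSchmidt_def' ℝ (Function.update ω n g) n
    rw [hg, zero_add, Function.update_self] at h1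
    have h2 : g ∈ W := by
      rw [h1]
      refine Submodule.sum_mem _ fun i hi => ?_
      rw [Submodule.starProjection_singleton]
      refine Submodule.smul_mem _ _ ?_
      have h3 := gramSchmidt_mem_span ℝ (Function.update ω n g) (le_refl i)
      refine Submodule.span_mono ?_ h3
      rintro _ ⟨k, hk, rfl⟩
      have hkn : k < n := lt_of_le_of_lt hk (Finset.mem_Iio.1 hi)
      exact ⟨k, hkn, by rw [Function.update_of_ne hkn.ne]⟩
    exact Submodule.inner_left_of_mem_orthogonal h2 hx
  · exact (measurable_measure_prodMk_left
      (Measure.measurable_update_pair n hA)).aemeasurable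

/-- The coordinates of a vector with respect to the random rotation. -/
noncomputable def rotated (ω : Fin d → E d) (x : E d) : E d :=
  WithLp.toLp 2 fun j => inner ℝ (gramSchmidtNormed ℝ ω j) x

lemma measurable_rotated (x : E d) : Measurable fun ω : Fin d → E d => rotated ω x := by
  refine (WithLp.measurable_toLp 2 _).comp (measurable_pi_lambda _ fun j => ?_)
  exact (measurable_gramSchmidtNormed j).inner measurable_const

lemma inner_rotated (ω : Fin d → E d) (x t : E d) :
    inner ℝ (rotated ω x) t = inner ℝ x (∑ j, t j • gramSchmidtNormed ℝ ω j) := by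
  rw [inner_sum, PiLp.inner_apply]
  refine Finset.sum_congr rfl fun j _ => ?_
  rw [real_inner_smul_right]
  simp [rotated, real_inner_comm x]

lemma rotated_add (ω : Fin d → E d) (x y : E d) :
    rotated ω (x + y) = rotated ω x + rotated ω y := by
  ext j; simp [rotated, inner_add_right]

lemma rotated_smul (ω : Fin d → E d) (c : ℝ) (x : E d) :
    rotated ω (c • x) = c • rotated ω x := by
  ext j; simp [rotated, real_inner_smul_right]

/-- A uniformly rotated unit vector is uniform on the sphere. -/
lemma map_rotated {x : E d} (hx : ‖x‖ = 1) :
    (Measure.pi fun _ : Fin d => stdGaussian (E d)).map (fun ω => rotated ω x) =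
      sphereUniform (E d) := by
  have : Nontrivial (E d) := ⟨x, 0, by rintro rfl; simp at hx⟩
  set P := Measure.pi fun _ : Fin d => stdGaussian (E d) with hP
  have : IsProbabilityMeasure (P.map fun ω => rotated ω x) :=
    Measure.isProbabilityMeasure_map (measurable_rotated x).aemeasurable
  refine Measure.ext_of_charFun (funext fun t => ?_)
  have hQ : Measurable fun ω : Fin d → E d => ∑ j, t j • gramSchmidtNormed ℝ ω j :=
    Finset.measurable_sum _ fun j _ => (measurable_gramSchmidtNormed j).const_smul (t j)
  -- The left side does not depend on the unit vector `y`: an isometry moving `x` to `y`, applied to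
  -- all Gaussian vectors at once, preserves their joint law and moves the frame along.
  have h1 : ∀ y : E d, ‖y‖ = 1 →
      ∫ ω, Complex.exp (inner ℝ y (∑ j, t j • gramSchmidtNormed ℝ ω j) * Complex.I) ∂P =
      charFun (P.map fun ω => rotated ω x) t := by
    intro y hy
    rw [charFun_apply, integral_map (measurable_rotated x).aemeasurable
      (by apply Continuous.aestronglyMeasurable; fun_prop)]
    simp_rw [inner_rotated]
    obtain ⟨f, hf⟩ := exists_linearIsometryEquiv_apply_eq (hx.trans hy.symm)
    have hmp : MeasurePreserving (fun (ω : Fin d → E d) j => f (ω j)) P P :=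
      measurePreserving_pi _ _ fun _ => ⟨f.continuous.measurable, stdGaussian_map f⟩
    conv_lhs => rw [← hmp.map_eq]
    rw [integral_map hmp.measurable.aemeasurable]
    · refine integral_congr_ae (Eventually.of_forall fun ω => ?_)
      simp only [gramSchmidtNormed_isometry, ← map_smul, ← map_sum, ← hf,
        LinearIsometryEquiv.inner_map_map]
    · refine Measurable.aestronglyMeasurable ?_
      exact Complex.measurable_exp.comp ((Complex.measurable_ofReal.comp
        (measurable_const.inner hQ)).mul_const _)
  -- Therefore `y` may be averaged over the sphere. After exchanging the integrals, `ω` is fixed and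
  -- its frame orthonormal, so the argument of the characteristic function of the uniform law has
  -- norm `‖t‖`.
  have h2 : charFun (P.map fun ω => rotated ω x) t = ∫ y, ∫ ω, Complex.exp (inner ℝ y
      (∑ j, t j • gramSchmidtNormed ℝ ω j) * Complex.I) ∂P ∂(sphereUniform (E d)) := by
    have : ∀ᵐ y ∂(sphereUniform (E d)), ∫ ω, Complex.exp (inner ℝ y
      (∑ j, t j • gramSchmidtNormed ℝ ω j) * Complex.I) ∂P =
        charFun (P.map fun ω => rotated ω x) t := by
      filter_upwards [ae_norm_sphereUniform] with y hy using h1 y hy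
    rw [integral_congr_ae this]
    simp
  rw [h2, integral_integral_swap]
  · have h3 : ∀ᵐ ω ∂P, ∫ y, Complex.exp (inner ℝ y
      (∑ j, t j • gramSchmidtNormed ℝ ω j) * Complex.I) ∂(sphereUniform (E d)) =
        charFun (sphereUniform (E d)) t := by
      have : ∀ᵐ ω ∂P, ∀ n, gramSchmidt ℝ ω n ≠ 0 := ae_all_iff.2 ae_gramSchmidt_ne_zero
      filter_upwards [this] with ω hω
      rw [← charFun_apply]
      refine rotationInvariant_sphereUniform.charFun_eq ?_
      have hon : Orthonormal ℝ (gramSchmidtNormed ℝ ω) := by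
        refine ⟨fun n => gramSchmidtNormed_unit_length' ?_, fun i j hij => ?_⟩
        · rw [gramSchmidtNormed]
          refine smul_ne_zero ?_ (hω n)
          simpa using hω n
        · simp [gramSchmidtNormed, real_inner_smul_left, real_inner_smul_right,
            gramSchmidt_orthogonal ℝ ω hij]
      have := hon.inner_sum t t Finset.univ
      rw [← pow_left_inj₀ (norm_nonneg _) (norm_nonneg _) two_ne_zero,
        EuclideanSpace.real_norm_sq_eq t, ← real_inner_self_eq_norm_sq, this]
      simp [sq]
    rw [integral_congr_ae h3]
    simp
  · refine Integrable.of_bound (C := 1) (Measurable.aestronglyMeasurable ?_)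
      (Eventually.of_forall fun p => ?_)
    · exact Complex.measurable_exp.comp ((Complex.measurable_ofReal.comp
        (measurable_fst.inner (hQ.comp measurable_snd))).mul_const _)
    · simp only [Function.uncurry]
      rw [Complex.norm_exp_ofReal_mul_I]

end gramSchmidt

end Sieve

namespace Sieve

/-! ## Spherical caps and wedges -/

section caps

variable {V : Type*} [NormedAddCommGroup V] [InnerProductSpace ℝ V] [FiniteDimensional ℝ V]
  [MeasurableSpace V] [BorelSpace V]

lemma volume_ball_mul (r : ℝ) (hr : 0 ≤ r) : (volume (Metric.ball (0 : V) 1))⁻¹ *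
    volume (Metric.closedBall (0 : V) r) = ENNReal.ofReal (r ^ Module.finrank ℝ V) := by
  rw [Measure.addHaar_closedBall _ _ hr, mul_left_comm, ENNReal.inv_mul_cancel
    (Metric.measure_ball_pos _ _ one_pos).ne' measure_ball_lt_top.ne, mul_one]

lemma volume_ball_mul' (r : ℝ) (hr : 0 < r) : (volume (Metric.ball (0 : V) 1))⁻¹ *
    volume (Metric.ball (0 : V) r) = ENNReal.ofReal (r ^ Module.finrank ℝ V) := by
  rw [Measure.addHaar_ball_of_pos _ _ hr, mul_left_comm, ENNReal.inv_mul_cancel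
    (Metric.measure_ball_pos _ _ one_pos).ne' measure_ball_lt_top.ne, mul_one]

/-- The part of the unit ball in the cone over the cap lies in the ball of radius √(3/4) around c/2:
there ‖x - c/2‖² = ‖x‖² - ⟪x, c⟫ + ‖c‖²/4 ≤ ‖x‖² - ‖x‖/2 + 1/4 ≤ 3/4. -/
lemma sphereUniform_cap_le {c : V} (hc : ‖c‖ ≤ 1) :
    sphereUniform V {v | 1 / 2 ≤ inner ℝ v c} ≤
      ENNReal.ofReal (Real.sqrt (3 / 4) ^ Module.finrank ℝ V) := by
  rw [sphereUniform_apply (measurableSet_le measurable_const (by fun_prop)),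
    ← volume_ball_mul _ (Real.sqrt_nonneg _),
    ← Measure.addHaar_closedBall_center volume ((1 / 2 : ℝ) • c)]
  gcongr
  intro x hx
  simp only [Set.mem_ofPred_eq, mem_ball_zero_iff] at hx
  obtain ⟨h1, h2⟩ := hx
  have hx0 : 0 < ‖x‖ := by
    rw [norm_pos_iff]
    rintro rfl
    simp [direction] at h2
    norm_num at h2
  rw [direction, real_inner_smul_left, inv_mul_eq_div, le_div_iff₀ hx0] at h2
  rw [Metric.mem_closedBall, dist_eq_norm]
  refine Real.le_sqrt_of_sq_le ?_
  rw [@norm_sub_sq_real, norm_smul, real_inner_smul_right, Real.norm_of_nonneg (by norm_num)]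
  nlinarith [norm_nonneg c]

omit [FiniteDimensional ℝ V] [MeasurableSpace V] [BorelSpace V] in
-- Stretching a vector of norm below 1 to length 1 only increases a positive inner product. So lower
-- bounds on the sphere follow from exhibiting part of a ball.
lemma le_of_norm_lt_one {x a : V} {h : ℝ} (hh : 0 < h) (hx : ‖x‖ < 1) (ha : h ≤ inner ℝ x a) :
    h ≤ inner ℝ (direction x) a := by
  have hx0 : 0 < ‖x‖ := by
    rw [norm_pos_iff]
    rintro rfl
    simp at ha
    linarith
  rw [direction, real_inner_smul_left, inv_mul_eq_div, le_div_iff₀ hx0]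
  nlinarith

/-- Let S be the slab of points of the ball of radius r whose height along e is between 0 and 1/k.
Its k translates along e, with their reflections, cover that ball, so S has at least 1/(2k) of its
volume. Shifted by h e, the slab stays in the unit ball, as ‖z + h e‖² < r² + 2h/k + h², and reaches
height h. -/
lemma le_sphereUniform_cap {e : V} (he : ‖e‖ = 1) {h r : ℝ} (hh : 0 < h) (hr : 0 < r)
    {k : ℕ} (hk : 0 < k) (hle : h ^ 2 + 2 * h / k + r ^ 2 ≤ 1) :
    ENNReal.ofReal (r ^ Module.finrank ℝ V) ≤
      (2 * k : ℕ) * sphereUniform V {v | h ≤ inner ℝ v e} := by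
  have hk' : (0 : ℝ) < k := by exact_mod_cast hk
  have hr1 : r ≤ 1 := by
    have : 0 ≤ 2 * h / k := by positivity
    nlinarith [sq_nonneg h]
  set S : Set V := {z ∈ Metric.ball (0 : V) r | 0 ≤ inner ℝ z e ∧ inner ℝ z e ≤ 1 / k} with hS
  have hcover : Metric.ball (0 : V) r ⊆
      (⋃ j ∈ Finset.range k, (fun z => z - ((j / k : ℝ) • e)) ⁻¹' S) ∪
      ⋃ j ∈ Finset.range k, (fun z => -z) ⁻¹' ((fun z => z - ((j / k : ℝ) • e)) ⁻¹' S) := by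
    have hpos : ∀ z ∈ Metric.ball (0 : V) r, 0 ≤ inner ℝ z e →
        z ∈ ⋃ j ∈ Finset.range k, (fun z => z - ((j / k : ℝ) • e)) ⁻¹' S := by
      intro z hz hze
      rw [mem_ball_zero_iff] at hz
      have h1 : inner ℝ z e < 1 := by
        have := real_inner_le_norm z e
        rw [he, mul_one] at this
        linarith
      set s : ℝ := inner ℝ z e with hs
      have hj0 : (⌊s * k⌋₊ : ℝ) ≤ s * k := Nat.floor_le (by positivity)
      have hj1 : s * k < ⌊s * k⌋₊ + 1 := Nat.lt_floor_add_one _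
      have hj2 : ⌊s * k⌋₊ < k := by
        rw [Nat.floor_lt (by positivity)]
        nlinarith
      simp only [Set.mem_iUnion, Finset.mem_range]
      refine ⟨⌊s * k⌋₊, hj2, ?_⟩
      set j : ℝ := (⌊s * k⌋₊ : ℝ) / k with hj
      have hjs : j ≤ s := by rw [hj, div_le_iff₀ hk']; exact hj0
      have hjs' : s - j ≤ 1 / k := by
        rw [sub_le_iff_le_add, hj, ← add_div, le_div_iff₀ hk']; linarith
      have hj0' : 0 ≤ j := by positivity
      have hee : inner ℝ e e = (1 : ℝ) := by rw [real_inner_self_eq_norm_sq, he]; norm_num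
      have hin : inner ℝ (z - j • e) e = s - j := by
        rw [inner_sub_left, real_inner_smul_left, hee, mul_one]
      refine ⟨?_, by rw [hin]; linarith, by rw [hin]; exact hjs'⟩
      rw [mem_ball_zero_iff]
      refine lt_of_le_of_lt ?_ hz
      -- Lowering `z` along `e` by `j`, at most its height, does not increase its norm.
      refine le_of_sq_le_sq ?_ (norm_nonneg _)
      rw [@norm_sub_sq_real, real_inner_smul_right, ← hs, norm_smul, he,
        Real.norm_of_nonneg hj0', mul_one]
      nlinarith
    intro z hz
    rcases le_total 0 (inner ℝ z e) with h0 | h0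
    · exact Or.inl (hpos z hz h0)
    · refine Or.inr ?_
      have := hpos (-z) (by simpa using hz) (by rw [inner_neg_left]; linarith)
      simpa using this
  have hSm : MeasurableSet S := by
    exact measurableSet_ball.inter (MeasurableSet.inter
      (measurableSet_le (f := fun _ => (0 : ℝ)) (g := fun z : V => inner ℝ z e) measurable_const
        (by fun_prop))
      (measurableSet_le (f := fun z : V => inner ℝ z e) (g := fun _ => (1 / k : ℝ)) (by fun_prop)
        measurable_const))
  have hsub : ∀ j : ℕ, volume ((fun z : V => z - ((j / k : ℝ) • e)) ⁻¹' S) = volume S := by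
    intro j
    simp only [sub_eq_add_neg]
    exact measure_preimage_add_right volume _ S
  have hneg : ∀ j : ℕ, volume ((fun z : V => -z) ⁻¹' ((fun z => z - ((j / k : ℝ) • e)) ⁻¹' S)) =
      volume S := by
    intro j
    rw [← hsub j]
    exact Measure.measure_preimage_neg volume _
  have hvol : volume (Metric.ball (0 : V) r) ≤ (2 * k : ℕ) * volume S := by
    refine (measure_mono hcover).trans ((measure_union_le _ _).trans ?_)
    have h1 := measure_biUnion_finset_le (μ := volume) (Finset.range k)
      (fun j : ℕ => (fun z : V => z - ((j / k : ℝ) • e)) ⁻¹' S)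
    have h2 := measure_biUnion_finset_le (μ := volume) (Finset.range k)
      (fun j : ℕ => (fun z : V => -z) ⁻¹' ((fun z => z - ((j / k : ℝ) • e)) ⁻¹' S))
    simp only [hsub, hneg, Finset.sum_const, Finset.card_range, nsmul_eq_mul] at h1 h2
    refine (add_le_add h1 h2).trans (le_of_eq ?_)
    push_cast; ring
  rw [sphereUniform_apply (measurableSet_le measurable_const (by fun_prop)),
    ← volume_ball_mul' _ hr, mul_left_comm]
  gcongr
  refine hvol.trans (mul_le_mul_right ?_ _)
  rw [show volume S = volume ((fun z : V => z + -(h • e)) ⁻¹' S) from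
    (measure_preimage_add_right volume _ S).symm]
  refine measure_mono fun x hx => ?_
  obtain ⟨z, hz⟩ : ∃ z, z = x + -(h • e) := ⟨_, rfl⟩
  obtain ⟨h1, h2, h3⟩ : z ∈ S := hz ▸ hx
  rw [mem_ball_zero_iff] at h1
  have hxz : x = z + h • e := by rw [hz]; abel
  have hee : inner ℝ e e = (1 : ℝ) := by rw [real_inner_self_eq_norm_sq, he]; norm_num
  have hxe : inner ℝ x e = inner ℝ z e + h := by
    rw [hxz, inner_add_left, real_inner_smul_left, hee, mul_one]
  have hx1 : ‖x‖ < 1 := by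
    refine lt_of_pow_lt_pow_left₀ 2 (by norm_num) ?_
    rw [hxz, @norm_add_sq_real, real_inner_smul_right, norm_smul, he, Real.norm_of_nonneg hh.le]
    have h4 : ‖z‖ ^ 2 < r ^ 2 := by
      have := norm_nonneg z
      nlinarith
    have h5 : h * inner ℝ z e ≤ h * (1 / k) := mul_le_mul_of_nonneg_left h3 hh.le
    have h6 : 2 * h / k = 2 * (h * (1 / k)) := by ring
    nlinarith
  simp only [Set.mem_ofPred_eq, mem_ball_zero_iff]
  exact ⟨hx1, le_of_norm_lt_one hh hx1 (by linarith)⟩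

/-- The second moment of the ball along any direction. -/
lemma lintegral_ball_inner_sq_le {r : ℝ} (hr : r ≤ 1) (a : V) :
    Module.finrank ℝ V * ∫⁻ z in Metric.ball (0 : V) r, ENNReal.ofReal (inner ℝ z a ^ 2) ≤
      ENNReal.ofReal (‖a‖ ^ 2) * volume (Metric.ball (0 : V) r) := by
  set b := stdOrthonormalBasis ℝ V
  have hinv : ∀ i, ∫⁻ z in Metric.ball (0 : V) r, ENNReal.ofReal (inner ℝ z a ^ 2) =
      ENNReal.ofReal (‖a‖ ^ 2) *
        ∫⁻ z in Metric.ball (0 : V) r, ENNReal.ofReal (inner ℝ z (b i) ^ 2) := by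
    intro i
    rw [← lintegral_const_mul _ (by fun_prop)]
    obtain ⟨f, hf⟩ := exists_linearIsometryEquiv_apply_eq (x := a) (y := ‖a‖ • b i)
      (by simp [norm_smul])
    have hpre : f ⁻¹' Metric.ball (0 : V) r = Metric.ball 0 r := by
      ext x; simp
    have h := (f.measurePreserving (E := V)).restrict_preimage (s := Metric.ball (0 : V) r)
      measurableSet_ball
    rw [hpre] at h
    conv_rhs => rw [← h.map_eq]
    rw [lintegral_map (by fun_prop) f.continuous.measurable]
    refine lintegral_congr fun z => ?_
    rw [← ENNReal.ofReal_mul (by positivity)]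
    congr 1
    rw [← f.inner_map_map z a, hf, real_inner_smul_right]
    ring
  have hsum : ∑ i, ∫⁻ z in Metric.ball (0 : V) r, ENNReal.ofReal (inner ℝ z (b i) ^ 2) ≤
      volume (Metric.ball (0 : V) r) := by
    rw [← lintegral_finsetSum _ (fun i _ => by fun_prop)]
    have : ∀ z ∈ Metric.ball (0 : V) r,
        ∑ i, ENNReal.ofReal (inner ℝ z (b i) ^ 2) ≤ 1 := by
      intro z hz
      rw [← ENNReal.ofReal_sum_of_nonneg (fun i _ => sq_nonneg _)]
      rw [mem_ball_zero_iff] at hz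
      have h1 := b.sum_sq_inner_left z
      rw [h1, ← ENNReal.ofReal_one]
      exact ENNReal.ofReal_le_ofReal (pow_le_one₀ (norm_nonneg _) (hz.le.trans hr))
    calc _ ≤ ∫⁻ z in Metric.ball (0 : V) r, 1 := setLIntegral_mono' measurableSet_ball this
      _ = _ := by simp
  have : (Module.finrank ℝ V : ℝ≥0∞) * ∫⁻ z in Metric.ball (0 : V) r,
      ENNReal.ofReal (inner ℝ z a ^ 2) = ENNReal.ofReal (‖a‖ ^ 2) *
      ∑ i, ∫⁻ z in Metric.ball (0 : V) r, ENNReal.ofReal (inner ℝ z (b i) ^ 2) := by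
    rw [Finset.mul_sum, ← Finset.sum_congr rfl fun i _ => hinv i]
    simp
  rw [this]
  gcongr

/-- Markov's inequality: the mean of ⟪z, a⟫² over the ball is at most ‖a‖²/n ≤ 2/n, and 2/(nδ²) ≤
1/4. -/
lemma volume_ball_slab_le {r δ : ℝ} (hr : r ≤ 1) (hδ : 0 < δ)
    (hn : 8 ≤ Module.finrank ℝ V * δ ^ 2) {a : V} (ha : ‖a‖ ^ 2 ≤ 2) :
    4 * volume {z ∈ Metric.ball (0 : V) r | δ ≤ |inner ℝ z a|} ≤
      volume (Metric.ball (0 : V) r) := by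
  have h1 := lintegral_ball_inner_sq_le (V := V) hr a
  have h2 := mul_meas_ge_le_lintegral (μ := volume.restrict (Metric.ball (0 : V) r))
    (f := fun z => ENNReal.ofReal (inner ℝ z a ^ 2)) (by fun_prop) (ENNReal.ofReal (δ ^ 2))
  have h3 : {z : V | ENNReal.ofReal (δ ^ 2) ≤ ENNReal.ofReal (inner ℝ z a ^ 2)} =
      {z | δ ≤ |inner ℝ z a|} := by
    ext z
    simp only [Set.mem_ofPred_eq]
    rw [ENNReal.ofReal_le_ofReal_iff (sq_nonneg _), ← sq_abs (inner ℝ z a),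
      pow_le_pow_iff_left₀ hδ.le (abs_nonneg _) two_ne_zero]
  rw [h3, Measure.restrict_apply (measurableSet_le measurable_const (by fun_prop))] at h2
  have h4 : {z : V | δ ≤ |inner ℝ z a|} ∩ Metric.ball 0 r =
      {z ∈ Metric.ball (0 : V) r | δ ≤ |inner ℝ z a|} := by
    rw [Set.inter_comm]; rfl
  rw [h4] at h2
  set X := volume {z ∈ Metric.ball (0 : V) r | δ ≤ |inner ℝ z a|}
  set B := volume (Metric.ball (0 : V) r)
  have h5 : ENNReal.ofReal (Module.finrank ℝ V * δ ^ 2) * X ≤ ENNReal.ofReal (‖a‖ ^ 2) * B := by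
    rw [ENNReal.ofReal_mul (by positivity), mul_assoc, ENNReal.ofReal_natCast]
    exact (mul_le_mul_right h2 _).trans h1
  have h6 : 8 * X ≤ 2 * B := by
    refine le_trans ?_ (h5.trans ?_)
    · gcongr
      have := ENNReal.ofReal_le_ofReal hn
      simpa using this
    · gcongr
      have := ENNReal.ofReal_le_ofReal ha
      simpa using this
  have h7 : 2 * (4 * X) ≤ 2 * B := by rw [← mul_assoc]; norm_num; exact h6
  exact (ENNReal.mul_le_mul_iff_right (by norm_num) (by norm_num)).1 h7

omit [FiniteDimensional ℝ V] in
lemma measurableSet_wedge [SecondCountableTopology V] (a b : V) :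
    MeasurableSet {v : V | 1 / 2 ≤ inner ℝ v a ∧ 1 / 2 ≤ inner ℝ v b} :=
  (measurableSet_le (f := fun _ => (1 / 2 : ℝ)) (g := fun v : V => inner ℝ v a) measurable_const
    (by fun_prop)).inter (measurableSet_le (f := fun _ => (1 / 2 : ℝ))
    (g := fun v : V => inner ℝ v b) measurable_const (by fun_prop))

/-- For unit vectors at exactly 60°, the shortest point with inner product 1/2 with both is (a +
b)/3, of squared norm 1/3. This leaves squared radius 2/3 for a ball orthogonal to a and b. In high
dimension half of a full ball is nearly orthogonal to both, so it serves as well, at the cost of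
terms in δ. -/
lemma le_sphereUniform_wedge {δ : ℝ} (hδ : 0 < δ) (hδ' : δ ≤ 1 / 100)
    (hn : 8 ≤ Module.finrank ℝ V * δ ^ 2) {a b : V} (ha : |‖a‖ ^ 2 - 1| ≤ δ)
    (hb : |‖b‖ ^ 2 - 1| ≤ δ) (hab : 3 * (1 - δ) ≤ ‖a + b‖ ^ 2) :
    ENNReal.ofReal (Real.sqrt (2 / 3 - 6 * δ) ^ Module.finrank ℝ V) ≤
      2 * sphereUniform V {v | 1 / 2 ≤ inner ℝ v a ∧ 1 / 2 ≤ inner ℝ v b} := by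
  set r := Real.sqrt (2 / 3 - 6 * δ) with hr
  have hrsq : r ^ 2 = 2 / 3 - 6 * δ := Real.sq_sqrt (by linarith)
  have hr0 : 0 < r := Real.sqrt_pos.2 (by linarith)
  have hr1 : r ≤ 1 := by nlinarith
  rw [abs_le] at ha hb
  set S : Set V := {z ∈ Metric.ball (0 : V) r | |inner ℝ z a| < δ ∧ |inner ℝ z b| < δ} with hS
  have hSvol : volume (Metric.ball (0 : V) r) ≤ 2 * volume S := by
    have h1 := volume_ball_slab_le (V := V) hr1 hδ hn (a := a) (by linarith)
    have h2 := volume_ball_slab_le (V := V) hr1 hδ hn (a := b) (by linarith)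
    have h3 : volume (Metric.ball (0 : V) r) ≤ volume S +
        (volume {z ∈ Metric.ball (0 : V) r | δ ≤ |inner ℝ z a|} +
        volume {z ∈ Metric.ball (0 : V) r | δ ≤ |inner ℝ z b|}) := by
      refine (measure_mono ?_).trans ((measure_union_le _ _).trans
        (add_le_add le_rfl (measure_union_le _ _)))
      intro z hz
      by_cases h4 : δ ≤ |inner ℝ z a|
      · exact Or.inr (Or.inl ⟨hz, h4⟩)
      · by_cases h5 : δ ≤ |inner ℝ z b|
        · exact Or.inr (Or.inr ⟨hz, h5⟩)
        · exact Or.inl ⟨hz, not_le.1 h4, not_le.1 h5⟩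
    -- Each of the two discarded regions takes at most a quarter of the ball.
    have h4 : 4 * volume (Metric.ball (0 : V) r) ≤
        4 * volume S + 2 * volume (Metric.ball (0 : V) r) := by
      refine (mul_le_mul_right h3 4).trans ?_
      rw [mul_add, mul_add]
      refine add_le_add le_rfl ((add_le_add h1 h2).trans (le_of_eq ?_))
      rw [two_mul]
    have h5 : 2 * volume (Metric.ball (0 : V) r) + 2 * volume (Metric.ball (0 : V) r) ≤
        2 * (2 * volume S) + 2 * volume (Metric.ball (0 : V) r) := by
      refine le_trans (le_of_eq ?_) (h4.trans (le_of_eq ?_)) <;> ring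
    have h6 := (ENNReal.add_le_add_iff_right
      (ENNReal.mul_ne_top (by norm_num) measure_ball_lt_top.ne)).1 h5
    exact (ENNReal.mul_le_mul_iff_right (by norm_num) (by norm_num)).1 h6
  have hmeas : MeasurableSet {v : V | 1 / 2 ≤ inner ℝ v a ∧ 1 / 2 ≤ inner ℝ v b} :=
    measurableSet_wedge a b
  rw [sphereUniform_apply hmeas, ← volume_ball_mul' _ hr0, mul_left_comm]
  gcongr
  refine hSvol.trans (mul_le_mul_right ?_ _)
  set t := ‖a + b‖ ^ 2 with ht
  have ht0 : 0 < t := by nlinarith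
  -- The excess 5δ over the ideal 1/t pays for the inner products of `z`, at least -δ, and for the
  -- difference of ‖a‖² and ‖b‖². In the norm it costs 4δ, the mixed terms cost 3δ/2, and the 6δ
  -- taken off r² cover both.
  set κ := (1 + 5 * δ) / t with hκ
  have hκ0 : 0 < κ := by positivity
  have hκt : κ * t = 1 + 5 * δ := div_mul_cancel₀ _ ht0.ne'
  have hκ1 : κ ≤ 3 / 8 := by
    rw [hκ, div_le_iff₀ ht0]; nlinarith
  rw [show volume S = volume ((fun z : V => z + -(κ • (a + b))) ⁻¹' S) from
    (measure_preimage_add_right volume _ S).symm]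
  refine measure_mono fun x hx => ?_
  obtain ⟨z, hz⟩ : ∃ z, z = x + -(κ • (a + b)) := ⟨_, rfl⟩
  obtain ⟨h1, h2, h3⟩ : z ∈ S := hz ▸ hx
  rw [mem_ball_zero_iff] at h1
  have hxz : x = z + κ • (a + b) := by rw [hz]; abel
  rw [abs_lt] at h2 h3
  have htab : t = ‖a‖ ^ 2 + 2 * inner ℝ a b + ‖b‖ ^ 2 := by rw [ht, @norm_add_sq_real]
  have hxa : 1 / 2 ≤ inner ℝ x a := by
    rw [hxz, inner_add_left, real_inner_smul_left, inner_add_left, real_inner_self_eq_norm_sq,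
      real_inner_comm a b]
    have : κ * (‖a‖ ^ 2 + inner ℝ a b) = κ * t / 2 + κ * (‖a‖ ^ 2 - ‖b‖ ^ 2) / 2 := by
      rw [htab]; ring
    rw [this, hκt]
    nlinarith
  have hxb : 1 / 2 ≤ inner ℝ x b := by
    rw [hxz, inner_add_left, real_inner_smul_left, inner_add_left, real_inner_self_eq_norm_sq]
    have : κ * (inner ℝ a b + ‖b‖ ^ 2) = κ * t / 2 + κ * (‖b‖ ^ 2 - ‖a‖ ^ 2) / 2 := by
      rw [htab]; ring
    rw [this, hκt]
    nlinarith
  have hx1 : ‖x‖ < 1 := by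
    refine lt_of_pow_lt_pow_left₀ 2 (by norm_num) ?_
    rw [hxz, @norm_add_sq_real, real_inner_smul_right, norm_smul, mul_pow,
      Real.norm_of_nonneg hκ0.le, ← ht, inner_add_right]
    have h4 : ‖z‖ ^ 2 < r ^ 2 := by
      have := norm_nonneg z
      nlinarith
    have h5 : κ * (inner ℝ z a + inner ℝ z b) ≤ 3 / 8 * (2 * δ) :=
      (mul_le_mul_of_nonneg_left (by linarith) hκ0.le).trans
        (mul_le_mul_of_nonneg_right hκ1 (by linarith))
    have h6 : κ ^ 2 * t ≤ 1 / 3 + 4 * δ := by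
      have : κ ^ 2 * t = (1 + 5 * δ) * κ := by rw [← hκt]; ring
      rw [this, hκ, mul_div_assoc', div_le_iff₀ ht0]
      nlinarith
    linarith
  simp only [Set.mem_ofPred_eq, mem_ball_zero_iff]
  exact ⟨hx1, le_of_norm_lt_one (by norm_num) hx1 hxa, le_of_norm_lt_one (by norm_num) hx1 hxb⟩

end caps

end Sieve

namespace Sieve

/-! ## The blocks of coordinates -/

section blocks

variable {d : ℕ}

/-- The coordinates in block `i`. -/
abbrev Block (d : ℕ) (i : Fin (numBlocks d)) : Type := {j : Fin d // (j : ℕ) % numBlocks d = i}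

/-- The restriction of a vector to a block. -/
noncomputable def restr (i : Fin (numBlocks d)) : E d →ₗ[ℝ] EuclideanSpace ℝ (Block d i) where
  toFun g := WithLp.toLp 2 fun j => g j
  map_add' _ _ := rfl
  map_smul' _ _ := rfl

lemma restr_apply (i : Fin (numBlocks d)) (g : E d) (j : Block d i) : restr i g j = g j := rfl

lemma continuous_restr (i : Fin (numBlocks d)) : Continuous (restr (d := d) i) :=
  LinearMap.continuous_of_finiteDimensional _

lemma norm_restr_sq (i : Fin (numBlocks d)) (g : E d) : ‖restr i g‖ ^ 2 =
    ∑ j with ((j : Fin d) : ℕ) % numBlocks d = i, g j ^ 2 := by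
  rw [EuclideanSpace.real_norm_sq_eq]
  simp only [restr_apply]
  rw [Finset.sum_subtype (p := fun j : Fin d => (j : ℕ) % numBlocks d = i) _ (by simp)]

lemma sum_norm_restr_sq (g : E d) : ∑ i, ‖restr i g‖ ^ 2 = ‖g‖ ^ 2 := by
  simp_rw [norm_restr_sq]
  rw [EuclideanSpace.real_norm_sq_eq]
  have := Finset.sum_fiberwise_of_maps_to (s := (Finset.univ : Finset (Fin d)))
    (t := (Finset.univ : Finset (Fin (numBlocks d))))
    (g := fun j => ⟨(j : ℕ) % numBlocks d, Nat.mod_lt _ numBlocks_pos⟩) (by simp)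
    (fun j => g j ^ 2)
  simpa [Fin.ext_iff] using this

lemma card_block (i : Fin (numBlocks d)) : Fintype.card (Block d i) =
    (Finset.univ.filter fun j : Fin d => (j : ℕ) % numBlocks d = i).card := by
  rw [Fintype.card_subtype]

lemma sum_card_block (d : ℕ) : ∑ i, Fintype.card (Block d i) = d := by
  simp_rw [card_block]
  have := Finset.card_eq_sum_card_fiberwise (s := (Finset.univ : Finset (Fin d)))
    (t := (Finset.univ : Finset (Fin (numBlocks d))))
    (f := fun j => ⟨(j : ℕ) % numBlocks d, Nat.mod_lt _ numBlocks_pos⟩) (by simp)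
  simp only [Finset.card_univ, Fintype.card_fin, Fin.ext_iff] at this
  exact this.symm

lemma card_block_bounds (i : Fin (numBlocks d)) : d / numBlocks d ≤ Fintype.card (Block d i) ∧
    Fintype.card (Block d i) ≤ d / numBlocks d + 1 := by
  have h1 : Fintype.card (Block d i) =
      Nat.count (fun x => x ≡ (i : ℕ) [MOD numBlocks d]) d := by
    rw [card_block, Nat.count_eq_card_filter_range]
    refine Finset.card_bij (fun j _ => (j : ℕ)) ?_ (fun a _ b _ h => Fin.ext h) ?_
    · intro j hj
      have := (Finset.mem_filter.1 hj).2
      simp [Nat.ModEq, Nat.mod_eq_of_lt i.2, this]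
    · intro j hj
      simp only [Finset.mem_filter, Finset.mem_range, Nat.ModEq, Nat.mod_eq_of_lt i.2] at hj
      exact ⟨⟨j, hj.1⟩, by simpa using hj.2, rfl⟩
  rw [h1, Nat.count_modEq_card d numBlocks_pos]
  split_ifs <;> omega

/-- Extending `t` by zero outside the block gives a vector of the same norm with the same inner
products, so the characteristic functions agree. -/
lemma map_restr_stdGaussian (i : Fin (numBlocks d)) : (stdGaussian (E d)).map (restr i) =
    stdGaussian (EuclideanSpace ℝ (Block d i)) := by
  have : IsProbabilityMeasure ((stdGaussian (E d)).map (restr i)) :=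
    Measure.isProbabilityMeasure_map (continuous_restr i).aemeasurable
  refine Measure.ext_of_charFun (funext fun t => ?_)
  set t' : E d := WithLp.toLp 2 fun j =>
    if h : (j : ℕ) % numBlocks d = i then t ⟨j, h⟩ else 0 with ht'
  have hinner : ∀ x : E d, inner ℝ (restr i x) t = inner ℝ x t' := by
    intro x
    rw [PiLp.inner_apply, PiLp.inner_apply, ← Finset.sum_filter_add_sum_filter_not Finset.univ
      (fun j : Fin d => (j : ℕ) % numBlocks d = i), Finset.sum_subtype
      (p := fun j : Fin d => (j : ℕ) % numBlocks d = i) (Finset.univ.filter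
      (fun j : Fin d => (j : ℕ) % numBlocks d = i)) (by simp)]
    have h2 : ∑ j with ¬ ((j : Fin d) : ℕ) % numBlocks d = i, inner ℝ (x j) (t' j) = 0 := by
      refine Finset.sum_eq_zero fun j hj => ?_
      have := (Finset.mem_filter.1 hj).2
      simp [ht', this]
    rw [h2, add_zero]
    refine Finset.sum_congr rfl fun j _ => ?_
    simp [ht', j.2, restr_apply]
  have hnorm : ‖t'‖ = ‖t‖ := by
    have h1 : restr i t' = t := by
      ext j; simp [ht', restr_apply, j.2]
    have h2 := hinner t'
    rw [h1, real_inner_self_eq_norm_sq, real_inner_self_eq_norm_sq] at h2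
    exact ((pow_left_inj₀ (norm_nonneg _) (norm_nonneg _) two_ne_zero).1 h2).symm
  rw [charFun_stdGaussian, charFun_apply, integral_map (continuous_restr i).aemeasurable
    (by apply Continuous.aestronglyMeasurable; fun_prop)]
  simp_rw [hinner]
  rw [← charFun_apply, charFun_stdGaussian, hnorm]

lemma inner_blockWord (i : Fin (numBlocks d)) (g u : E d) :
    inner ℝ u (blockWord i g) = inner ℝ (direction (restr i g)) (restr i u) := by
  set w : E d := WithLp.toLp 2 fun j => if (j : ℕ) % numBlocks d = i then g j else 0 with hw
  have hinner : ∀ x : E d, inner ℝ x w = inner ℝ (restr i g) (restr i x) := by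
    intro x
    rw [PiLp.inner_apply, PiLp.inner_apply, ← Finset.sum_filter_add_sum_filter_not Finset.univ
      (fun j : Fin d => (j : ℕ) % numBlocks d = i), Finset.sum_subtype
      (p := fun j : Fin d => (j : ℕ) % numBlocks d = i) (Finset.univ.filter
      (fun j : Fin d => (j : ℕ) % numBlocks d = i)) (by simp)]
    have h2 : ∑ j with ¬ ((j : Fin d) : ℕ) % numBlocks d = i, inner ℝ (x j) (w j) = 0 := by
      refine Finset.sum_eq_zero fun j hj => ?_
      have := (Finset.mem_filter.1 hj).2
      simp [hw, this]
    rw [h2, add_zero]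
    refine Finset.sum_congr rfl fun j _ => ?_
    simp [hw, j.2, restr_apply, mul_comm]
  have hnorm : ‖w‖ = ‖restr i g‖ := by
    have h1 : restr i w = restr i g := by
      ext j; simp [hw, restr_apply, j.2]
    have h2 := hinner w
    rw [h1, real_inner_self_eq_norm_sq, real_inner_self_eq_norm_sq] at h2
    exact (pow_left_inj₀ (norm_nonneg _) (norm_nonneg _) two_ne_zero).1 h2
  rw [blockWord, ← hw, normalized, real_inner_smul_right, hinner, hnorm, direction,
    real_inner_smul_left]

/-- The rotation is shifted from the code to the vector, so that each block sees only its own words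
and its part of the rotated vector. -/
lemma partValue_eq (ω : RoundCoins d) {x : E d} (hx : ‖x‖ = 1) (i : Fin (numBlocks d))
    (b : Fin (blockSize d)) : partValue ω x i b = (Real.sqrt (numBlocks d))⁻¹ *
      inner ℝ (direction (restr i (ω.2 i b))) (restr i (rotated ω.1 x)) := by
  rw [partValue, codePart, normalized, hx, inv_one, one_smul, real_inner_smul_right,
    ← inner_rotated, inner_blockWord]

/-! ## Rotated vectors are evenly spread over the blocks -/

/-- The vector `x` has about the same squared length in every block. -/
def Balanced (δ : ℝ) (x : E d) : Prop :=
  ∀ i : Fin (numBlocks d), |numBlocks d * ‖restr i x‖ ^ 2 - ‖x‖ ^ 2| ≤ δ * ‖x‖ ^ 2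

lemma measurableSet_balanced (δ : ℝ) : MeasurableSet {x : E d | Balanced δ x} := by
  have : {x : E d | Balanced δ x} = ⋂ i : Fin (numBlocks d),
      {x : E d | |numBlocks d * ‖restr i x‖ ^ 2 - ‖x‖ ^ 2| ≤ δ * ‖x‖ ^ 2} := by
    ext x; simp [Balanced]
  rw [this]
  refine MeasurableSet.iInter fun i => measurableSet_le ?_ (by fun_prop)
  have := (continuous_restr (d := d) i).measurable
  have h2 : Measurable fun x : E d => (numBlocks d : ℝ) * ‖restr i x‖ ^ 2 - ‖x‖ ^ 2 := by fun_prop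
  exact continuous_abs.measurable.comp h2

lemma balanced_smul {δ c : ℝ} (hc : c ≠ 0) {x : E d} :
    Balanced δ (c • x) ↔ Balanced δ x := by
  have hc2 : 0 < c ^ 2 := by positivity
  refine forall_congr' fun i => ?_
  rw [map_smul, norm_smul, norm_smul, mul_pow, mul_pow, Real.norm_eq_abs, sq_abs]
  have : (numBlocks d : ℝ) * (c ^ 2 * ‖restr i x‖ ^ 2) - c ^ 2 * ‖x‖ ^ 2 =
      c ^ 2 * (numBlocks d * ‖restr i x‖ ^ 2 - ‖x‖ ^ 2) := by ring
  rw [this, abs_mul, abs_of_pos hc2, mul_left_comm, mul_le_mul_iff_right₀ hc2]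

/-- The variance of the square of a standard normal variable. -/
noncomputable def squareVar : ℝ := Var[fun x => x ^ 2; gaussianReal 0 1]

lemma memLp_sq_gaussianReal : MemLp (fun x : ℝ => x ^ 2) 2 (gaussianReal 0 1) := by
  have h4 : MemLp (id : ℝ → ℝ) ((4 : NNReal) : ℝ≥0∞) (gaussianReal 0 1) := memLp_id_gaussianReal 4
  have : MemLp (fun x : ℝ => id x * id x) 2 (gaussianReal 0 1) := by
    refine MemLp.mul (p := 4) (q := 4) (by simpa using h4) (by simpa using h4) (hpqr := ⟨?_⟩)
    rw [← two_mul, show (4 : ℝ≥0∞) = 2 * 2 by norm_num, ENNReal.mul_inv (by simp) (by simp),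
      ← mul_assoc, ENNReal.mul_inv_cancel (by simp) (by simp), one_mul]
  simpa [sq] using this

lemma integral_sq_gaussianReal : ∫ x, x ^ 2 ∂(gaussianReal 0 1) = 1 := by
  have h := variance_eq_sub (memLp_id_gaussianReal (μ := 0) (v := 1) 2)
  rw [variance_id_gaussianReal] at h
  simp at h
  exact h.symm

/-- Chebyshev's inequality for a sum of independent squares of mean 1 and variance `squareVar`. -/
lemma stdGaussian_restr_deviation (i : Fin (numBlocks d)) {δ : ℝ} (hδ : 0 < δ)
    (hn : 0 < Fintype.card (Block d i)) :
    stdGaussian (E d) {g | δ * Fintype.card (Block d i) ≤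
      |‖restr i g‖ ^ 2 - Fintype.card (Block d i)|} ≤
      ENNReal.ofReal (squareVar / (δ ^ 2 * Fintype.card (Block d i))) := by
  set n := Fintype.card (Block d i) with hnn
  set P := Measure.pi fun _ : Fin d => gaussianReal 0 1 with hP
  set S := Finset.univ.filter fun j : Fin d => (j : ℕ) % numBlocks d = i with hS
  have hcard : S.card = n := (card_block i).symm
  have hmp : ∀ j, MeasurePreserving (Function.eval j) P (gaussianReal 0 1) :=
    fun j => measurePreserving_eval _ j
  have hL : ∀ j, MemLp (fun g : Fin d → ℝ => g j ^ 2) 2 P := fun j =>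
    memLp_sq_gaussianReal.comp_measurePreserving (hmp j)
  have hind : iIndepFun (fun (j : Fin d) (g : Fin d → ℝ) => g j ^ 2) P :=
    iIndepFun_pi (X := fun _ (x : ℝ) => x ^ 2) fun j => by fun_prop
  have hvarj : ∀ j, Var[fun g : Fin d → ℝ => g j ^ 2; P] = squareVar := by
    intro j
    rw [squareVar, ← (hmp j).map_eq, variance_map (by fun_prop)
      (hmp j).measurable.aemeasurable]
    rfl
  have hvar : Var[∑ j ∈ S, fun g : Fin d → ℝ => g j ^ 2; P] = n * squareVar := by
    rw [IndepFun.variance_sum (fun j _ => hL j) (fun j _ k _ hjk => hind.indepFun hjk)]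
    simp [hvarj, hcard]
  have hmean : ∫ g, (∑ j ∈ S, fun g : Fin d → ℝ => g j ^ 2) g ∂P = n := by
    simp only [Finset.sum_apply]
    rw [integral_finsetSum _ fun j _ => (hL j).integrable (by norm_num)]
    have : ∀ j, ∫ g, (g j) ^ 2 ∂P = 1 := by
      intro j
      rw [← integral_sq_gaussianReal, ← (hmp j).map_eq, integral_map
        (hmp j).measurable.aemeasurable (by apply Continuous.aestronglyMeasurable; fun_prop)]
      try rfl
    simp [this, hcard]
  have hcheb := meas_ge_le_variance_div_sq (μ := P) (X := ∑ j ∈ S, fun g : Fin d → ℝ => g j ^ 2)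
    (memLp_finsetSum' _ fun j _ => hL j) (c := δ * n) (by positivity)
  rw [hvar, hmean] at hcheb
  rw [← map_pi_eq_stdGaussian, Measure.map_apply (by fun_prop)]
  · refine le_trans (le_of_eq ?_) (hcheb.trans (le_of_eq ?_))
    · congr 1
      ext g
      simp [norm_restr_sq, hS]
    · congr 1
      have : (n : ℝ) ≠ 0 := by positivity
      field_simp
  · refine measurableSet_le measurable_const ?_
    have := (continuous_restr (d := d) i).measurable
    have h2 : Measurable fun x : E d => ‖restr i x‖ ^ 2 - (n : ℝ) := by fun_prop
    exact continuous_abs.measurable.comp h2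

/-- Three relative errors of δ/4 add up to less than δ: the deviation in the block, that of the
total squared length, and that of the block size from d/m, which is less than one coordinate. -/
lemma balanced_of_deviation {δ : ℝ} (hδ : 0 < δ) (hδ' : δ ≤ 1 / 100) (hd : 0 < d)
    (hm : numBlocks d ≤ δ / 4 * d) {g : E d}
    (h : ∀ i : Fin (numBlocks d), |‖restr i g‖ ^ 2 - Fintype.card (Block d i)| <
      δ / 4 * Fintype.card (Block d i)) : Balanced δ g := by
  intro i
  have hsum : |‖g‖ ^ 2 - d| ≤ δ / 4 * d := by
    have h1 : (d : ℝ) = ∑ i : Fin (numBlocks d), (Fintype.card (Block d i) : ℝ) := by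
      exact_mod_cast (sum_card_block d).symm
    rw [← sum_norm_restr_sq, h1, ← Finset.sum_sub_distrib, Finset.mul_sum]
    exact (Finset.abs_sum_le_sum_abs _ _).trans (Finset.sum_le_sum fun i _ => (h i).le)
  obtain ⟨c1, c2⟩ := card_block_bounds i
  have hi := h i
  have hmod := Nat.div_add_mod d (numBlocks d)
  have hmod' := Nat.mod_lt d (numBlocks_pos (d := d))
  generalize Fintype.card (Block d i) = n at *
  generalize hX : ‖restr i g‖ ^ 2 = X at *
  generalize ‖g‖ ^ 2 = Y at *
  clear h hX
  have hmpos0 : 0 < numBlocks d := numBlocks_pos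
  generalize numBlocks d = m at *
  have hmpos : (0 : ℝ) < m := by exact_mod_cast hmpos0
  have hdr : (0 : ℝ) < d := by exact_mod_cast hd
  have e1 : (m : ℝ) * n ≤ d + m := by
    have : m * n ≤ d + m := by
      calc m * n ≤ m * (d / m + 1) := Nat.mul_le_mul_left _ c2
        _ ≤ _ := by rw [mul_add, mul_one]; exact Nat.add_le_add_right (Nat.mul_div_le d m) _
    exact_mod_cast this
  have e2 : (d : ℝ) ≤ m * n + m := by
    have : d ≤ m * n + m := by
      calc d ≤ m * (d / m) + m := by
            omega
        _ ≤ _ := Nat.add_le_add_right (Nat.mul_le_mul_left _ c1) _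
    exact_mod_cast this
  rw [abs_lt] at hi
  rw [abs_le] at hsum ⊢
  have f1 : m * X ≤ m * n * (1 + δ / 4) := by nlinarith
  have f2 : m * n * (1 - δ / 4) ≤ m * X := by nlinarith
  have f3 : m * X ≤ d * (1 + δ / 4) * (1 + δ / 4) := by nlinarith
  have f4 : d * (1 - δ / 4) * (1 - δ / 4) ≤ m * X := by
    have : d * (1 - δ / 4) ≤ m * n := by linarith
    nlinarith
  have f5 : d * (1 - δ / 4) ≤ Y := by linarith
  have f6 : Y ≤ d * (1 + δ / 4) := by linarith
  have f7 : (1 - δ) * Y ≤ (1 - δ) * (d * (1 + δ / 4)) :=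
    mul_le_mul_of_nonneg_left f6 (by linarith)
  have f8 : (1 + δ) * (d * (1 - δ / 4)) ≤ (1 + δ) * Y :=
    mul_le_mul_of_nonneg_left f5 (by linarith)
  have f9 : d * (1 + δ / 4) * (1 + δ / 4) ≤ (1 + δ) * (d * (1 - δ / 4)) := by
    have : (1 + δ / 4) * (1 + δ / 4) ≤ (1 + δ) * (1 - δ / 4) := by nlinarith
    nlinarith
  have f10 : (1 - δ) * (d * (1 + δ / 4)) ≤ d * (1 - δ / 4) * (1 - δ / 4) := by
    have : (1 - δ) * (1 + δ / 4) ≤ (1 - δ / 4) * (1 - δ / 4) := by nlinarith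
    nlinarith
  constructor <;> linarith

/-- What is required of the accuracy `δ` to which the blocks are balanced. -/
structure Accuracy (d : ℕ) (δ : ℝ) : Prop where
  pos : 0 < δ
  le : δ ≤ 1 / 100
  numBlocks_le : numBlocks d ≤ δ / 4 * d
  le_card : ∀ i : Fin (numBlocks d), 8 ≤ Fintype.card (Block d i) * δ ^ 2
  var_le : ∀ i : Fin (numBlocks d),
    96 * numBlocks d * squareVar ≤ δ ^ 2 * Fintype.card (Block d i)

/-- The rotated unit vector is distributed like the direction of a Gaussian, and balance ignores
scaling. The bound is 1/6 because three vectors have to be balanced together with probability 1/2;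
the 96 in `Accuracy` is 16 · 6, with 16 from the square of δ/4 and 6 from this bound, shared among
the blocks. -/
lemma not_balanced_le {δ : ℝ} (hδ : Accuracy d δ) (hd : 0 < d) {x : E d} (hx : x ≠ 0) :
    (Measure.pi fun _ : Fin d => stdGaussian (E d)) {ω | ¬ Balanced δ (rotated ω x)} ≤
      ENNReal.ofReal (1 / 6) := by
  have : Nonempty (Fin d) := ⟨⟨0, hd⟩⟩
  have hnx : ‖x‖ ≠ 0 := by simpa using hx
  set e := ‖x‖⁻¹ • x with he
  have he1 : ‖e‖ = 1 := by
    rw [he, norm_smul, norm_inv, norm_norm, inv_mul_cancel₀ hnx]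
  have h1 : {ω : Fin d → E d | ¬ Balanced δ (rotated ω x)} =
      (fun ω => rotated ω e) ⁻¹' {y | ¬ Balanced δ y} := by
    ext ω
    have : Balanced δ (rotated ω e) ↔ Balanced δ (rotated ω x) := by
      rw [he, rotated_smul, balanced_smul (inv_ne_zero hnx)]
    simp [this]
  have hm : MeasurableSet {y : E d | ¬ Balanced δ y} := (measurableSet_balanced (d := d) δ).compl
  rw [h1, ← Measure.map_apply (measurable_rotated e) hm, map_rotated he1,
    ← map_direction_stdGaussian, Measure.map_apply measurable_direction hm]
  have hcard : ∀ i : Fin (numBlocks d), 0 < Fintype.card (Block d i) := by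
    intro i
    by_contra h
    have h8 := hδ.le_card i
    rw [Nat.eq_zero_of_not_pos h] at h8
    norm_num at h8
  have h2 : direction ⁻¹' {y : E d | ¬ Balanced δ y} ⊆ {g : E d | ¬ g ≠ 0} ∪
      ⋃ i : Fin (numBlocks d), {g | δ / 4 * Fintype.card (Block d i) ≤
      |‖restr i g‖ ^ 2 - Fintype.card (Block d i)|} := by
    intro g hg
    by_contra hc
    simp only [Set.mem_union, Set.mem_ofPred_eq, not_not, Set.mem_iUnion, not_or, not_exists,
      not_le] at hc
    refine hg ?_
    have := balanced_of_deviation hδ.pos hδ.le hd hδ.numBlocks_le hc.2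
    exact (balanced_smul (inv_ne_zero (by simpa using hc.1))).2 this
  refine (measure_mono h2).trans ((measure_union_le _ _).trans ?_)
  rw [show stdGaussian (E d) {g : E d | ¬ g ≠ 0} = 0 from ae_iff.1 stdGaussian_ae_ne_zero, zero_add]
  refine (measure_iUnion_fintype_le _ _).trans ?_
  have hmpos : (0 : ℝ) < numBlocks d := by exact_mod_cast numBlocks_pos
  have h3 : ∀ i : Fin (numBlocks d), stdGaussian (E d) {g | δ / 4 * Fintype.card (Block d i) ≤
      |‖restr i g‖ ^ 2 - Fintype.card (Block d i)|} ≤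
      ENNReal.ofReal (1 / (6 * numBlocks d)) := by
    intro i
    refine (stdGaussian_restr_deviation i (div_pos hδ.pos (by norm_num)) (hcard i)).trans ?_
    refine ENNReal.ofReal_le_ofReal ?_
    have hv := hδ.var_le i
    have hc : (0 : ℝ) < Fintype.card (Block d i) := by exact_mod_cast hcard i
    have := hδ.pos
    rw [div_le_div_iff₀ (by positivity) (by positivity)]
    linarith
  refine (Finset.sum_le_sum fun i _ => h3 i).trans ?_
  rw [Finset.sum_const, Finset.card_univ, Fintype.card_fin, nsmul_eq_mul, ← ENNReal.ofReal_natCast,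
    ← ENNReal.ofReal_mul (by positivity)]
  refine ENNReal.ofReal_le_ofReal (le_of_eq ?_)
  field_simp

end blocks

end Sieve

namespace Sieve

/-! ## Measurability of the filters -/

section measurability

variable {d : ℕ}

lemma measurable_codePart (i : Fin (numBlocks d)) (b : Fin (blockSize d)) :
    Measurable fun ω : RoundCoins d => codePart ω i b := by
  have h1 : Measurable fun ω : RoundCoins d => blockWord i (ω.2 i b) := by
    have : Measurable fun g : E d => blockWord i g := by
      refine measurable_direction.comp ((WithLp.measurable_toLp 2 _).comp
        (measurable_pi_lambda _ fun j => ?_))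
      split_ifs <;> fun_prop
    exact this.comp (by fun_prop)
  have h2 : ∀ j : Fin d, Measurable fun ω : RoundCoins d =>
      (blockWord i (ω.2 i b)) j • InnerProductSpace.gramSchmidtNormed ℝ ω.1 j := by
    intro j
    have h3 : Measurable fun x : E d => x j := by fun_prop
    exact (h3.comp h1).smul ((measurable_gramSchmidtNormed j).comp measurable_fst)
  have h4 : Measurable fun ω : RoundCoins d =>
      ∑ j : Fin d, (blockWord i (ω.2 i b)) j • InnerProductSpace.gramSchmidtNormed ℝ ω.1 j :=
    Finset.measurable_sum _ fun j _ => h2 j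
  exact (measurable_const (a := (Real.sqrt (numBlocks d))⁻¹)).smul h4

lemma measurable_partValue (i : Fin (numBlocks d)) (b : Fin (blockSize d)) :
    Measurable fun p : RoundCoins d × E d => partValue p.1 p.2 i b :=
  (measurable_direction.comp measurable_snd).inner
    ((measurable_codePart i b).comp measurable_fst)

lemma measurableSet_accepting (a : Address d) :
    MeasurableSet {p : RoundCoins d × E d | a ∈ accepting p.1 p.2} := by
  have : {p : RoundCoins d × E d | a ∈ accepting p.1 p.2} =
      ⋃ β : Fin (numBlocks d) → Fin (blockSize d), {p | a = List.ofFn β} ∩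
        {p : RoundCoins d × E d | 1 / 2 ≤ ∑ i, partValue p.1 p.2 i (β i)} := by
    ext p
    simp only [Set.mem_ofPred_eq, mem_accepting, Set.mem_iUnion, Set.mem_inter_iff]
  rw [this]
  refine MeasurableSet.iUnion fun β => (MeasurableSet.const _).inter
    (measurableSet_le measurable_const (Finset.measurable_sum _ fun i _ =>
      measurable_partValue i (β i)))

lemma measurableSet_collide :
    MeasurableSet {p : RoundCoins d × (E d × E d) | Collide p.1 p.2.1 p.2.2} := by
  have : {p : RoundCoins d × (E d × E d) | Collide p.1 p.2.1 p.2.2} =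
      ⋃ a ∈ addresses d, ({p | a ∈ accepting p.1 p.2.1} ∩ {p | a ∈ accepting p.1 p.2.2}) := by
    ext p
    simp only [Set.mem_ofPred_eq, Collide, Set.mem_iUnion, Set.mem_inter_iff, exists_prop]
    exact ⟨fun ⟨a, h1, h2⟩ => ⟨a, mem_addresses_of_mem_accepting h1, h1, h2⟩,
      fun ⟨a, _, h1, h2⟩ => ⟨a, h1, h2⟩⟩
  rw [this]
  refine Finset.measurableSet_biUnion _ fun a _ => ?_
  have h1 : Measurable fun p : RoundCoins d × (E d × E d) => (p.1, p.2.1) :=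
    measurable_fst.prodMk (measurable_fst.comp measurable_snd)
  have h2 : Measurable fun p : RoundCoins d × (E d × E d) => (p.1, p.2.2) :=
    measurable_fst.prodMk (measurable_snd.comp measurable_snd)
  exact MeasurableSet.inter (h1 (measurableSet_accepting a)) (h2 (measurableSet_accepting a))

end measurability

/-! ## The chance that a close pair is found in one round -/

section success

variable {d : ℕ}

/-- Bernoulli's inequality 1 + Mp ≤ (1 + p)^M, combined with (1 - p)(1 + p) ≤ 1. -/
lemma one_sub_pow_le {p : ℝ} (h0 : 0 ≤ p) (h1 : p ≤ 1) (M : ℕ) :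
    (1 - p) ^ M * (1 + M * p) ≤ 1 := by
  calc (1 - p) ^ M * (1 + M * p) ≤ (1 - p) ^ M * (1 + p) ^ M := by
        have := one_add_mul_le_pow (show (-2 : ℝ) ≤ p by linarith) M
        have := pow_nonneg (sub_nonneg.2 h1) M
        gcongr
    _ = (1 - p ^ 2) ^ M := by rw [← mul_pow]; ring
    _ ≤ 1 := pow_le_one₀ (by nlinarith) (by nlinarith)

/-- For M independent trials, 1 - (1 - p)^M ≥ Mp/(1 + Mp) ≥ Mp/3 because Mp ≤ 2. -/
lemma le_pi_exists_mem {X : Type*} [MeasurableSpace X] (μ : Measure X) [IsProbabilityMeasure μ]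
    {W : Set X} (hW : MeasurableSet W) {M : ℕ} {p : ℝ} (hp : 0 ≤ p) (hMp : M * p ≤ 2)
    (h : ENNReal.ofReal p ≤ μ W) :
    ENNReal.ofReal (M * p / 3) ≤ (Measure.pi fun _ : Fin M => μ) {g | ∃ b, g b ∈ W} := by
  have h1 : {g : Fin M → X | ∃ b, g b ∈ W} = (Set.univ.pi fun _ => Wᶜ)ᶜ := by
    ext g; simp
  rw [h1, prob_compl_eq_one_sub (MeasurableSet.univ_pi fun _ => hW.compl), Measure.pi_pi,
    Finset.prod_const, Finset.card_univ, Fintype.card_fin, prob_compl_eq_one_sub hW]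
  set q := (μ W).toReal with hq
  have hq1 : q ≤ 1 := ENNReal.toReal_le_of_le_ofReal zero_le_one (by simpa using prob_le_one)
  have hq0 : 0 ≤ q := ENNReal.toReal_nonneg
  have hpq : p ≤ q := by
    rwa [hq, ← ENNReal.ofReal_le_iff_le_toReal (measure_ne_top _ _)]
  have hWq : μ W = ENNReal.ofReal q := (ENNReal.ofReal_toReal (measure_ne_top _ _)).symm
  rw [hWq, ← ENNReal.ofReal_one, ← ENNReal.ofReal_sub _ hq0,
    ← ENNReal.ofReal_pow (sub_nonneg.2 hq1), ← ENNReal.ofReal_sub _ (by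
      exact pow_nonneg (sub_nonneg.2 hq1) _)]
  refine ENNReal.ofReal_le_ofReal ?_
  have h2 := one_sub_pow_le hq0 hq1 M
  have h3 : (1 - q) ^ M ≤ (1 - p) ^ M := pow_le_pow_left₀ (sub_nonneg.2 hq1) (by linarith) _
  have h4 := one_sub_pow_le hp (hpq.trans hq1) M
  have h5 : 0 ≤ (1 - p) ^ M := pow_nonneg (by linarith) _
  have hMp0 : 0 ≤ M * p := by positivity
  nlinarith

/-- The word `g` makes block `i` contribute its share to the acceptance of `x` and `y`. -/
def goodWord (ω : Fin d → E d) (x y : E d) (i : Fin (numBlocks d)) : Set (E d) :=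
  {g | 1 / 2 ≤ inner ℝ (direction (restr i g))
      (Real.sqrt (numBlocks d) • restr i (rotated ω x)) ∧
    1 / 2 ≤ inner ℝ (direction (restr i g)) (Real.sqrt (numBlocks d) • restr i (rotated ω y))}

/-- A good word contributes at least 1/(2m) to the inner product with either vector. The choices in
the m blocks are free, and together they address one filter that accepts both. -/
lemma collide_of_goodWord {ω : RoundCoins d} {x y : E d} (hx : ‖x‖ = 1) (hy : ‖y‖ = 1)
    (h : ∀ i, ∃ b, ω.2 i b ∈ goodWord ω.1 x y i) : Collide ω x y := by
  choose β hβ using h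
  have hm : (0 : ℝ) < numBlocks d := by exact_mod_cast numBlocks_pos
  have key : ∀ z : E d, ‖z‖ = 1 → (∀ i, 1 / 2 ≤ inner ℝ (direction (restr i (ω.2 i (β i))))
      (Real.sqrt (numBlocks d) • restr i (rotated ω.1 z))) →
      List.ofFn β ∈ accepting ω z := by
    intro z hz h
    refine (mem_accepting ω z _).2 ⟨β, rfl, ?_⟩
    have : ∀ i, 1 / (2 * (numBlocks d : ℝ)) ≤ partValue ω z i (β i) := by
      intro i
      rw [partValue_eq ω hz]
      have h1 := h i
      rw [real_inner_smul_right] at h1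
      set s := Real.sqrt (numBlocks d) with hs
      have hs0 : 0 < s := Real.sqrt_pos.2 hm
      have hss : s * s = numBlocks d := Real.mul_self_sqrt hm.le
      rw [← hss, ← div_eq_inv_mul, div_le_div_iff₀ (by positivity) hs0]
      nlinarith
    calc (1 / 2 : ℝ) = ∑ _i : Fin (numBlocks d), 1 / (2 * (numBlocks d : ℝ)) := by
          rw [Finset.sum_const, Finset.card_univ, Fintype.card_fin, nsmul_eq_mul]
          field_simp
      _ ≤ _ := Finset.sum_le_sum fun i _ => this i
  exact ⟨List.ofFn β, key x hx fun i => (hβ i).1, key y hy fun i => (hβ i).2⟩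

lemma measurableSet_goodWord (x y : E d) (i : Fin (numBlocks d)) :
    MeasurableSet {p : (Fin d → E d) × E d | p.2 ∈ goodWord p.1 x y i} := by
  have hr := (continuous_restr (d := d) i).measurable
  have key : ∀ z : E d, MeasurableSet {p : (Fin d → E d) × E d |
      1 / 2 ≤ inner ℝ (direction (restr i p.2))
      (Real.sqrt (numBlocks d) • restr i (rotated p.1 z))} := by
    intro z
    have h1 : Measurable fun p : (Fin d → E d) × E d => direction (restr i p.2) :=
      measurable_direction.comp (hr.comp measurable_snd)
    have h2 : Measurable fun p : (Fin d → E d) × E d => restr i (rotated p.1 z) :=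
      hr.comp ((measurable_rotated z).comp measurable_fst)
    have h3 : Measurable fun p : (Fin d → E d) × E d =>
      Real.sqrt (numBlocks d) • restr i (rotated p.1 z) :=
      (measurable_const (a := Real.sqrt (numBlocks d))).smul h2
    exact measurableSet_le measurable_const (h1.inner h3)
  exact (key x).inter (key y)

/-- The lower bound for the norms of the vectors in the wedge. -/
noncomputable def wedgeRadius (δ : ℝ) : ℝ := Real.sqrt (2 / 3 - 6 * δ)

/-- The wedge estimate inside one block, for the block parts scaled by √m. Balance of `x` and `y`
makes these nearly unit vectors. Balance of `x + y` carries the angle over to the block: ‖x + y‖² ≥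
3 becomes ‖a + b‖² ≥ 3(1 - δ). -/
lemma le_stdGaussian_goodWord {δ : ℝ} (hδ : Accuracy d δ) {x y : E d} (hx : ‖x‖ = 1)
    (hy : ‖y‖ = 1) (hxy : 1 / 2 ≤ inner ℝ x y) {ω : Fin d → E d}
    (hω : ∀ z, ‖rotated ω z‖ = ‖z‖) (hbx : Balanced δ (rotated ω x))
    (hby : Balanced δ (rotated ω y)) (hbxy : Balanced δ (rotated ω (x + y)))
    (i : Fin (numBlocks d)) :
    ENNReal.ofReal (wedgeRadius δ ^ Fintype.card (Block d i) / 2) ≤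
      stdGaussian (E d) (goodWord ω x y i) := by
  have hcard : 0 < Fintype.card (Block d i) := by
    by_contra h
    have h8 := hδ.le_card i
    rw [Nat.eq_zero_of_not_pos h] at h8
    norm_num at h8
  have : Nonempty (Block d i) := Fintype.card_pos_iff.1 hcard
  set s := Real.sqrt (numBlocks d) with hs
  have hss : s ^ 2 = numBlocks d := Real.sq_sqrt (by positivity)
  have hns : ∀ z : E d, ‖s • restr i (rotated ω z)‖ ^ 2 =
      numBlocks d * ‖restr i (rotated ω z)‖ ^ 2 := by
    intro z
    rw [norm_smul, mul_pow, Real.norm_eq_abs, sq_abs, hss]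
  have hpos := hδ.pos
  have hle := hδ.le
  have h1 := le_sphereUniform_wedge (V := EuclideanSpace ℝ (Block d i)) hδ.pos hδ.le
    (by rw [finrank_euclideanSpace]; exact hδ.le_card i)
    (a := s • restr i (rotated ω x)) (b := s • restr i (rotated ω y))
    (by rw [hns]; simpa [hω, hx] using hbx i) (by rw [hns]; simpa [hω, hy] using hby i)
    (by
      rw [← smul_add, ← map_add, ← rotated_add, hns]
      have h2 := hbxy i
      have h3 : (3 : ℝ) ≤ ‖rotated ω (x + y)‖ ^ 2 := by
        rw [hω, @norm_add_sq_real, hx, hy]; linarith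
      rw [abs_le] at h2
      nlinarith [h2.1])
  rw [finrank_euclideanSpace] at h1
  have hmeas := measurableSet_wedge (s • restr i (rotated ω x)) (s • restr i (rotated ω y))
  have hr := (continuous_restr (d := d) i).measurable
  rw [← map_direction_stdGaussian, Measure.map_apply measurable_direction hmeas,
    ← map_restr_stdGaussian, Measure.map_apply hr (measurable_direction hmeas)] at h1
  have h4 : (restr i) ⁻¹' (direction ⁻¹' {v : EuclideanSpace ℝ (Block d i) |
      1 / 2 ≤ inner ℝ v (s • restr i (rotated ω x)) ∧
      1 / 2 ≤ inner ℝ v (s • restr i (rotated ω y))}) = goodWord ω x y i := rfl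
  rw [h4] at h1
  rw [ENNReal.ofReal_div_of_pos (by norm_num), ENNReal.div_le_iff_le_mul (by simp) (by simp),
    mul_comm]
  simpa [wedgeRadius] using h1

lemma ae_norm_rotated : ∀ᵐ ω ∂(Measure.pi fun _ : Fin d => stdGaussian (E d)),
    ∀ z, ‖rotated ω z‖ = ‖z‖ := by
  have : ∀ᵐ ω ∂(Measure.pi fun _ : Fin d => stdGaussian (E d)),
      ∀ n, InnerProductSpace.gramSchmidt ℝ ω n ≠ 0 := ae_all_iff.2 ae_gramSchmidt_ne_zero
  filter_upwards [this] with ω hω z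
  have hon : Orthonormal ℝ (InnerProductSpace.gramSchmidtNormed ℝ ω) := by
    refine ⟨fun n => InnerProductSpace.gramSchmidtNormed_unit_length' ?_, fun i j hij => ?_⟩
    · rw [InnerProductSpace.gramSchmidtNormed]
      refine smul_ne_zero ?_ (hω n)
      simpa using hω n
    · simp [InnerProductSpace.gramSchmidtNormed, real_inner_smul_left, real_inner_smul_right,
        InnerProductSpace.gramSchmidt_orthogonal ℝ ω hij]
  have hspan := hon.linearIndependent.span_eq_top_of_card_eq_finrank' (by simp)
  have h1 := (OrthonormalBasis.mk hon hspan.ge).sum_sq_inner_right z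
  rw [OrthonormalBasis.coe_mk] at h1
  rw [← pow_left_inj₀ (norm_nonneg _) (norm_nonneg _) two_ne_zero,
    EuclideanSpace.real_norm_sq_eq, ← h1]
  rfl

/-- Supplies the hypothesis Mp ≤ 2 of `le_pi_exists_mem`. The base is 4/3 · 2/3 < 1; the factor 2
and the added 1 in the proof come from rounding the block length and the number of words. -/
lemma blockSize_mul_wedgeRadius_pow_le {δ : ℝ} (hδ : 0 ≤ δ) (i : Fin (numBlocks d)) :
    blockSize d * (wedgeRadius δ ^ Fintype.card (Block d i) / 2) ≤ 2 := by
  obtain ⟨c1, -⟩ := card_block_bounds i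
  have hm := numBlocks_pos (d := d)
  have hmod := Nat.div_add_mod d (numBlocks d)
  have hmod' := Nat.mod_lt d hm
  have hM : (blockSize d : ℝ) ≤ (4 / 3 : ℝ) ^ ((d : ℝ) / (2 * numBlocks d)) + 1 :=
    (Nat.ceil_lt_add_one (by positivity)).le
  generalize Fintype.card (Block d i) = n at *
  generalize numBlocks d = m at *
  have hdm : d ≤ m * (n + 1) := by
    have : m * (d / m) ≤ m * n := by gcongr
    rw [mul_add, mul_one]; omega
  have hexp : (d : ℝ) / (2 * m) ≤ (n + 1) / 2 := by
    have hm' : (0 : ℝ) < m := by exact_mod_cast hm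
    rw [div_le_div_iff₀ (by positivity) (by norm_num)]
    have : (d : ℝ) ≤ m * (n + 1) := by exact_mod_cast hdm
    nlinarith
  have h1 : (4 / 3 : ℝ) ^ ((d : ℝ) / (2 * m)) ≤ 2 * (Real.sqrt (4 / 3)) ^ n := by
    calc (4 / 3 : ℝ) ^ ((d : ℝ) / (2 * m)) ≤ (4 / 3 : ℝ) ^ (((n : ℝ) + 1) / 2) :=
          Real.rpow_le_rpow_of_exponent_le (by norm_num) hexp
      _ = Real.sqrt (4 / 3) ^ (n + 1) := by
          rw [Real.sqrt_eq_rpow, ← Real.rpow_natCast, ← Real.rpow_mul (by norm_num)]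
          congr 1; push_cast; ring
      _ ≤ 2 * (Real.sqrt (4 / 3)) ^ n := by
          rw [pow_succ, mul_comm]
          gcongr
          rw [Real.sqrt_le_left (by norm_num)]; norm_num
  have hw0 : 0 ≤ wedgeRadius δ := Real.sqrt_nonneg _
  have hw1 : wedgeRadius δ ≤ Real.sqrt (2 / 3) := Real.sqrt_le_sqrt (by linarith)
  have hw2 : Real.sqrt (4 / 3) * wedgeRadius δ ≤ 1 := by
    calc Real.sqrt (4 / 3) * wedgeRadius δ ≤ Real.sqrt (4 / 3) * Real.sqrt (2 / 3) := by gcongr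
      _ = Real.sqrt (4 / 3 * (2 / 3)) := (Real.sqrt_mul (by norm_num) _).symm
      _ ≤ 1 := Real.sqrt_le_one.2 (by norm_num)
  have hw3 : wedgeRadius δ ≤ 1 := hw1.trans (Real.sqrt_le_one.2 (by norm_num))
  have h2 : Real.sqrt (4 / 3) ^ n * wedgeRadius δ ^ n ≤ 1 := by
    rw [← mul_pow]; exact pow_le_one₀ (by positivity) hw2
  have h3 : wedgeRadius δ ^ n ≤ 1 := pow_le_one₀ hw0 hw3
  have h4 : (0 : ℝ) ≤ wedgeRadius δ ^ n := by positivity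
  nlinarith

/-- The rotation moves `x`, `y` and `x + y` to vectors whose weight is spread evenly over the
blocks. -/
def balancedRotations (δ : ℝ) (x y : E d) : Set (Fin d → E d) :=
  {ω | Balanced δ (rotated ω x) ∧ Balanced δ (rotated ω y) ∧ Balanced δ (rotated ω (x + y))}

lemma measurableSet_balancedRotations (δ : ℝ) (x y : E d) :
    MeasurableSet (balancedRotations δ x y) := by
  have h1 := (measurable_rotated x) (measurableSet_balanced δ)
  have h2 := (measurable_rotated y) (measurableSet_balanced δ)
  have h3 := (measurable_rotated (x + y)) (measurableSet_balanced δ)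
  exact h1.inter (h2.inter h3)

lemma le_measure_balancedRotations {δ : ℝ} (hδ : Accuracy d δ) (hd : 0 < d) {x y : E d}
    (hx : ‖x‖ = 1) (hy : ‖y‖ = 1) (hxy : 1 / 2 ≤ inner ℝ x y) :
    ENNReal.ofReal (1 / 2) ≤
      (Measure.pi fun _ : Fin d => stdGaussian (E d)) (balancedRotations δ x y) := by
  have h1 : (Measure.pi fun _ : Fin d => stdGaussian (E d)) (balancedRotations δ x y)ᶜ ≤
      ENNReal.ofReal (1 / 2) := by
    have hsub : (balancedRotations δ x y)ᶜ ⊆ {ω | ¬ Balanced δ (rotated ω x)} ∪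
        ({ω | ¬ Balanced δ (rotated ω y)} ∪ {ω | ¬ Balanced δ (rotated ω (x + y))}) := by
      intro ω hω
      by_contra hc
      simp only [Set.mem_union, Set.mem_ofPred_eq, not_or, not_not] at hc
      exact hω hc
    have hx0 : x ≠ 0 := by rintro rfl; simp at hx
    have hy0 : y ≠ 0 := by rintro rfl; simp at hy
    have hxy0 : x + y ≠ 0 := by
      intro h
      have := @norm_add_sq_real _ _ _ x y
      rw [h, hx, hy] at this
      norm_num at this
      linarith
    refine (measure_mono hsub).trans ((measure_union_le _ _).trans ((add_le_add
      (not_balanced_le hδ hd hx0) ((measure_union_le _ _).trans (add_le_add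
      (not_balanced_le hδ hd hy0) (not_balanced_le hδ hd hxy0)))).trans (le_of_eq ?_)))
    rw [← ENNReal.ofReal_add (by norm_num) (by norm_num),
      ← ENNReal.ofReal_add (by norm_num) (by norm_num)]
    norm_num
  have h2 := prob_compl_eq_one_sub (μ := Measure.pi fun _ : Fin d => stdGaussian (E d))
    (measurableSet_balancedRotations δ x y).compl
  rw [compl_compl] at h2
  rw [h2]
  refine le_trans ?_ (tsub_le_tsub_left h1 1)
  rw [← ENNReal.ofReal_one, ← ENNReal.ofReal_sub _ (by norm_num)]
  norm_num

/-- For a fixed rotation the blocks are independent, and the exponents, being the block lengths, add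
up to `d`. Each block loses 6 = 2 · 3, from the wedge estimate and from `le_pi_exists_mem`. -/
lemma le_measure_goodWords {δ : ℝ} (hδ : Accuracy d δ) {x y : E d}
    (hx : ‖x‖ = 1) (hy : ‖y‖ = 1) (hxy : 1 / 2 ≤ inner ℝ x y) {ω : Fin d → E d}
    (hω : ∀ z, ‖rotated ω z‖ = ‖z‖) (hb : ω ∈ balancedRotations δ x y) :
    ENNReal.ofReal ((blockSize d / 6) ^ numBlocks d * wedgeRadius δ ^ d) ≤
      (Measure.pi fun _ : Fin (numBlocks d) => Measure.pi fun _ : Fin (blockSize d) =>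
        stdGaussian (E d)) {w | ∀ i, ∃ b, w i b ∈ goodWord ω x y i} := by
  have hset : {w : Fin (numBlocks d) → Fin (blockSize d) → E d |
      ∀ i, ∃ b, w i b ∈ goodWord ω x y i} =
      Set.univ.pi fun i => {g : Fin (blockSize d) → E d | ∃ b, g b ∈ goodWord ω x y i} := by
    ext w
    simp only [Set.mem_ofPred_eq, Set.mem_pi, Set.mem_univ, forall_true_left]
  have hw0 : 0 ≤ wedgeRadius δ := Real.sqrt_nonneg _
  have hq' : ENNReal.ofReal ((blockSize d / 6) ^ numBlocks d * wedgeRadius δ ^ d) =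
      ∏ i : Fin (numBlocks d), ENNReal.ofReal (blockSize d *
        (wedgeRadius δ ^ Fintype.card (Block d i) / 2) / 3) := by
    rw [← ENNReal.ofReal_prod_of_nonneg fun i _ => by positivity]
    congr 1
    have : ∀ i : Fin (numBlocks d), (blockSize d : ℝ) *
      (wedgeRadius δ ^ Fintype.card (Block d i) / 2) / 3 =
      (blockSize d / 6) * wedgeRadius δ ^ Fintype.card (Block d i) := fun i => by ring
    simp_rw [this]
    rw [Finset.prod_mul_distrib, Finset.prod_const, Finset.card_univ, Fintype.card_fin,
      Finset.prod_pow_eq_pow_sum, sum_card_block]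
  rw [hset, Measure.pi_pi, hq']
  refine Finset.prod_le_prod' fun i _ => ?_
  refine le_pi_exists_mem _ ?_ (by positivity)
    (blockSize_mul_wedgeRadius_pow_le hδ.pos.le i)
    (le_stdGaussian_goodWord hδ hx hy hxy hω hb.1 hb.2.1 hb.2.2 i)
  exact measurable_prodMk_left (measurableSet_goodWord x y i)

lemma measurableSet_goodWords (x y : E d) : MeasurableSet
    {ω : RoundCoins d | ∀ i, ∃ b, ω.2 i b ∈ goodWord ω.1 x y i} := by
  have : {ω : RoundCoins d | ∀ i, ∃ b, ω.2 i b ∈ goodWord ω.1 x y i} =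
      ⋂ i, ⋃ b, (fun ω : RoundCoins d => (ω.1, ω.2 i b)) ⁻¹'
        {p : (Fin d → E d) × E d | p.2 ∈ goodWord p.1 x y i} := by
    ext ω
    simp only [Set.mem_ofPred_eq, Set.mem_iInter, Set.mem_iUnion, Set.mem_preimage]
  rw [this]
  refine MeasurableSet.iInter fun i => MeasurableSet.iUnion fun b => ?_
  have h1 : Measurable fun ω : RoundCoins d => ω.2 i b :=
    (measurable_pi_apply b).comp ((measurable_pi_apply i).comp measurable_snd)
  exact (measurable_fst.prodMk h1) (measurableSet_goodWord x y i)

lemma mul_measure_le_prod {X Y : Type*} [MeasurableSpace X] [MeasurableSpace Y] (P : Measure X)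
    (Q : Measure Y) [SFinite Q] {G : Set X} (hG : MeasurableSet G) {A : Set (X × Y)}
    (hA : MeasurableSet A) (q : ℝ≥0∞) (h : ∀ᵐ x ∂P, x ∈ G → q ≤ Q (Prod.mk x ⁻¹' A)) :
    q * P G ≤ P.prod Q A := by
  rw [Measure.prod_apply hA]
  calc q * P G = ∫⁻ x, G.indicator (fun _ => q) x ∂P := by
        rw [lintegral_indicator hG, lintegral_const, Measure.restrict_apply_univ]
    _ ≤ _ := by
        refine lintegral_mono_ae ?_
        filter_upwards [h] with x hx
        by_cases hxG : x ∈ G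
        · rw [Set.indicator_of_mem hxG]; exact hx hxG
        · rw [Set.indicator_of_notMem hxG]; exact zero_le

/-- A lower bound for the probability that two close unit vectors collide in one round. -/
lemma le_roundMeasure_collide {δ : ℝ} (hδ : Accuracy d δ) (hd : 0 < d) {x y : E d}
    (hx : ‖x‖ = 1) (hy : ‖y‖ = 1) (hxy : 1 / 2 ≤ inner ℝ x y) :
    ENNReal.ofReal ((blockSize d / 6) ^ numBlocks d * wedgeRadius δ ^ d / 2) ≤
      roundMeasure d {ω | Collide ω x y} := by
  have hw0 : 0 ≤ wedgeRadius δ := Real.sqrt_nonneg _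
  refine le_trans ?_ (measure_mono fun ω
    (hω : ω ∈ {ω : RoundCoins d | ∀ i, ∃ b, ω.2 i b ∈ goodWord ω.1 x y i}) =>
      collide_of_goodWord hx hy hω)
  have h1 := mul_measure_le_prod (Measure.pi fun _ : Fin d => stdGaussian (E d))
    (Measure.pi fun _ : Fin (numBlocks d) => Measure.pi fun _ : Fin (blockSize d) =>
        stdGaussian (E d)) (measurableSet_balancedRotations δ x y) (measurableSet_goodWords x y)
    (ENNReal.ofReal ((blockSize d / 6) ^ numBlocks d * wedgeRadius δ ^ d)) (by
      filter_upwards [ae_norm_rotated] with ω hω hb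
      exact le_measure_goodWords hδ hx hy hxy hω hb)
  refine le_trans ?_ h1
  rw [div_eq_mul_one_div, ENNReal.ofReal_mul (by positivity)]
  exact mul_le_mul_right (le_measure_balancedRotations hδ hd hx hy hxy) _

end success

end Sieve

namespace Sieve

/-! ## All rounds together -/

section growth

lemma eventually_mul_rpow_le (C : ℝ) {a b : ℝ} (h : a < b) :
    ∀ᶠ d : ℕ in atTop, C * (d : ℝ) ^ a ≤ (d : ℝ) ^ b := by
  have h1 : ∀ᶠ x : ℝ in atTop, C ≤ x ^ (b - a) :=
    (tendsto_rpow_atTop (sub_pos.2 h)).eventually_ge_atTop C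
  filter_upwards [tendsto_natCast_atTop_atTop.eventually h1, eventually_gt_atTop 0] with d hd h0
  have h0' : (0 : ℝ) < d := by exact_mod_cast h0
  calc C * (d : ℝ) ^ a ≤ (d : ℝ) ^ (b - a) * (d : ℝ) ^ a := by gcongr
    _ = (d : ℝ) ^ b := by rw [← Real.rpow_add h0']; congr 1; ring

lemma eventually_mul_log_le_rpow (C : ℝ) {b : ℝ} (h : 0 < b) :
    ∀ᶠ d : ℕ in atTop, C * Real.log d ≤ (d : ℝ) ^ b := by
  have h1 := (isLittleO_log_rpow_atTop h).const_mul_left C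
  have h2 := tendsto_natCast_atTop_atTop (R := ℝ) |>.eventually (h1.bound zero_lt_one)
  filter_upwards [h2] with d hd
  rw [one_mul, Real.norm_of_nonneg (by positivity : 0 ≤ (d : ℝ) ^ b)] at hd
  exact (le_abs_self _).trans hd

lemma numBlocks_le_log {d : ℕ} (hd : 3 ≤ d) : (numBlocks d : ℝ) ≤ 3 * Real.log d := by
  have h1 := Real.natLog_le_logb d 2
  have h2 : (1 : ℝ) ≤ Real.log d := by
    rw [Real.le_log_iff_exp_le (by positivity)]
    have : (3 : ℝ) ≤ d := by exact_mod_cast hd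
    linarith [Real.exp_one_lt_d9]
  have h3 : Real.logb (2 : ℕ) d ≤ 2 * Real.log d := by
    rw [Real.logb, div_le_iff₀ (by positivity)]
    push_cast
    nlinarith [Real.log_two_gt_d9]
  rw [numBlocks]
  push_cast
  linarith

lemma eventually_numBlocks_le (C : ℝ) (hC : 0 ≤ C) {b : ℝ} (h : 0 < b) :
    ∀ᶠ d : ℕ in atTop, C * numBlocks d ≤ (d : ℝ) ^ b := by
  filter_upwards [eventually_mul_log_le_rpow (C * 3) h, eventually_ge_atTop 3] with d hd h3
  refine le_trans ?_ hd
  rw [mul_assoc]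
  exact mul_le_mul_of_nonneg_left (numBlocks_le_log h3) hC

/-- The accuracy to which random rotations balance the blocks. -/
noncomputable def accuracy (d : ℕ) : ℝ := (d : ℝ) ^ (-(3 / 10) : ℝ)

/-- The exponent 3/10 meets two demands. A block has at least d^(9/10) coordinates, so δ² times its
length is at least d^(3/10) and outgrows the logarithmic number of blocks. And δd = d^(7/10) stays
below the d^(3/4) in `numRounds`. -/
lemma eventually_accuracy : ∀ᶠ d : ℕ in atTop, Accuracy d (accuracy d) := by
  filter_upwards [eventually_gt_atTop 0,
    eventually_mul_rpow_le 100 (show (0 : ℝ) < 3 / 10 by norm_num),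
    eventually_numBlocks_le 4 (by norm_num) (show (0 : ℝ) < 7 / 10 by norm_num),
    eventually_numBlocks_le 2 (by norm_num) (show (0 : ℝ) < 1 / 10 by norm_num),
    eventually_mul_rpow_le 8 (show (6 / 10 : ℝ) < 7 / 10 by norm_num),
    eventually_mul_rpow_le (96 * squareVar) (show (7 / 10 : ℝ) < 8 / 10 by norm_num),
    eventually_mul_rpow_le 1 (show (7 / 10 : ℝ) < 9 / 10 by norm_num),
    eventually_mul_rpow_le 1 (show (8 / 10 : ℝ) < 9 / 10 by norm_num),
    eventually_mul_rpow_le 1 (show (0 : ℝ) < 9 / 10 by norm_num)]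
    with d hd h1 h2 h3 h4 h5 h6 h7 h8
  have hd' : (0 : ℝ) < d := by exact_mod_cast hd
  have hcard : ∀ i : Fin (numBlocks d), (d : ℝ) ^ (9 / 10 : ℝ) ≤ Fintype.card (Block d i) := by
    intro i
    obtain ⟨c1, -⟩ := card_block_bounds i
    have hm := numBlocks_pos (d := d)
    have hmod := Nat.div_add_mod d (numBlocks d)
    have hmod' := Nat.mod_lt d hm
    generalize Fintype.card (Block d i) = n at *
    generalize numBlocks d = m at *
    have hdm : d ≤ m * (n + 1) := by
      have : m * (d / m) ≤ m * n := by gcongr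
      rw [mul_add, mul_one]; omega
    have hdm' : (d : ℝ) ≤ m * (n + 1) := by exact_mod_cast hdm
    have e1 : (d : ℝ) = (d : ℝ) ^ (1 / 10 : ℝ) * (d : ℝ) ^ (9 / 10 : ℝ) := by
      rw [← Real.rpow_add hd']; norm_num
    have e2 : 0 < (d : ℝ) ^ (1 / 10 : ℝ) := by positivity
    have e3 : 2 * (d : ℝ) ≤ (d : ℝ) ^ (1 / 10 : ℝ) * (n + 1) := by
      have : (0 : ℝ) ≤ n + 1 := by positivity
      nlinarith
    have e4 : 2 * (d : ℝ) ^ (9 / 10 : ℝ) ≤ n + 1 := by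
      refine le_of_mul_le_mul_left ?_ e2
      nlinarith
    rw [Real.rpow_zero] at h8
    linarith
  have hsq : accuracy d ^ 2 * (d : ℝ) ^ (6 / 10 : ℝ) = 1 := by
    rw [accuracy, ← Real.rpow_natCast, ← Real.rpow_mul hd'.le, ← Real.rpow_add hd']
    norm_num
  refine ⟨by unfold accuracy; positivity, ?_, ?_, fun i => ?_, fun i => ?_⟩
  · rw [Real.rpow_zero, mul_one] at h1
    rw [accuracy, Real.rpow_neg hd'.le, one_div]
    exact inv_anti₀ (by norm_num) h1
  · have : accuracy d * d = (d : ℝ) ^ (7 / 10 : ℝ) := by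
      rw [accuracy]
      nth_rewrite 2 [← Real.rpow_one (d : ℝ)]
      rw [← Real.rpow_add hd']; norm_num
    nlinarith
  · have h9 : 8 * (d : ℝ) ^ (6 / 10 : ℝ) ≤ Fintype.card (Block d i) := by
      linarith [hcard i]
    have : (0 : ℝ) ≤ accuracy d ^ 2 := by positivity
    nlinarith
  · have hV : 0 ≤ squareVar := variance_nonneg _ _
    have h9 : 96 * numBlocks d * squareVar * (d : ℝ) ^ (6 / 10 : ℝ) ≤
        Fintype.card (Block d i) := by
      have e1 : (d : ℝ) ^ (1 / 10 : ℝ) * (d : ℝ) ^ (6 / 10 : ℝ) = (d : ℝ) ^ (7 / 10 : ℝ) := by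
        rw [← Real.rpow_add hd']; norm_num
      have e2 : numBlocks d * (d : ℝ) ^ (6 / 10 : ℝ) ≤ (d : ℝ) ^ (7 / 10 : ℝ) := by
        rw [← e1]
        have : (0 : ℝ) ≤ numBlocks d := by positivity
        gcongr
        linarith
      calc _ = 96 * squareVar * (numBlocks d * (d : ℝ) ^ (6 / 10 : ℝ)) := by ring
        _ ≤ 96 * squareVar * (d : ℝ) ^ (7 / 10 : ℝ) := by gcongr
        _ ≤ _ := by linarith [hcard i]
    have h10 : (0 : ℝ) ≤ accuracy d ^ 2 := by positivity
    calc 96 * numBlocks d * squareVar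
        = accuracy d ^ 2 * (96 * numBlocks d * squareVar * (d : ℝ) ^ (6 / 10 : ℝ)) := by
          linear_combination (-(96 * numBlocks d * squareVar)) * hsq
      _ ≤ _ := mul_le_mul_of_nonneg_left h9 h10

lemma rpow_le_codeSize (d : ℕ) : (4 / 3 : ℝ) ^ ((d : ℝ) / 2) ≤
    (blockSize d : ℝ) ^ numBlocks d := by
  have hm : (numBlocks d : ℝ) ≠ 0 := by exact_mod_cast numBlocks_pos.ne'
  calc (4 / 3 : ℝ) ^ ((d : ℝ) / 2) = ((4 / 3 : ℝ) ^ ((d : ℝ) / (2 * numBlocks d))) ^ numBlocks d := by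
        rw [← Real.rpow_natCast, ← Real.rpow_mul (by norm_num)]
        congr 1; field_simp
    _ ≤ _ := by gcongr; exact Nat.le_ceil _

/-- The expected number of rounds that find a close pair is more than polynomial. -/
lemma eventually_le_numRounds_mul : ∀ᶠ d : ℕ in atTop, (d : ℝ) ^ 2 ≤ numRounds d *
    ((blockSize d / 6) ^ numBlocks d * wedgeRadius (accuracy d) ^ d / 2) := by
  filter_upwards [eventually_accuracy, eventually_gt_atTop 2,
    eventually_numBlocks_le 2 (by norm_num) (show (0 : ℝ) < 7 / 10 by norm_num),
    eventually_mul_log_le_rpow 2 (show (0 : ℝ) < 7 / 10 by norm_num),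
    eventually_mul_rpow_le 24 (show (7 / 10 : ℝ) < 3 / 4 by norm_num),
    eventually_mul_rpow_le 1 (show (0 : ℝ) < 7 / 10 by norm_num)] with d hδ hd h1 h2 h3 h4
  have hd' : (0 : ℝ) < d := by positivity
  have hδ0 := hδ.pos
  have hδ1 := hδ.le
  set δ := accuracy d with hδdef
  have hR : (9 / 8 : ℝ) ^ ((d : ℝ) / 2) * (2 : ℝ) ^ ((d : ℝ) ^ (3 / 4 : ℝ)) ≤ numRounds d :=
    Nat.le_ceil _
  have hM := rpow_le_codeSize d
  have hw : wedgeRadius δ ^ d = (2 / 3 - 6 * δ) ^ ((d : ℝ) / 2) := by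
    rw [wedgeRadius, Real.sqrt_eq_rpow, ← Real.rpow_natCast, ← Real.rpow_mul (by linarith)]
    congr 1; ring
  -- The price of imperfect balance: (1 - 9δ)^(d/2) ≥ exp(-9δd), and δd = d^(7/10).
  have hw2 : (2 / 3 : ℝ) ^ ((d : ℝ) / 2) * Real.exp (-(9 * (d : ℝ) ^ (7 / 10 : ℝ))) ≤
      wedgeRadius δ ^ d := by
    have e0 : Real.exp (-(18 * δ)) ≤ 1 - 9 * δ := by
      have := Real.add_one_le_exp (18 * δ)
      rw [Real.exp_neg, inv_le_comm₀ (Real.exp_pos _) (by linarith)]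
      refine le_trans ?_ this
      rw [inv_le_iff_one_le_mul₀ (by linarith)]
      nlinarith
    have e1 : (2 / 3 - 6 * δ) = 2 / 3 * (1 - 9 * δ) := by ring
    rw [hw, e1, Real.mul_rpow (by norm_num) (by linarith)]
    gcongr
    calc Real.exp (-(9 * (d : ℝ) ^ (7 / 10 : ℝ))) = Real.exp (-(18 * δ)) ^ ((d : ℝ) / 2) := by
          rw [← Real.exp_mul]
          congr 1
          have : δ * d = (d : ℝ) ^ (7 / 10 : ℝ) := by
            rw [hδdef, accuracy]
            nth_rewrite 2 [← Real.rpow_one (d : ℝ)]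
            rw [← Real.rpow_add hd']; norm_num
          rw [← this]; ring
      _ ≤ _ := Real.rpow_le_rpow (Real.exp_pos _).le e0 (by positivity)
  have h6 : (6 : ℝ) ^ numBlocks d ≤ Real.exp ((d : ℝ) ^ (7 / 10 : ℝ)) := by
    have e6 : (6 : ℝ) ≤ Real.exp 2 := by
      have : Real.exp 2 = Real.exp 1 * Real.exp 1 := by rw [← Real.exp_add]; norm_num
      rw [this]; nlinarith [Real.exp_one_gt_d9]
    calc (6 : ℝ) ^ numBlocks d ≤ (Real.exp 2) ^ numBlocks d := by gcongr
      _ = Real.exp (2 * numBlocks d) := by rw [← Real.exp_nat_mul]; congr 1; ring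
      _ ≤ _ := Real.exp_le_exp.2 h1
  have hd2 : (d : ℝ) ^ 2 ≤ Real.exp ((d : ℝ) ^ (7 / 10 : ℝ)) := by
    rw [← Real.exp_log (show (0 : ℝ) < (d : ℝ) ^ 2 by positivity), Real.log_pow]
    exact Real.exp_le_exp.2 (by push_cast; exact h2)
  have h2e : (2 : ℝ) ≤ Real.exp ((d : ℝ) ^ (7 / 10 : ℝ)) := by
    rw [Real.rpow_zero] at h4
    have := Real.exp_le_exp.2 h4
    linarith [Real.exp_one_gt_d9, this, Real.exp_le_exp.2 (show (1 : ℝ) ≤ 1 * 1 by norm_num)]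
  -- With X = exp(d^(7/10)), nine factors X pay for the balance, one for 6^m, one for the factor
  -- 1/2, and the last one dominates d².
  have hbig : Real.exp (12 * (d : ℝ) ^ (7 / 10 : ℝ)) ≤ (2 : ℝ) ^ ((d : ℝ) ^ (3 / 4 : ℝ)) := by
    rw [Real.rpow_def_of_pos (show (0 : ℝ) < 2 by norm_num)]
    refine Real.exp_le_exp.2 ?_
    have h34 : 0 ≤ (d : ℝ) ^ (3 / 4 : ℝ) := by positivity
    have hlog : (1 / 2 : ℝ) ≤ Real.log 2 := by linarith [Real.log_two_gt_d9]
    linarith [mul_le_mul_of_nonneg_right hlog h34]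
  -- The exponential rates of rounds, filters and wedge cancel exactly.
  have hcancel : (9 / 8 : ℝ) ^ ((d : ℝ) / 2) * (4 / 3 : ℝ) ^ ((d : ℝ) / 2) *
      (2 / 3 : ℝ) ^ ((d : ℝ) / 2) = 1 := by
    rw [← Real.mul_rpow (by norm_num) (by norm_num), ← Real.mul_rpow (by norm_num) (by norm_num)]
    norm_num
  set X := Real.exp ((d : ℝ) ^ (7 / 10 : ℝ)) with hX
  have hX0 : 0 < X := Real.exp_pos _
  have hX9 : Real.exp (-(9 * (d : ℝ) ^ (7 / 10 : ℝ))) = (X ^ 9)⁻¹ := by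
    rw [Real.exp_neg, hX, ← Real.exp_nat_mul]; norm_num
  have hX12 : Real.exp (12 * (d : ℝ) ^ (7 / 10 : ℝ)) = X ^ 12 := by
    rw [hX, ← Real.exp_nat_mul]; norm_num
  rw [hX9] at hw2
  rw [hX12] at hbig
  set a := (9 / 8 : ℝ) ^ ((d : ℝ) / 2)
  set b := (4 / 3 : ℝ) ^ ((d : ℝ) / 2)
  set c := (2 / 3 : ℝ) ^ ((d : ℝ) / 2)
  have ha : 0 < a := by positivity
  have hb : 0 < b := by positivity
  have hc : 0 < c := by positivity
  have hw0 : 0 ≤ wedgeRadius δ := Real.sqrt_nonneg _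
  rw [div_pow]
  calc (d : ℝ) ^ 2 ≤ X := hd2
    _ = (a * b * c) * X ^ 12 * ((X ^ 9)⁻¹ * X⁻¹ * X⁻¹) := by rw [hcancel]; field_simp
    _ ≤ (a * b * c) * X ^ 12 * ((X ^ 9)⁻¹ * ((6 : ℝ) ^ numBlocks d)⁻¹ * 2⁻¹) := by gcongr
    _ = (a * X ^ 12) * (b / 6 ^ numBlocks d * (c * (X ^ 9)⁻¹) / 2) := by ring
    _ ≤ (a * 2 ^ ((d : ℝ) ^ (3 / 4 : ℝ))) * (b / 6 ^ numBlocks d * (c * (X ^ 9)⁻¹) / 2) := by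
        gcongr
    _ ≤ numRounds d * (b / 6 ^ numBlocks d * (c * (X ^ 9)⁻¹) / 2) := by gcongr
    _ ≤ _ := by gcongr

end growth

/-- A close pair is missed by all rounds with negligible probability only. -/
lemma eventually_stepMeasure_not_collide_le : ∀ᶠ d : ℕ in atTop, ∀ x y : E d, ‖x‖ = 1 → ‖y‖ = 1 →
    1 / 2 ≤ inner ℝ x y → stepMeasure d {ω | ¬ ∃ r, Collide (ω r) x y} ≤
      ENNReal.ofReal (Real.exp (-(d : ℝ) ^ 2)) := by
  filter_upwards [eventually_accuracy, eventually_gt_atTop 0, eventually_le_numRounds_mul]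
    with d hδ hd hq x y hx hy hxy
  have hp := le_roundMeasure_collide hδ hd hx hy hxy
  set q := (blockSize d / 6 : ℝ) ^ numBlocks d * wedgeRadius (accuracy d) ^ d / 2 with hqdef
  have hq0 : 0 ≤ q := by
    have hw0 : 0 ≤ wedgeRadius (accuracy d) := Real.sqrt_nonneg _
    positivity
  have hset : {ω : StepCoins d | ¬ ∃ r, Collide (ω r) x y} =
      Set.univ.pi fun _ => {ω : RoundCoins d | Collide ω x y}ᶜ := by
    ext ω
    simp only [Set.mem_ofPred_eq, Set.mem_pi, Set.mem_univ, forall_true_left, not_exists,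
      Set.mem_compl_iff]
  have hm : MeasurableSet {ω : RoundCoins d | Collide ω x y} :=
    (measurable_id.prodMk measurable_const) (measurableSet_collide (d := d))
      |> fun h => (h : MeasurableSet ((fun ω : RoundCoins d => (ω, ((x, y) : E d × E d))) ⁻¹' _))
  rw [hset, stepMeasure, Measure.pi_pi, Finset.prod_const, Finset.card_univ, Fintype.card_fin,
    prob_compl_eq_one_sub hm]
  -- The rounds are independent, so the pair is missed with probability at most exp(-`numRounds d` ·
  -- q), and the exponent is at most -d².
  have h1 : 1 - roundMeasure d {ω | Collide ω x y} ≤ ENNReal.ofReal (Real.exp (-q)) := by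
    refine (tsub_le_tsub_left hp 1).trans ?_
    rw [← ENNReal.ofReal_one, ← ENNReal.ofReal_sub _ hq0]
    exact ENNReal.ofReal_le_ofReal (Real.one_sub_le_exp_neg q)
  refine (pow_le_pow_left₀ zero_le h1 _).trans ?_
  rw [← ENNReal.ofReal_pow (Real.exp_pos _).le, ← Real.exp_nat_mul]
  refine ENNReal.ofReal_le_ofReal (Real.exp_le_exp.2 ?_)
  linarith

end Sieve

namespace Sieve

/-! ## Filter vectors -/

section filterVector

variable {d : ℕ}

/-- The filter vector belonging to a choice of one word per block. -/
noncomputable def filterVector (ω : RoundCoins d) (β : Fin (numBlocks d) → Fin (blockSize d)) :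
    E d := ∑ i, codePart ω i (β i)

lemma sum_partValue (ω : RoundCoins d) (v : E d) (β : Fin (numBlocks d) → Fin (blockSize d)) :
    ∑ i, partValue ω v i (β i) = inner ℝ (normalized v) (filterVector ω β) := by
  rw [filterVector, inner_sum]; rfl

/-- The words of different blocks are orthogonal, so y has norm at most 1: pairing it with its own
definition and using the Cauchy–Schwarz inequality over the blocks gives ‖y‖² ≤ ‖y‖. The inequality
suffices for `sphereUniform_cap_le` and needs no nondegeneracy. -/
lemma norm_filterVector_le (ω : RoundCoins d) (β : Fin (numBlocks d) → Fin (blockSize d)) :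
    ‖filterVector ω β‖ ≤ 1 := by
  have hm : (0 : ℝ) < numBlocks d := by exact_mod_cast numBlocks_pos
  set s := Real.sqrt (numBlocks d) with hs
  have hs0 : 0 < s := Real.sqrt_pos.2 hm
  have hss : s ^ 2 = numBlocks d := Real.sq_sqrt hm.le
  set y : E d := s⁻¹ • ∑ i, blockWord i (ω.2 i (β i)) with hy
  have h1 : filterVector ω β =
      ∑ j : Fin d, y j • InnerProductSpace.gramSchmidtNormed ℝ ω.1 j := by
    have h2 : ∀ j, y j = s⁻¹ * ∑ i, (blockWord i (ω.2 i (β i))) j := by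
      intro j; simp [hy]
    simp_rw [filterVector, codePart, h2, ← hs]
    rw [← Finset.smul_sum, Finset.sum_comm]
    simp_rw [mul_smul, Finset.sum_smul]
    rw [Finset.smul_sum]
  have h3 : ‖y‖ ^ 2 ≤ ‖y‖ := by
    have h4 : ∀ i, inner ℝ y (blockWord i (ω.2 i (β i))) ≤ ‖restr i y‖ := by
      intro i
      rw [inner_blockWord]
      refine (real_inner_le_norm _ _).trans ?_
      refine mul_le_of_le_one_left (norm_nonneg _) ?_
      rw [direction, norm_smul, norm_inv, norm_norm]
      exact inv_mul_le_one
    have h5 : (∑ i, ‖restr i y‖) ^ 2 ≤ numBlocks d * ‖y‖ ^ 2 := by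
      have := sq_sum_le_card_mul_sum_sq (s := Finset.univ) (f := fun i => ‖restr i y‖)
      rwa [sum_norm_restr_sq, Finset.card_univ, Fintype.card_fin] at this
    have h6 : ∑ i, ‖restr i y‖ ≤ s * ‖y‖ := by
      refine le_of_sq_le_sq ?_ (by positivity)
      rw [mul_pow, hss]; exact h5
    calc ‖y‖ ^ 2 = s⁻¹ * ∑ i, inner ℝ y (blockWord i (ω.2 i (β i))) := by
          rw [← inner_sum, ← real_inner_smul_right, ← hy, real_inner_self_eq_norm_sq]
      _ ≤ s⁻¹ * (s * ‖y‖) := by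
          gcongr
          exact (Finset.sum_le_sum fun i _ => h4 i).trans h6
      _ = ‖y‖ := by field_simp
  have h7 : ‖y‖ ≤ 1 := by nlinarith [norm_nonneg y]
  have h8 := norm_sum_gramSchmidtNormed_sq_le ω.1 y
  rw [← h1] at h8
  exact ((pow_le_pow_iff_left₀ (norm_nonneg _) (norm_nonneg _) two_ne_zero).1 h8).trans h7

lemma normalized_smul {R : ℝ} (hR : 0 < R) (v : E d) : normalized (R • v) = normalized v := by
  rw [normalized, normalized, norm_smul, Real.norm_of_nonneg hR.le, smul_smul]
  congr 1
  field_simp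

lemma mem_accepting_smul {R : ℝ} (hR : 0 < R) (ω : RoundCoins d) (v : E d) (a : Address d) :
    a ∈ accepting ω (R • v) ↔ a ∈ accepting ω v := by
  simp_rw [mem_accepting, sum_partValue, normalized_smul hR]

lemma collide_smul {R : ℝ} (hR : 0 < R) (ω : RoundCoins d) (v w : E d) :
    Collide ω (R • v) (R • w) ↔ Collide ω v w := by
  simp_rw [Collide, mem_accepting_smul hR]

lemma sphereUniform_mem_accepting_le (hd : 0 < d) (ω : RoundCoins d) (a : Address d) :
    sphereUniform (E d) {v | a ∈ accepting ω v} ≤ ENNReal.ofReal (Real.sqrt (3 / 4) ^ d) := by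
  have : Nontrivial (E d) := by
    have : Nonempty (Fin d) := ⟨⟨0, hd⟩⟩
    infer_instance
  by_cases ha : ∃ β : Fin (numBlocks d) → Fin (blockSize d), a = List.ofFn β
  · obtain ⟨β, rfl⟩ := ha
    have h1 := sphereUniform_cap_le (norm_filterVector_le ω β)
    rw [finrank_euclideanSpace, Fintype.card_fin] at h1
    refine le_trans (measure_mono_ae ?_) h1
    filter_upwards [ae_norm_sphereUniform] with v hv h
    obtain ⟨β', h2, h3⟩ := (mem_accepting ω v _).1 h
    rw [← List.ofFn_injective h2, sum_partValue, normalized, hv, inv_one, one_smul] at h3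
    exact h3
  · have : {v : E d | a ∈ accepting ω v} = ∅ := by
      ext v
      simp only [Set.mem_ofPred_eq, Set.mem_empty_iff_false, iff_false]
      intro h
      obtain ⟨β, h2, -⟩ := (mem_accepting ω v _).1 h
      exact ha ⟨β, h2⟩
    rw [this, measure_empty]
    exact zero_le

end filterVector

/-! ## The uniform measure on the unit sphere -/

section uniformSphere

variable {d : ℕ}

lemma uniformSphere_apply (hd : 0 < d) {A : Set (E d)} (hA : MeasurableSet A) :
    uniformSphere d {v | (v : E d) ∈ A} = sphereUniform (E d) A := by
  rw [← map_coe_uniformSphere hd, Measure.map_apply measurable_subtype_coe hA]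
  rfl

lemma uniformSphere_apply_le (hd : 0 < d) (A : Set (E d)) :
    uniformSphere d {v | (v : E d) ∈ A} ≤ sphereUniform (E d) A := by
  rw [← map_coe_uniformSphere hd]
  exact Measure.le_map_apply measurable_subtype_coe.aemeasurable A

lemma measurableSet_cap {V : Type*} [NormedAddCommGroup V] [InnerProductSpace ℝ V]
    [MeasurableSpace V] [BorelSpace V] [SecondCountableTopology V] (h : ℝ) (e : V) :
    MeasurableSet {v : V | h ≤ inner ℝ v e} :=
  measurableSet_le measurable_const (measurable_id.inner measurable_const)

lemma sphereUniform_cap_eq {V : Type*} [NormedAddCommGroup V] [InnerProductSpace ℝ V]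
    [FiniteDimensional ℝ V] [MeasurableSpace V] [BorelSpace V] (h : ℝ) {e e' : V}
    (he : ‖e‖ = ‖e'‖) :
    sphereUniform V {v | h ≤ inner ℝ v e} = sphereUniform V {v | h ≤ inner ℝ v e'} := by
  obtain ⟨f, hf⟩ := exists_linearIsometryEquiv_apply_eq he
  rw [← rotationInvariant_sphereUniform (V := V) f, Measure.map_apply f.continuous.measurable
    (measurableSet_cap h e'), rotationInvariant_sphereUniform]
  congr 1
  ext v
  simp only [Set.mem_preimage, Set.mem_ofPred_eq, ← hf, LinearIsometryEquiv.inner_map_map]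

/-- In dimension 1 the two points of the sphere are atoms. From dimension 2 on, a Gaussian vector
with direction `x` lies in the hyperplane orthogonal to some nonzero y ⊥ x. -/
lemma uniformSphere_singleton (hd : 2 ≤ d) (x : E d) : uniformSphere d {v | (v : E d) = x} = 0 := by
  have hdpos : 0 < d := by omega
  have : Nontrivial (E d) := by
    have : Nonempty (Fin d) := ⟨⟨0, hdpos⟩⟩
    infer_instance
  have h1 := uniformSphere_apply_le hdpos ({x} : Set (E d))
  refine le_antisymm (h1.trans (le_of_eq ?_)) zero_le
  rw [← map_direction_stdGaussian, Measure.map_apply measurable_direction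
    (measurableSet_singleton x)]
  have hne : (Submodule.span ℝ {x})ᗮ ≠ ⊥ := by
    intro h
    rw [Submodule.orthogonal_eq_bot_iff] at h
    have h2 := finrank_span_le_card (R := ℝ) ({x} : Set (E d))
    rw [h, finrank_top, finrank_euclideanSpace, Fintype.card_fin] at h2
    simp at h2
    omega
  obtain ⟨y, hy, hy0⟩ := Submodule.exists_mem_ne_zero_of_ne_bot hne
  refine measure_mono_null (fun g hg => ?_) (stdGaussian_inner_eq_zero hy0)
  simp only [Set.mem_preimage, Set.mem_singleton_iff, Set.mem_ofPred_eq] at hg ⊢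
  have h3 : inner ℝ x y = 0 := Submodule.mem_orthogonal_singleton_iff_inner_right.1 hy
  have h4 : g = ‖g‖ • x := by
    by_cases hg0 : g = 0
    · simp [hg0]
    · rw [← hg, direction, smul_smul, mul_inv_cancel₀ (norm_ne_zero_iff.2 hg0), one_smul]
  rw [h4, real_inner_smul_right, real_inner_comm, h3, mul_zero]

end uniformSphere

/-! ## Lists of independent random elements -/

lemma measurable_indicator_generateFrom {X : Type*} (A : Set X) :
    Measurable[MeasurableSpace.generateFrom {A}] (A.indicator (1 : X → ℝ)) := by
  let _ := MeasurableSpace.generateFrom {A}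
  exact measurable_one.indicator (MeasurableSpace.measurableSet_generateFrom rfl)

section pi

variable {X Y : Type*} [MeasurableSpace X] [MeasurableSpace Y]

lemma prod_measure_le (P : Measure X) (Q : Measure Y) [IsProbabilityMeasure P] [SFinite Q]
    {A : Set (X × Y)} (hA : MeasurableSet A) {c : ℝ≥0∞} (h : ∀ x, Q {y | (x, y) ∈ A} ≤ c) :
    P.prod Q A ≤ c := by
  rw [Measure.prod_apply hA]
  calc _ ≤ ∫⁻ _, c ∂P := lintegral_mono fun x => h x
    _ = c := by simp

lemma prod_measure_le_symm (P : Measure X) (Q : Measure Y) [SFinite P] [IsProbabilityMeasure Q]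
    {A : Set (X × Y)} (hA : MeasurableSet A) {c : ℝ≥0∞} (h : ∀ y, P {x | (x, y) ∈ A} ≤ c) :
    P.prod Q A ≤ c := by
  rw [Measure.prod_apply_symm hA]
  calc _ ≤ ∫⁻ _, c ∂Q := lintegral_mono fun x => h x
    _ = c := by simp

lemma pi_forall_mem {N : ℕ} (μ : Measure X) [IsProbabilityMeasure μ] {A : Set X}
    (S : Finset (Fin N)) : (Measure.pi fun _ : Fin N => μ) {u | ∀ i ∈ S, u i ∈ A} =
      μ A ^ S.card := by
  classical
  have : {u : Fin N → X | ∀ i ∈ S, u i ∈ A} =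
      Set.univ.pi fun i => if i ∈ S then A else Set.univ := by
    ext u
    simp only [Set.mem_ofPred_eq, Set.mem_pi, Set.mem_univ, forall_true_left]
    refine forall_congr' fun i => ?_
    split_ifs with h <;> simp [h]
  rw [this, Measure.pi_pi]
  have : ∀ i : Fin N, μ (if i ∈ S then A else Set.univ) = if i ∈ S then μ A else 1 := by
    intro i; split_ifs <;> simp
  simp_rw [this]
  rw [Finset.prod_ite_mem, Finset.univ_inter, Finset.prod_const]

open scoped Classical in
/-- It is unlikely that many elements of a random list lie in a small set. -/
lemma prod_card_filter_le {N : ℕ} (μ : Measure X) [IsProbabilityMeasure μ] (Q : Measure Y)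
    [IsProbabilityMeasure Q] {A : Set (X × Y)} (hA : MeasurableSet A) {q : ℝ≥0∞}
    (h : ∀ y, μ {x | (x, y) ∈ A} ≤ q) (s : ℕ) :
    ((Measure.pi fun _ : Fin N => μ).prod Q)
      {p | s ≤ (Finset.univ.filter fun i => (p.1 i, p.2) ∈ A).card} ≤ N.choose s * q ^ s := by
  -- Union bound over the `s`-element sets of indices. For a fixed set and fixed `y` the coordinates
  -- are independent.
  have hsub : {p : (Fin N → X) × Y | s ≤ (Finset.univ.filter fun i => (p.1 i, p.2) ∈ A).card} ⊆
      ⋃ S ∈ Finset.univ.powersetCard s, {p | ∀ i ∈ S, (p.1 i, p.2) ∈ A} := by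
    intro p hp
    obtain ⟨S, hS, hcard⟩ := Finset.exists_subset_card_eq (Set.mem_ofPred_eq ▸ hp)
    simp only [Set.mem_iUnion, Finset.mem_powersetCard, exists_prop]
    exact ⟨S, ⟨Finset.subset_univ _, hcard⟩, fun i hi => (Finset.mem_filter.1 (hS hi)).2⟩
  refine (measure_mono hsub).trans ((measure_biUnion_finset_le _ _).trans ?_)
  calc _ ≤ ∑ _S ∈ (Finset.univ : Finset (Fin N)).powersetCard s, q ^ s := by
        refine Finset.sum_le_sum fun S hS => ?_
        refine prod_measure_le_symm _ _ ?_ fun y => ?_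
        · have : {p : (Fin N → X) × Y | ∀ i ∈ S, (p.1 i, p.2) ∈ A} =
              ⋂ i ∈ S, (fun p : (Fin N → X) × Y => (p.1 i, p.2)) ⁻¹' A := by
            ext p; simp
          rw [this]
          refine Finset.measurableSet_biInter _ fun i _ => ?_
          exact (((measurable_pi_apply i).comp measurable_fst).prodMk measurable_snd) hA
        · have h1 := pi_forall_mem μ (A := {x | (x, y) ∈ A}) S
          simp only [Set.mem_ofPred_eq] at h1 ⊢
          rw [h1, (Finset.mem_powersetCard.1 hS).2]
          exact pow_le_pow_left₀ zero_le (h y) _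
    _ = _ := by
        rw [Finset.sum_const, Finset.card_powersetCard, Finset.card_univ, Fintype.card_fin,
          nsmul_eq_mul]

/-- If each of finitely many pairwise independent events of equal probability fails, then an event
of small probability happens. -/
lemma measure_forall_notMem_le {ι : Type*} [Fintype ι] (P : Measure X) [IsProbabilityMeasure P]
    {A : ι → Set X} (hA : ∀ i, MeasurableSet (A i)) {p : ℝ} (hp : 0 < p)
    (hPA : ∀ i, P.real (A i) = p) (hind : Pairwise fun i j => P (A i ∩ A j) = P (A i) * P (A j))
    (hne : Nonempty ι) :
    P {x | ∀ i, x ∉ A i} ≤ ENNReal.ofReal (1 / (Fintype.card ι * p)) := by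
  classical
  set f : ι → X → ℝ := fun i => (A i).indicator 1 with hf
  have hfm : ∀ i, Measurable (f i) := fun i => measurable_one.indicator (hA i)
  have hL : ∀ i, MemLp (f i) 2 P := fun i =>
    MemLp.of_bound (hfm i).aestronglyMeasurable 1 (Eventually.of_forall fun x => by
      simp only [hf, Set.indicator]; split_ifs <;> simp)
  have hint : ∀ i, ∫ x, f i x ∂P = p := by
    intro i
    rw [hf, integral_indicator_one (hA i), hPA]
  have hindep : ∀ i j, i ≠ j → IndepFun (f i) (f j) P := by
    intro i j hij
    have h1 : IndepSet (A i) (A j) P :=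
      (indepSet_iff_measure_inter_eq_mul (hA i) (hA j) P).2 (hind hij)
    have hle : ∀ k, (inferInstance : MeasurableSpace ℝ).comap (f k) ≤
        MeasurableSpace.generateFrom {A k} := by
      intro k
      rw [← measurable_iff_comap_le]
      exact measurable_indicator_generateFrom (A k)
    exact indep_of_indep_of_le_left (indep_of_indep_of_le_right h1 (hle j)) (hle i)
  have hvar : ∀ i, Var[f i; P] ≤ p := by
    intro i
    refine (variance_le_expectation_sq (hfm i).aestronglyMeasurable).trans (le_of_eq ?_)
    rw [← hint i]
    refine integral_congr_ae (Eventually.of_forall fun x => ?_)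
    simp only [hf, Set.indicator, Pi.pow_apply]; split_ifs <;> simp
  have hsum := IndepFun.variance_sum (μ := P) (X := f) (s := Finset.univ) (fun i _ => hL i)
    (fun i _ j _ hij => hindep i j hij)
  have hcard : (0 : ℝ) < Fintype.card ι := by exact_mod_cast Fintype.card_pos
  have hE : ∫ x, (∑ i, f i) x ∂P = Fintype.card ι * p := by
    simp_rw [Finset.sum_apply]
    rw [integral_finsetSum _ fun i _ => (hL i).integrable (by norm_num)]
    simp_rw [hint]
    rw [Finset.sum_const, Finset.card_univ, nsmul_eq_mul]
  -- If no event happens, the number of events that do deviates from its mean by the whole mean. Its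
  -- variance is at most the mean, by pairwise independence.
  have hch := meas_ge_le_variance_div_sq (μ := P) (X := ∑ i, f i)
    (memLp_finsetSum' _ fun i _ => hL i) (mul_pos hcard hp)
  refine (measure_mono fun x hx => ?_).trans (hch.trans (ENNReal.ofReal_le_ofReal ?_))
  · rw [Set.mem_ofPred_eq, hE]
    have : (∑ i, f i) x = 0 := by
      rw [Finset.sum_apply]
      exact Finset.sum_eq_zero fun i _ => Set.indicator_of_notMem (hx i) _
    rw [this, zero_sub, abs_neg]
    exact le_abs_self _
  · rw [hsum, div_le_div_iff₀ (by positivity) (by positivity)]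
    have : ∑ i, Var[f i; P] ≤ Fintype.card ι * p := by
      calc _ ≤ ∑ _i : ι, p := Finset.sum_le_sum fun i _ => hvar i
        _ = _ := by rw [Finset.sum_const, Finset.card_univ, nsmul_eq_mul]
    nlinarith [mul_pos hcard hp]

end pi

end Sieve

namespace Sieve

/-! ## Lists of random unit vectors -/

section pi

variable {X : Type*} [MeasurableSpace X]

lemma pi_pair {N : ℕ} (μ : Measure X) [IsProbabilityMeasure μ] {i j : Fin N} (hij : i ≠ j)
    {B C : Set X} (hB : MeasurableSet B) (hC : MeasurableSet C) :
    (Measure.pi fun _ : Fin N => μ) {u | u i ∈ B ∧ u j ∈ C} = μ B * μ C := by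
  have h1 := iIndepFun_pi (μ := fun _ : Fin N => μ) (X := fun _ => id) fun _ => aemeasurable_id
  have h2 := (h1.indepFun hij).measure_inter_preimage_eq_mul B C hB hC
  have h3 : ∀ (k : Fin N) {D : Set X}, MeasurableSet D →
      (Measure.pi fun _ : Fin N => μ) ((fun u => id (u k)) ⁻¹' D) = μ D := fun k D hD =>
    (measurePreserving_eval (fun _ : Fin N => μ) k).measure_preimage hD.nullMeasurableSet
  rw [h3 i hB, h3 j hC] at h2
  exact h2

lemma pi_single {N : ℕ} (μ : Measure X) [IsProbabilityMeasure μ] (i : Fin N)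
    {B : Set X} (hB : MeasurableSet B) :
    (Measure.pi fun _ : Fin N => μ) {u | u i ∈ B} = μ B :=
  (measurePreserving_eval (fun _ : Fin N => μ) i).measure_preimage hB.nullMeasurableSet

end pi

section lists

variable {d : ℕ}

/-- The distribution of one list of the ideal model. -/
noncomputable def listMeasure (d : ℕ) : Measure (UnitVectors d) :=
  Measure.pi fun _ => uniformSphere d

lemma isProbabilityMeasure_listMeasure (hd : 0 < d) : IsProbabilityMeasure (listMeasure d) := by
  have := isProbabilityMeasure_uniformSphere hd
  unfold listMeasure; infer_instance

lemma measurable_coord (i : Fin (listSize d)) :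
    Measurable fun u : UnitVectors d => (u i : E d) :=
  measurable_subtype_coe.comp (measurable_pi_apply i)

/-- `F` ignores coordinate `i`, so given the others a uniform vector would have to hit one
prescribed point. -/
lemma listMeasure_eq_null (hd : 2 ≤ d) (i : Fin (listSize d)) {F : UnitVectors d → E d}
    (hF : Measurable F) (h : ∀ u x, F (Function.update u i x) = F u) :
    listMeasure d {u | (u i : E d) = F u} = 0 := by
  have := isProbabilityMeasure_uniformSphere (show 0 < d by omega)
  have hm : MeasurableSet {u : UnitVectors d | (u i : E d) = F u} :=
    measurableSet_eq_fun (measurable_coord i) hF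
  rw [listMeasure, Measure.pi_apply_eq_lintegral_update _ i hm]
  have : ∀ u : UnitVectors d,
      uniformSphere d {x | Function.update u i x ∈ {u : UnitVectors d | (u i : E d) = F u}} = 0 := by
    intro u
    simp only [Set.mem_ofPred_eq, Function.update_self, h]
    exact uniformSphere_singleton hd _
  rw [lintegral_congr this, lintegral_zero]

lemma listMeasure_eq_coord (hd : 2 ≤ d) {i j : Fin (listSize d)} (hij : i ≠ j) :
    listMeasure d {u | (u i : E d) = u j} = 0 :=
  listMeasure_eq_null hd i (measurable_coord j) fun u x => by
    rw [Function.update_of_ne hij.symm]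

/-- The equation can be solved for `u i`: the hypotheses keep it from cancelling, and its
coefficient is 2 if `i = l` and 1 otherwise. -/
lemma listMeasure_sub_eq_sub (hd : 2 ≤ d) {i j k l : Fin (listSize d)} (hik : i ≠ k)
    (hij : i ≠ j) : listMeasure d {u | (u i : E d) - u j = u k - u l} = 0 := by
  have hadd : Measurable fun u : UnitVectors d => (u j : E d) + u k :=
    (measurable_coord j).add (measurable_coord k)
  by_cases hil : i = l
  · subst hil
    have h1 := listMeasure_eq_null hd i (F := fun u => (1 / 2 : ℝ) • ((u j : E d) + u k))
      ((measurable_const (a := (1 / 2 : ℝ))).smul hadd) fun u x => by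
        rw [Function.update_of_ne hij.symm, Function.update_of_ne hik.symm]
    refine measure_mono_null (fun u hu => ?_) h1
    simp only [Set.mem_ofPred_eq] at hu ⊢
    rw [sub_eq_sub_iff_add_eq_add] at hu
    rw [add_comm (u j : E d), ← hu, ← two_smul ℝ (u i : E d), smul_smul]
    norm_num
  · have h1 := listMeasure_eq_null hd i (F := fun u => (u j : E d) + u k - u l)
      (hadd.sub (measurable_coord l)) fun u x => by
        rw [Function.update_of_ne hij.symm, Function.update_of_ne hik.symm,
          Function.update_of_ne (Ne.symm hil)]
    refine measure_mono_null (fun u hu => ?_) h1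
    simp only [Set.mem_ofPred_eq] at hu ⊢
    rw [sub_eq_iff_eq_add] at hu
    rw [hu]; abel

lemma listMeasure_prod_sub_eq_sub (hd : 2 ≤ d) {i j k l : Fin (listSize d)} (hik : i ≠ k) :
    ((listMeasure d).prod (listMeasure d))
      {p | (p.2 i : E d) - p.1 j = p.2 k - p.1 l} = 0 := by
  have := isProbabilityMeasure_listMeasure (show 0 < d by omega)
  have c1 : ∀ i, Measurable fun p : UnitVectors d × UnitVectors d => (p.1 i : E d) := fun i =>
    (measurable_coord i).comp measurable_fst
  have c2 : ∀ i, Measurable fun p : UnitVectors d × UnitVectors d => (p.2 i : E d) := fun i =>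
    (measurable_coord i).comp measurable_snd
  refine le_antisymm (prod_measure_le _ _ (measurableSet_eq_fun ((c2 i).sub (c1 j))
    ((c2 k).sub (c1 l))) fun u => le_of_eq ?_) zero_le
  have h1 := listMeasure_eq_null hd i (F := fun v => (v k : E d) - u l + u j)
    (((measurable_coord k).sub_const _).add_const _) fun v x => by
      rw [Function.update_of_ne hik.symm]
  refine measure_mono_null (fun v hv => ?_) h1
  simp only [Set.mem_ofPred_eq, Pi.sub_apply] at hv ⊢
  rw [sub_eq_iff_eq_add] at hv
  exact hv

/-- The probability that a random unit vector has inner product at least `h` with a fixed one. -/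
noncomputable def capMeasure (d : ℕ) (h : ℝ) : ℝ≥0∞ :=
  ⨅ e : Metric.sphere (0 : E d) 1, uniformSphere d {v | h ≤ inner ℝ (v : E d) e}

/-- By rotation invariance the infimum that defines `capMeasure` runs over a constant family; it
merely avoids the choice of a centre. -/
lemma uniformSphere_cap (hd : 0 < d) (h : ℝ) (e : Metric.sphere (0 : E d) 1) :
    uniformSphere d {v | h ≤ inner ℝ (v : E d) e} = capMeasure d h := by
  have key : ∀ e : Metric.sphere (0 : E d) 1, uniformSphere d {v | h ≤ inner ℝ (v : E d) e} =
      sphereUniform (E d) {v | h ≤ inner ℝ v e} := fun e =>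
    uniformSphere_apply hd (measurableSet_cap h (e : E d))
  refine le_antisymm (le_iInf fun e' => le_of_eq ?_) (iInf_le _ e)
  rw [key, key]
  exact sphereUniform_cap_eq h (by simp)

lemma measurableSet_sphere_cap (h : ℝ) (e : E d) :
    MeasurableSet {v : Metric.sphere (0 : E d) 1 | h ≤ inner ℝ (v : E d) e} :=
  measurable_subtype_coe (measurableSet_cap h e)

lemma measurableSet_inner_coord (h : ℝ) (j i : Fin (listSize d)) : MeasurableSet
    {p : UnitVectors d × UnitVectors d | h ≤ inner ℝ (p.1 j : E d) (p.2 i)} :=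
  measurableSet_le measurable_const
    (((measurable_coord j).comp measurable_fst).inner ((measurable_coord i).comp measurable_snd))

lemma uniformSphere_cap_compl (hd : 0 < d) (h : ℝ) (e : Metric.sphere (0 : E d) 1) :
    uniformSphere d {v | ¬ h ≤ inner ℝ (v : E d) e} = 1 - capMeasure d h := by
  have := isProbabilityMeasure_uniformSphere hd
  rw [← uniformSphere_cap hd h e, ← prob_compl_eq_one_sub (measurableSet_sphere_cap h _)]
  rfl

/-- With `u i` held fixed, the other `listSize d - 1` vectors avoid the same cap independently. -/
lemma listMeasure_no_neighbour (hd : 0 < d) (h : ℝ) (i : Fin (listSize d)) :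
    listMeasure d {u | ∀ j, j ≠ i → ¬ h ≤ inner ℝ (u j : E d) (u i)} =
      (1 - capMeasure d h) ^ (listSize d - 1) := by
  have := isProbabilityMeasure_uniformSphere hd
  have hm : MeasurableSet {u : UnitVectors d | ∀ j, j ≠ i → ¬ h ≤ inner ℝ (u j : E d) (u i)} := by
    have : {u : UnitVectors d | ∀ j, j ≠ i → ¬ h ≤ inner ℝ (u j : E d) (u i)} =
        ⋂ j, ⋂ _ : j ≠ i, {u : UnitVectors d | h ≤ inner ℝ (u j : E d) (u i)}ᶜ := by
      ext u; simp
    rw [this]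
    exact MeasurableSet.iInter fun j => MeasurableSet.iInter fun _ =>
      (measurableSet_le measurable_const ((measurable_coord j).inner (measurable_coord i))).compl
  rw [listMeasure, Measure.pi_apply_eq_lintegral_update' _ i hm]
  have key : ∀ x, (Measure.pi fun _ : Fin (listSize d) => uniformSphere d)
      {u | Function.update u i x ∈
        {u : UnitVectors d | ∀ j, j ≠ i → ¬ h ≤ inner ℝ (u j : E d) (u i)}} =
      (1 - capMeasure d h) ^ (listSize d - 1) := by
    intro x
    have h1 := pi_forall_mem (N := listSize d) (uniformSphere d)
      (A := {v | ¬ h ≤ inner ℝ (v : E d) x}) (Finset.univ.erase i)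
    rw [uniformSphere_cap_compl hd, Finset.card_erase_of_mem (Finset.mem_univ i),
      Finset.card_univ, Fintype.card_fin] at h1
    rw [← h1]
    congr 1
    ext u
    simp only [Set.mem_ofPred_eq, Function.update_self, Finset.mem_erase, Finset.mem_univ,
      and_true]
    refine forall_congr' fun j => ?_
    by_cases hj : j = i
    · simp [hj]
    · simp [hj]
  simp_rw [key]
  simp

lemma listMeasure_prod_no_neighbour (hd : 0 < d) (h : ℝ) (i : Fin (listSize d)) :
    ((listMeasure d).prod (listMeasure d))
      {p | ∀ j, ¬ h ≤ inner ℝ (p.1 j : E d) (p.2 i)} ≤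
      (1 - capMeasure d h) ^ (listSize d - 1) := by
  have := isProbabilityMeasure_uniformSphere hd
  have := isProbabilityMeasure_listMeasure hd
  refine prod_measure_le_symm _ _ ?_ fun v => ?_
  · have : {p : UnitVectors d × UnitVectors d | ∀ j, ¬ h ≤ inner ℝ (p.1 j : E d) (p.2 i)} =
        ⋂ j, {p : UnitVectors d × UnitVectors d | h ≤ inner ℝ (p.1 j : E d) (p.2 i)}ᶜ := by
      ext u; simp
    rw [this]
    exact MeasurableSet.iInter fun j => (measurableSet_inner_coord h j i).compl
  · have h1 := pi_forall_mem (N := listSize d) (uniformSphere d)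
      (A := {w | ¬ h ≤ inner ℝ (w : E d) (v i)}) Finset.univ
    rw [uniformSphere_cap_compl hd, Finset.card_univ, Fintype.card_fin] at h1
    simp only [Set.mem_ofPred_eq, Finset.mem_univ, forall_true_left] at h1 ⊢
    rw [listMeasure, h1]
    exact pow_le_pow_of_le_one zero_le tsub_le_self (Nat.sub_le _ _)

lemma listMeasure_prod_cap (hd : 0 < d) (h : ℝ) (j i : Fin (listSize d)) :
    ((listMeasure d).prod (listMeasure d)) {p | h ≤ inner ℝ (p.1 j : E d) (p.2 i)} =
      capMeasure d h := by
  have := isProbabilityMeasure_uniformSphere hd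
  have := isProbabilityMeasure_listMeasure hd
  rw [Measure.prod_apply_symm (measurableSet_inner_coord h j i)]
  have key : ∀ v : UnitVectors d, listMeasure d ((fun u => (u, v)) ⁻¹'
      {p : UnitVectors d × UnitVectors d | h ≤ inner ℝ (p.1 j : E d) (p.2 i)}) =
      capMeasure d h := by
    intro v
    rw [← uniformSphere_cap hd h (v i)]
    exact pi_single (uniformSphere d) j (measurableSet_sphere_cap h (v i : E d))
  simp_rw [key]
  simp

/-- Pairwise independence, also for two pairs that share a vector: given the shared vector, or one
whole list, the caps have the same measure wherever their centres are. -/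
lemma listMeasure_prod_cap_inter (hd : 0 < d) (h : ℝ) {j i l k : Fin (listSize d)}
    (hne : (i, j) ≠ (k, l)) :
    ((listMeasure d).prod (listMeasure d))
      ({p | h ≤ inner ℝ (p.1 j : E d) (p.2 i)} ∩ {p | h ≤ inner ℝ (p.1 l : E d) (p.2 k)}) =
      capMeasure d h * capMeasure d h := by
  have := isProbabilityMeasure_uniformSphere hd
  have := isProbabilityMeasure_listMeasure hd
  have hm := (measurableSet_inner_coord (d := d) h j i).inter (measurableSet_inner_coord h l k)
  by_cases hjl : j = l
  · have hik : i ≠ k := by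
      rintro rfl; exact hne (by rw [hjl])
    rw [Measure.prod_apply hm]
    have key : ∀ u : UnitVectors d, listMeasure d (Prod.mk u ⁻¹'
        ({p | h ≤ inner ℝ (p.1 j : E d) (p.2 i)} ∩ {p | h ≤ inner ℝ (p.1 l : E d) (p.2 k)})) =
        capMeasure d h * capMeasure d h := by
      intro u
      nth_rewrite 1 [← uniformSphere_cap hd h (u j)]
      rw [← uniformSphere_cap hd h (u l)]
      rw [← pi_pair (uniformSphere d) hik (measurableSet_sphere_cap h (u j : E d))
        (measurableSet_sphere_cap h (u l : E d))]
      simp only [Set.mem_ofPred_eq, real_inner_comm (u j : E d), real_inner_comm (u l : E d)]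
      rfl
    simp_rw [key]
    simp
  · rw [Measure.prod_apply_symm hm]
    have key : ∀ v : UnitVectors d, listMeasure d ((fun u => (u, v)) ⁻¹'
        ({p | h ≤ inner ℝ (p.1 j : E d) (p.2 i)} ∩ {p | h ≤ inner ℝ (p.1 l : E d) (p.2 k)})) =
        capMeasure d h * capMeasure d h := by
      intro v
      nth_rewrite 1 [← uniformSphere_cap hd h (v i)]
      rw [← uniformSphere_cap hd h (v k)]
      exact pi_pair (uniformSphere d) hjl (measurableSet_sphere_cap h (v i : E d))
        (measurableSet_sphere_cap h (v k : E d))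
    simp_rw [key]
    simp

/-- Two random lists contain a pair with inner product at least `h` if the expected number of such
pairs is large. -/
lemma listMeasure_prod_no_pair (hd : 0 < d) {h p : ℝ} (hp : 0 < p)
    (hph : ENNReal.ofReal p ≤ capMeasure d h) :
    ((listMeasure d).prod (listMeasure d)) {q | ∀ i j, ¬ h ≤ inner ℝ (q.1 j : E d) (q.2 i)} ≤
      ENNReal.ofReal (1 / ((listSize d : ℝ) ^ 2 * p)) := by
  have := isProbabilityMeasure_uniformSphere hd
  have := isProbabilityMeasure_listMeasure hd
  have hN : 0 < listSize d := Nat.ceil_pos.2 (by positivity)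
  have hN' : (0 : ℝ) < listSize d := by exact_mod_cast hN
  have : Nonempty (Fin (listSize d)) := ⟨⟨0, hN⟩⟩
  have htop : capMeasure d h ≠ ∞ := by
    rw [← listMeasure_prod_cap hd h ⟨0, hN⟩ ⟨0, hN⟩]; exact measure_ne_top _ _
  have hpp : p ≤ (capMeasure d h).toReal := (ENNReal.ofReal_le_iff_le_toReal htop).1 hph
  have h1 := measure_forall_notMem_le ((listMeasure d).prod (listMeasure d))
    (A := fun a : Fin (listSize d) × Fin (listSize d) =>
      {q : UnitVectors d × UnitVectors d | h ≤ inner ℝ (q.1 a.2 : E d) (q.2 a.1)})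
    (fun a => measurableSet_inner_coord h a.2 a.1) (p := (capMeasure d h).toReal)
    (hp.trans_le hpp) (fun a => by rw [Measure.real, listMeasure_prod_cap hd])
    (fun a b hab => by
      beta_reduce
      rw [listMeasure_prod_cap hd, listMeasure_prod_cap hd]
      exact listMeasure_prod_cap_inter hd h hab) inferInstance
  refine (measure_mono fun q hq => ?_).trans (h1.trans (ENNReal.ofReal_le_ofReal ?_))
  · exact fun a => hq a.1 a.2
  · rw [Fintype.card_prod, Fintype.card_fin]
    push_cast
    rw [← sq]
    gcongr

end lists

end Sieve

namespace Sieve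

/-! ## One application of the sieve to random lists -/

section model

variable {d : ℕ}

/-- A sample from the ideal model. -/
abbrev Sample (d : ℕ) : Type := (UnitVectors d × UnitVectors d) × StepCoins d

open scoped Classical in
/-- The properties of a sample that make the application of the sieve succeed: all buckets have
fewer than `s` elements, different pairs have different differences, every vector has a neighbour
to within inner product `h`, and all close pairs share a filter. -/
structure Typical (s : ℕ) (h : ℝ) (p : Sample d) : Prop where
  bucket_zero : ∀ r, ∀ a ∈ addresses d,
    ¬ s ≤ (Finset.univ.filter fun i => a ∈ accepting (p.2 r) (p.1.1 i : E d)).card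
  bucket_target : ∀ r, ∀ a ∈ addresses d,
    ¬ s ≤ (Finset.univ.filter fun i => a ∈ accepting (p.2 r) (p.1.2 i : E d)).card
  ne_zero : ∀ i j, i ≠ j → (p.1.1 i : E d) ≠ p.1.1 j
  sub_ne_sub_zero : ∀ i j k l, i ≠ k → i ≠ j → (p.1.1 i : E d) - p.1.1 j ≠ p.1.1 k - p.1.1 l
  sub_ne_sub_target : ∀ i j k l, i ≠ k → (p.1.2 i : E d) - p.1.1 j ≠ p.1.2 k - p.1.1 l
  neighbour_zero : ∀ i, ∃ j, j ≠ i ∧ h ≤ inner ℝ (p.1.1 j : E d) (p.1.1 i)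
  neighbour_target : ∀ i, ∃ j, h ≤ inner ℝ (p.1.1 j : E d) (p.1.2 i)
  collide_zero : ∀ i j, 1 / 2 ≤ inner ℝ (p.1.1 j : E d) (p.1.1 i) →
    ∃ r, Collide (p.2 r) (p.1.1 i : E d) (p.1.1 j)
  collide_target : ∀ i j, 1 / 2 ≤ inner ℝ (p.1.1 j : E d) (p.1.2 i) →
    ∃ r, Collide (p.2 r) (p.1.2 i : E d) (p.1.1 j)

open scoped Classical in
lemma bucketSize_ofFn {n : ℕ} (ω : RoundCoins d) (f : Fin n → E d) (a : Address d) :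
    bucketSize ω (List.ofFn f) a = (Finset.univ.filter fun i => a ∈ accepting ω (f i)).card := by
  rw [bucketSize, List.ofFn_eq_map, List.countP_map, List.countP_eq_length_filter,
    ← List.toFinset_card_of_nodup ((List.nodup_finRange n).filter _)]
  congr 1
  ext i
  simp

lemma bucketSize_le_of_typical {s n : ℕ} {R : ℝ} (hR : 0 < R) (ω : RoundCoins d)
    (f : Fin n → E d) (h : ∀ a ∈ addresses d, ¬ s ≤ (open scoped Classical in
      Finset.univ.filter fun i => a ∈ accepting ω (f i)).card) (a : Address d) :
    bucketSize ω (List.ofFn fun i => R • f i) a ≤ s := by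
  classical
  rw [bucketSize_ofFn]
  simp_rw [mem_accepting_smul hR]
  by_cases ha : a ∈ addresses d
  · have := h a ha
    push Not at this
    convert this.le
  · rw [Finset.filter_false_of_mem fun i _ hi => ha (mem_addresses_of_mem_accepting hi)]
    simp

lemma norm_sub_le_of_inner {x y : E d} (hx : ‖x‖ = 1) (hy : ‖y‖ = 1) {h c : ℝ} (hc : 0 ≤ c)
    (hh : 2 - 2 * h ≤ c ^ 2) (hxy : h ≤ inner ℝ y x) : ‖x - y‖ ≤ c := by
  refine le_of_sq_le_sq ?_ hc
  rw [@norm_sub_sq_real, hx, hy, real_inner_comm]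
  linarith

lemma le_length_of_injective {n : ℕ} {L : List (E d)} (f : Fin n → E d)
    (hf : Function.Injective f) (h : ∀ i, f i ∈ L ∨ n ≤ L.length) : n ≤ L.length := by
  classical
  by_contra hn
  have h1 : Finset.univ.image f ⊆ L.toFinset := by
    intro w hw
    obtain ⟨i, -, rfl⟩ := Finset.mem_image.1 hw
    exact List.mem_toFinset.2 ((h i).resolve_right hn)
  have h2 := (Finset.card_le_card h1).trans L.toFinset_card_le
  rw [Finset.card_image_of_injective _ hf, Finset.card_univ, Fintype.card_fin] at h2
  exact hn h2

lemma fits_model (R : ℝ) (t : E d) (p : Sample d) :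
    Fits (⟨List.ofFn fun i => R • (p.1.1 i : E d), List.ofFn fun i => t + R • (p.1.2 i : E d), 0⟩ :
      State d) := by
  constructor <;> simp

lemma map_sub_ofFn {n : ℕ} (t : E d) (f : Fin n → E d) :
    (List.ofFn fun i => t + f i).map (· - t) = List.ofFn f := by
  rw [List.map_ofFn]
  congr 1
  ext1 i
  simp

/-- Each index `i` with a neighbour `j i` yields a short difference, and different indices yield
different ones. These are `listSize d` candidates, each found through a shared filter, so the lists
are full. The hypothesis on `h` turns inner products into lengths through ‖x - y‖² = 2 - 2⟪x, y⟫. -/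
lemma productive_of_typical {s : ℕ} {h R : ℝ} (hR : 0 < R) (hs : 0 ≤ shrink d) (t : E d)
    (hh : 1 / 2 ≤ h) (hsh : 2 - 2 * h ≤ shrink d ^ 2) {p : Sample d} (hp : Typical s h p) :
    Productive (modelStep R t p) (numRounds d * roundTime d s : ℕ)
      (2 * d * listSize d + roundSpace d s : ℕ) := by
  have hcost := cost_sieveStep (R := R) (t := t) (ω := p.2) (k := s) (fits_model R t p)
    (fun r => bucketSize_le_of_typical hR _ _ (hp.bucket_zero r))
    (fun r => by
      rw [map_sub_ofFn]
      exact bucketSize_le_of_typical hR _ _ (hp.bucket_target r))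
  have hn1 : ∀ i, ‖(p.1.1 i : E d)‖ = 1 := fun i => by simp
  have hn2 : ∀ i, ‖(p.1.2 i : E d)‖ = 1 := fun i => by simp
  refine ⟨?_, ?_, ?_, ?_⟩
  · choose j hj1 hj2 using hp.neighbour_zero
    refine le_length_of_injective (fun i => R • (p.1.1 i : E d) - R • (p.1.1 (j i) : E d)) ?_ ?_
    · intro i k hik
      by_contra hne
      simp only [← smul_sub] at hik
      exact hp.sub_ne_sub_zero i (j i) k (j k) hne (hj1 i).symm (smul_right_injective _ hR.ne' hik)
    · intro i
      refine mem_zero_sieveStep (List.mem_ofFn.2 ⟨i, rfl⟩) (List.mem_ofFn.2 ⟨j i, rfl⟩) ?_ ?_ ?_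
      · rw [← smul_sub, norm_smul, Real.norm_of_nonneg hR.le, mul_comm]
        exact mul_le_mul_of_nonneg_right
          (norm_sub_le_of_inner (hn1 i) (hn1 (j i)) hs hsh (hj2 i)) hR.le
      · rw [← smul_sub]
        exact smul_ne_zero hR.ne' (sub_ne_zero.2 (hp.ne_zero i (j i) (hj1 i).symm))
      · obtain ⟨r, hr⟩ := hp.collide_zero i (j i) (hh.trans (hj2 i))
        exact ⟨r, (collide_smul hR _ _ _).2 hr⟩
  · choose j hj2 using hp.neighbour_target
    refine le_length_of_injective
      (fun i => t + R • (p.1.2 i : E d) - R • (p.1.1 (j i) : E d)) ?_ ?_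
    · intro i k hik
      by_contra hne
      simp only [add_sub_assoc, ← smul_sub] at hik
      exact hp.sub_ne_sub_target i (j i) k (j k) hne
        (smul_right_injective _ hR.ne' (add_left_cancel hik))
    · intro i
      refine (mem_target_sieveStep (List.mem_ofFn.2 ⟨i, rfl⟩) (List.mem_ofFn.2 ⟨j i, rfl⟩)
        ?_ ?_).1
      · rw [add_sub_assoc, add_sub_cancel_left, ← smul_sub, norm_smul, Real.norm_of_nonneg hR.le,
          mul_comm]
        exact mul_le_mul_of_nonneg_right
          (norm_sub_le_of_inner (hn2 i) (hn1 (j i)) hs hsh (hj2 i)) hR.le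
      · obtain ⟨r, hr⟩ := hp.collide_target i (j i) (hh.trans (hj2 i))
        exact ⟨r, by rw [add_sub_cancel_left]; exact (collide_smul hR _ _ _).2 hr⟩
  · exact_mod_cast hcost.time_le
  · have := hcost.peak_le
    exact_mod_cast this

lemma norm_best_sub_le_of_typical {s : ℕ} {h R : ℝ} (hR : 0 < R) (t : E d)
    {p : Sample d} (hp : Typical s h p) {c : ℝ} (hc : 0 ≤ c) (hcs : c ≤ shrink d) {h' : ℝ}
    (hh' : 1 / 2 ≤ h') (hch' : 2 - 2 * h' ≤ c ^ 2) {i j : Fin (listSize d)}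
    (hij : h' ≤ inner ℝ (p.1.1 j : E d) (p.1.2 i)) :
    ‖(modelStep R t p).val.best - t‖ ≤ c * R := by
  have h1 : ‖t + R • (p.1.2 i : E d) - R • (p.1.1 j : E d) - t‖ ≤ c * R := by
    rw [add_sub_assoc, add_sub_cancel_left, ← smul_sub, norm_smul, Real.norm_of_nonneg hR.le,
      mul_comm]
    exact mul_le_mul_of_nonneg_right
      (norm_sub_le_of_inner (by simp) (by simp) hc hch' hij) hR.le
  refine (mem_target_sieveStep (List.mem_ofFn.2 ⟨i, rfl⟩) (List.mem_ofFn.2 ⟨j, rfl⟩)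
    (h1.trans (mul_le_mul_of_nonneg_right hcs hR.le)) ?_).2.trans h1
  obtain ⟨r, hr⟩ := hp.collide_target i j (hh'.trans hij)
  exact ⟨r, by rw [add_sub_cancel_left]; exact (collide_smul hR _ _ _).2 hr⟩

/-! ### Union bounds in the ideal model -/

lemma measure_exists_le {Ω ι : Type*} [MeasurableSpace Ω] [Fintype ι] (μ : Measure Ω)
    {P : ι → Ω → Prop} {c : ℝ≥0∞} (h : ∀ i, μ {ω | P i ω} ≤ c) :
    μ {ω | ∃ i, P i ω} ≤ Fintype.card ι * c := by
  have : {ω | ∃ i, P i ω} = ⋃ i, {ω | P i ω} := by ext; simp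
  rw [this]
  refine (measure_iUnion_fintype_le _ _).trans ((Finset.sum_le_sum fun i _ => h i).trans ?_)
  simp

lemma measure_exists_mem_le {Ω ι : Type*} [MeasurableSpace Ω] (s : Finset ι) (μ : Measure Ω)
    {P : ι → Ω → Prop} {c : ℝ≥0∞} (h : ∀ i ∈ s, μ {ω | P i ω} ≤ c) :
    μ {ω | ∃ i ∈ s, P i ω} ≤ s.card * c := by
  have : {ω | ∃ i ∈ s, P i ω} = ⋃ i ∈ s, {ω | P i ω} := by ext; simp
  rw [this]
  refine (measure_biUnion_finset_le _ _).trans ((Finset.sum_le_sum fun i hi => h i hi).trans ?_)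
  simp

lemma modelMeasure_def (d : ℕ) : modelMeasure d =
    ((listMeasure d).prod (listMeasure d)).prod (stepMeasure d) := rfl

lemma modelMeasure_fst_le (hd : 0 < d) (A : Set (UnitVectors d × UnitVectors d)) :
    modelMeasure d {p | p.1 ∈ A} ≤ ((listMeasure d).prod (listMeasure d)) A := by
  have := isProbabilityMeasure_listMeasure hd
  have h1 : MeasurePreserving Prod.fst (modelMeasure d) ((listMeasure d).prod (listMeasure d)) :=
    measurePreserving_fst
  rw [← h1.map_eq]
  exact Measure.le_map_apply measurable_fst.aemeasurable A

lemma modelMeasure_zero_le (hd : 0 < d) (A : Set (UnitVectors d × StepCoins d)) :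
    modelMeasure d {p | (p.1.1, p.2) ∈ A} ≤ ((listMeasure d).prod (stepMeasure d)) A := by
  have := isProbabilityMeasure_listMeasure hd
  have h1 : MeasurePreserving (Prod.map Prod.fst id) (modelMeasure d)
      ((listMeasure d).prod (stepMeasure d)) :=
    (measurePreserving_fst (μ := listMeasure d) (ν := listMeasure d)).prod (.id (stepMeasure d))
  rw [← h1.map_eq]
  exact Measure.le_map_apply h1.measurable.aemeasurable A

lemma modelMeasure_target_le (hd : 0 < d) (A : Set (UnitVectors d × StepCoins d)) :
    modelMeasure d {p | (p.1.2, p.2) ∈ A} ≤ ((listMeasure d).prod (stepMeasure d)) A := by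
  have := isProbabilityMeasure_listMeasure hd
  have h1 : MeasurePreserving (Prod.map Prod.snd id) (modelMeasure d)
      ((listMeasure d).prod (stepMeasure d)) :=
    (measurePreserving_snd (μ := listMeasure d) (ν := listMeasure d)).prod (.id (stepMeasure d))
  rw [← h1.map_eq]
  exact Measure.le_map_apply h1.measurable.aemeasurable A

open scoped Classical in
lemma listMeasure_bucket_le (hd : 0 < d) (s : ℕ) (r : Fin (numRounds d)) (a : Address d) :
    ((listMeasure d).prod (stepMeasure d)) {p | s ≤ (Finset.univ.filter fun i =>
      a ∈ accepting (p.2 r) (p.1 i : E d)).card} ≤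
      (listSize d).choose s * ENNReal.ofReal (Real.sqrt (3 / 4) ^ d) ^ s := by
  have := isProbabilityMeasure_uniformSphere hd
  have hm : Measurable fun p : Metric.sphere (0 : E d) 1 × StepCoins d => (p.2 r, (p.1 : E d)) :=
    ((measurable_pi_apply r).comp measurable_snd).prodMk (measurable_subtype_coe.comp measurable_fst)
  have h1 := prod_card_filter_le (N := listSize d) (uniformSphere d) (stepMeasure d)
    (A := {p | a ∈ accepting (p.2 r) (p.1 : E d)}) (hm (measurableSet_accepting a)) (fun ω => (uniformSphere_apply_le hd _).trans
      (sphereUniform_mem_accepting_le hd (ω r) a)) s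
  simp only [Set.mem_ofPred_eq] at h1
  convert h1
  rfl

lemma measurableSet_not_collide {f g : UnitVectors d × UnitVectors d → E d} (hf : Measurable f)
    (hg : Measurable g) : MeasurableSet {p : Sample d | 1 / 2 ≤ inner ℝ (g p.1) (f p.1) ∧
      ¬ ∃ r, Collide (p.2 r) (f p.1) (g p.1)} := by
  have h1 : MeasurableSet {p : Sample d | 1 / 2 ≤ inner ℝ (g p.1) (f p.1)} :=
    measurableSet_le measurable_const ((hg.comp measurable_fst).inner (hf.comp measurable_fst))
  have h2 : {p : Sample d | ∃ r, Collide (p.2 r) (f p.1) (g p.1)} =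
      ⋃ r, {p : Sample d | Collide (p.2 r) (f p.1) (g p.1)} := by ext; simp
  have h3 : MeasurableSet {p : Sample d | ∃ r, Collide (p.2 r) (f p.1) (g p.1)} := by
    rw [h2]
    refine MeasurableSet.iUnion fun r => ?_
    have hm : Measurable fun p : Sample d => (p.2 r, (f p.1, g p.1)) :=
      ((measurable_pi_apply r).comp measurable_snd).prodMk
        ((hf.comp measurable_fst).prodMk (hg.comp measurable_fst))
    exact hm (measurableSet_collide (d := d))
  exact h1.inter h3.compl

lemma modelMeasure_not_collide_le (hd : 0 < d) {f g : UnitVectors d × UnitVectors d → E d}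
    (hf : Measurable f) (hg : Measurable g) (hf1 : ∀ p, ‖f p‖ = 1) (hg1 : ∀ p, ‖g p‖ = 1)
    {ε : ℝ≥0∞} (hε : ∀ x y : E d, ‖x‖ = 1 → ‖y‖ = 1 → 1 / 2 ≤ inner ℝ x y →
      stepMeasure d {ω | ¬ ∃ r, Collide (ω r) x y} ≤ ε) :
    modelMeasure d {p | 1 / 2 ≤ inner ℝ (g p.1) (f p.1) ∧
      ¬ ∃ r, Collide (p.2 r) (f p.1) (g p.1)} ≤ ε := by
  have := isProbabilityMeasure_listMeasure hd
  rw [modelMeasure_def]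
  refine prod_measure_le _ _ (measurableSet_not_collide hf hg) fun q => ?_
  by_cases hq : 1 / 2 ≤ inner ℝ (g q) (f q)
  · refine (measure_mono fun ω hω => ?_).trans
      (hε (f q) (g q) (hf1 q) (hg1 q) (by rwa [real_inner_comm]))
    exact hω.2
  · have : {ω : StepCoins d | (q, ω) ∈ {p : Sample d | 1 / 2 ≤ inner ℝ (g p.1) (f p.1) ∧
        ¬ ∃ r, Collide (p.2 r) (f p.1) (g p.1)}} = ∅ := by
      ext ω
      simp only [Set.mem_ofPred_eq, Set.mem_empty_iff_false, iff_false]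
      exact fun h => hq h.1
    rw [this, measure_empty]
    exact zero_le

open scoped Classical in
-- For the buckets the codes are held fixed and the vectors are random; for missed pairs the vectors
-- are held fixed and the codes are random. Coincidences of vectors or differences have probability
-- zero. The factors 2 count the two lists.
lemma modelMeasure_not_typical_le (hd : 2 ≤ d) (s : ℕ) (h : ℝ) {ε : ℝ≥0∞}
    (hε : ∀ x y : E d, ‖x‖ = 1 → ‖y‖ = 1 → 1 / 2 ≤ inner ℝ x y →
      stepMeasure d {ω | ¬ ∃ r, Collide (ω r) x y} ≤ ε) :
    modelMeasure d {p | ¬ Typical s h p} ≤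
      2 * (numRounds d * ((blockSize d ^ numBlocks d : ℕ) *
        ((listSize d).choose s * ENNReal.ofReal (Real.sqrt (3 / 4) ^ d) ^ s))) +
      2 * (listSize d * (1 - capMeasure d h) ^ (listSize d - 1)) +
      2 * (listSize d * (listSize d * ε)) := by
  have hd0 : 0 < d := by omega
  have := isProbabilityMeasure_listMeasure hd0
  have hfst : ∀ {A : Set (UnitVectors d)}, listMeasure d A = 0 →
      modelMeasure d {p | p.1.1 ∈ A} = 0 := by
    intro A hA
    refine le_antisymm ((modelMeasure_fst_le hd0 {q | q.1 ∈ A}).trans ?_) zero_le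
    have h1 : MeasurePreserving Prod.fst ((listMeasure d).prod (listMeasure d)) (listMeasure d) :=
      measurePreserving_fst
    exact (h1.quasiMeasurePreserving.preimage_null hA).le
  have c1 : ∀ i, Measurable fun p : UnitVectors d × UnitVectors d => (p.1 i : E d) := fun i =>
    (measurable_coord i).comp measurable_fst
  have c2 : ∀ i, Measurable fun p : UnitVectors d × UnitVectors d => (p.2 i : E d) := fun i =>
    (measurable_coord i).comp measurable_snd
  set μ := modelMeasure d with hμ
  set N := listSize d with hN
  set B := (blockSize d ^ numBlocks d : ℕ) with hB
  set q := (N.choose s * ENNReal.ofReal (Real.sqrt (3 / 4) ^ d) ^ s : ℝ≥0∞) with hq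
  set z := (1 - capMeasure d h) ^ (N - 1) with hz
  have b1 : μ {p | ∃ r, ∃ a ∈ addresses d,
      s ≤ (Finset.univ.filter fun i => a ∈ accepting (p.2 r) (p.1.1 i : E d)).card} ≤
      numRounds d * (B * q) := by
    have := measure_exists_le (ι := Fin (numRounds d)) μ (P := fun r p => ∃ a ∈ addresses d,
      s ≤ (Finset.univ.filter fun i => a ∈ accepting (p.2 r) (p.1.1 i : E d)).card)
      (c := B * q) fun r => by
        rw [hB, ← card_addresses]
        exact measure_exists_mem_le (addresses d) μ fun a _ =>
          (modelMeasure_zero_le hd0 _).trans (listMeasure_bucket_le hd0 s r a)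
    rwa [Fintype.card_fin] at this
  have b2 : μ {p | ∃ r, ∃ a ∈ addresses d,
      s ≤ (Finset.univ.filter fun i => a ∈ accepting (p.2 r) (p.1.2 i : E d)).card} ≤
      numRounds d * (B * q) := by
    have := measure_exists_le (ι := Fin (numRounds d)) μ (P := fun r p => ∃ a ∈ addresses d,
      s ≤ (Finset.univ.filter fun i => a ∈ accepting (p.2 r) (p.1.2 i : E d)).card)
      (c := B * q) fun r => by
        rw [hB, ← card_addresses]
        exact measure_exists_mem_le (addresses d) μ fun a _ =>
          (modelMeasure_target_le hd0 _).trans (listMeasure_bucket_le hd0 s r a)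
    rwa [Fintype.card_fin] at this
  have b3 : ∀ᵐ p ∂μ, ∀ i j, i ≠ j → (p.1.1 i : E d) ≠ p.1.1 j := by
    simp_rw [ae_all_iff]
    intro i j hij
    rw [ae_iff]
    simp only [not_not]
    exact hfst (listMeasure_eq_coord hd hij)
  have b4 : ∀ᵐ p ∂μ, ∀ i j k l, i ≠ k → i ≠ j →
      (p.1.1 i : E d) - p.1.1 j ≠ p.1.1 k - p.1.1 l := by
    simp_rw [ae_all_iff]
    intro i j k l hik hij
    rw [ae_iff]
    simp only [not_not]
    exact hfst (listMeasure_sub_eq_sub hd hik hij)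
  have b5 : ∀ᵐ p ∂μ, ∀ i j k l, i ≠ k →
      (p.1.2 i : E d) - p.1.1 j ≠ p.1.2 k - p.1.1 l := by
    simp_rw [ae_all_iff]
    intro i j k l hik
    rw [ae_iff]
    simp only [not_not]
    exact le_antisymm ((modelMeasure_fst_le hd0 _).trans
      (listMeasure_prod_sub_eq_sub hd hik (j := j) (l := l)).le) zero_le
  have b6 : μ {p | ∃ i, ∀ j, j ≠ i → ¬ h ≤ inner ℝ (p.1.1 j : E d) (p.1.1 i)} ≤ N * z := by
    have := measure_exists_le (ι := Fin N) μ (P := fun i p => ∀ j, j ≠ i →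
      ¬ h ≤ inner ℝ (p.1.1 j : E d) (p.1.1 i)) (c := z) fun i => by
        refine (modelMeasure_fst_le hd0 {p | ∀ j, j ≠ i → ¬ h ≤ inner ℝ (p.1 j : E d) (p.1 i)}).trans
          (le_trans ?_ (listMeasure_no_neighbour hd0 h i).le)
        have h1 : MeasurePreserving Prod.fst ((listMeasure d).prod (listMeasure d))
          (listMeasure d) := measurePreserving_fst
        nth_rewrite 3 [← h1.map_eq]
        exact Measure.le_map_apply measurable_fst.aemeasurable _
    rwa [Fintype.card_fin] at this
  have b7 : μ {p | ∃ i, ∀ j, ¬ h ≤ inner ℝ (p.1.1 j : E d) (p.1.2 i)} ≤ N * z := by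
    have := measure_exists_le (ι := Fin N) μ (P := fun i p => ∀ j,
      ¬ h ≤ inner ℝ (p.1.1 j : E d) (p.1.2 i)) (c := z) fun i =>
        (modelMeasure_fst_le hd0 _).trans (listMeasure_prod_no_neighbour hd0 h i)
    rwa [Fintype.card_fin] at this
  have b8 : μ {p | ∃ i j, 1 / 2 ≤ inner ℝ (p.1.1 j : E d) (p.1.1 i) ∧
      ¬ ∃ r, Collide (p.2 r) (p.1.1 i : E d) (p.1.1 j)} ≤ N * (N * ε) := by
    have := measure_exists_le (ι := Fin N) μ (P := fun i p => ∃ j,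
      1 / 2 ≤ inner ℝ (p.1.1 j : E d) (p.1.1 i) ∧
      ¬ ∃ r, Collide (p.2 r) (p.1.1 i : E d) (p.1.1 j)) (c := N * ε) fun i => by
        have := measure_exists_le (ι := Fin N) μ (P := fun j p =>
          1 / 2 ≤ inner ℝ (p.1.1 j : E d) (p.1.1 i) ∧
          ¬ ∃ r, Collide (p.2 r) (p.1.1 i : E d) (p.1.1 j)) (c := ε) fun j =>
            modelMeasure_not_collide_le hd0 (c1 i) (c1 j) (fun _ => by simp) (fun _ => by simp) hε
        rwa [Fintype.card_fin] at this
    rwa [Fintype.card_fin] at this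
  have b9 : μ {p | ∃ i j, 1 / 2 ≤ inner ℝ (p.1.1 j : E d) (p.1.2 i) ∧
      ¬ ∃ r, Collide (p.2 r) (p.1.2 i : E d) (p.1.1 j)} ≤ N * (N * ε) := by
    have := measure_exists_le (ι := Fin N) μ (P := fun i p => ∃ j,
      1 / 2 ≤ inner ℝ (p.1.1 j : E d) (p.1.2 i) ∧
      ¬ ∃ r, Collide (p.2 r) (p.1.2 i : E d) (p.1.1 j)) (c := N * ε) fun i => by
        have := measure_exists_le (ι := Fin N) μ (P := fun j p =>
          1 / 2 ≤ inner ℝ (p.1.1 j : E d) (p.1.2 i) ∧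
          ¬ ∃ r, Collide (p.2 r) (p.1.2 i : E d) (p.1.1 j)) (c := ε) fun j =>
            modelMeasure_not_collide_le hd0 (c2 i) (c1 j) (fun _ => by simp) (fun _ => by simp) hε
        rwa [Fintype.card_fin] at this
    rwa [Fintype.card_fin] at this
  have hle : μ {p | ¬ Typical s h p} ≤ μ ((({p | ∃ r, ∃ a ∈ addresses d,
      s ≤ (Finset.univ.filter fun i => a ∈ accepting (p.2 r) (p.1.1 i : E d)).card} ∪
      {p | ∃ r, ∃ a ∈ addresses d,
      s ≤ (Finset.univ.filter fun i => a ∈ accepting (p.2 r) (p.1.2 i : E d)).card}) ∪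
      ({p | ∃ i, ∀ j, j ≠ i → ¬ h ≤ inner ℝ (p.1.1 j : E d) (p.1.1 i)} ∪
      {p | ∃ i, ∀ j, ¬ h ≤ inner ℝ (p.1.1 j : E d) (p.1.2 i)})) ∪
      ({p | ∃ i j, 1 / 2 ≤ inner ℝ (p.1.1 j : E d) (p.1.1 i) ∧
        ¬ ∃ r, Collide (p.2 r) (p.1.1 i : E d) (p.1.1 j)} ∪
      {p | ∃ i j, 1 / 2 ≤ inner ℝ (p.1.1 j : E d) (p.1.2 i) ∧
        ¬ ∃ r, Collide (p.2 r) (p.1.2 i : E d) (p.1.1 j)})) := by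
    refine measure_mono_ae ?_
    filter_upwards [b3, b4, b5] with p h3 h4 h5 hp
    by_contra hc
    have hc' := fun h' => hc (Set.mem_union_left _ (Set.mem_union_left _ h'))
    have hc'' := fun h' => hc (Set.mem_union_left _ (Set.mem_union_right _ h'))
    have hcc := fun h' => hc (Set.mem_union_right _ h')
    refine hp ⟨fun r a ha hs => hc' (Or.inl ⟨r, a, ha, hs⟩),
      fun r a ha hs => hc' (Or.inr ⟨r, a, ha, hs⟩), h3, h4, h5, fun i => ?_, fun i => ?_,
      fun i j hij => ?_, fun i j hij => ?_⟩
    · by_contra hn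
      push Not at hn
      exact hc'' (Or.inl ⟨i, fun j hj => not_le.2 (hn j hj)⟩)
    · by_contra hn
      push Not at hn
      exact hc'' (Or.inr ⟨i, fun j => not_le.2 (hn j)⟩)
    · by_contra hn
      exact hcc (Or.inl ⟨i, j, hij, hn⟩)
    · by_contra hn
      exact hcc (Or.inr ⟨i, j, hij, hn⟩)
  refine hle.trans ((measure_union_le _ _).trans (add_le_add ((measure_union_le _ _).trans
    (add_le_add ((measure_union_le _ _).trans ?_) ((measure_union_le _ _).trans ?_)))
    ((measure_union_le _ _).trans ?_)))
  · rw [two_mul]; exact add_le_add b1 b2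
  · rw [two_mul]; exact add_le_add b6 b7
  · rw [two_mul]; exact add_le_add b8 b9

end model

end Sieve

namespace Sieve

/-! ## Subexponential growth -/

section subexp

/-- The function grows at most subexponentially. -/
def Subexp (f : ℕ → ℝ) : Prop := ∀ ε : ℝ, 0 < ε → ∀ᶠ d : ℕ in atTop, f d ≤ Real.exp (ε * d)

namespace Subexp

variable {f g : ℕ → ℝ}

lemma mono (hg : Subexp g) (h : ∀ᶠ d in atTop, f d ≤ g d) : Subexp f := fun ε hε => by
  filter_upwards [hg ε hε, h] with d h1 h2 using h2.trans h1

lemma mul (hf : Subexp f) (hg : Subexp g) (hg0 : ∀ d, 0 ≤ g d) : Subexp fun d => f d * g d :=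
  fun ε hε => by
    filter_upwards [hf (ε / 2) (half_pos hε), hg (ε / 2) (half_pos hε)] with d h1 h2
    calc f d * g d ≤ Real.exp (ε / 2 * d) * Real.exp (ε / 2 * d) :=
          mul_le_mul h1 h2 (hg0 d) (Real.exp_pos _).le
      _ = Real.exp (ε * d) := by rw [← Real.exp_add]; congr 1; ring

lemma const (C : ℝ) : Subexp fun _ => C := fun ε hε => by
  have h1 : Tendsto (fun d : ℕ => ε * (d : ℝ)) atTop atTop :=
    tendsto_natCast_atTop_atTop.const_mul_atTop hε
  exact (Real.tendsto_exp_atTop.comp h1).eventually_ge_atTop C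

lemma add (hf : Subexp f) (hg : Subexp g) : Subexp fun d => f d + g d := fun ε hε => by
  filter_upwards [hf (ε / 2) (half_pos hε), hg (ε / 2) (half_pos hε),
    const 2 (ε / 2) (half_pos hε)] with d h1 h2 h3
  have h4 : 0 < Real.exp (ε / 2 * d) := Real.exp_pos _
  calc f d + g d ≤ 2 * Real.exp (ε / 2 * d) := by linarith
    _ ≤ Real.exp (ε / 2 * d) * Real.exp (ε / 2 * d) := by gcongr
    _ = Real.exp (ε * d) := by rw [← Real.exp_add]; congr 1; ring

lemma pow (hf : Subexp f) (hf0 : ∀ d, 0 ≤ f d) (k : ℕ) : Subexp fun d => f d ^ k := by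
  induction k with
  | zero => simpa using const 1
  | succ k ih => simpa only [pow_succ] using ih.mul hf hf0

lemma natCast : Subexp fun d : ℕ => (d : ℝ) := fun ε hε => by
  filter_upwards [eventually_mul_log_le_rpow (1 / ε) zero_lt_one, eventually_gt_atTop 0] with d h h0
  have h0' : (0 : ℝ) < d := by exact_mod_cast h0
  rw [Real.rpow_one, one_div, ← div_eq_inv_mul, div_le_iff₀ hε] at h
  calc (d : ℝ) = Real.exp (Real.log d) := (Real.exp_log h0').symm
    _ ≤ _ := Real.exp_le_exp.2 (by linarith)

lemma two_rpow : Subexp fun d : ℕ => (2 : ℝ) ^ ((d : ℝ) ^ (3 / 4 : ℝ)) := fun ε hε => by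
  filter_upwards [eventually_mul_rpow_le (Real.log 2 / ε) (show (3 / 4 : ℝ) < 1 by norm_num)]
    with d h
  rw [Real.rpow_one, div_mul_eq_mul_div, div_le_iff₀ hε] at h
  rw [Real.rpow_def_of_pos (show (0 : ℝ) < 2 by norm_num)]
  exact Real.exp_le_exp.2 (by linarith)

lemma two_rpow_isLittleO {e : ℕ → ℝ} (he : e =o[atTop] fun d : ℕ => (d : ℝ)) :
    Subexp fun d => (2 : ℝ) ^ e d := fun ε hε => by
  have hl := Real.log_pos (show (1 : ℝ) < 2 by norm_num)
  filter_upwards [he.bound (div_pos hε hl)] with d h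
  rw [Real.norm_natCast] at h
  rw [Real.rpow_def_of_pos (show (0 : ℝ) < 2 by norm_num)]
  refine Real.exp_le_exp.2 ?_
  have h2 := (le_abs_self _).trans h
  rw [div_mul_eq_mul_div, le_div_iff₀ hl] at h2
  linarith

end Subexp

end subexp

/-! ## Sizes of the parameters -/

section sizes

lemma ceil_le_two_mul {x : ℝ} (hx : 1 ≤ x) : (⌈x⌉₊ : ℝ) ≤ 2 * x := by
  linarith [(Nat.ceil_lt_add_one (zero_le_one.trans hx)).le]

lemma listSize_le {d : ℕ} (hd : 0 < d) :
    (listSize d : ℝ) ≤ 2 * (d : ℝ) ^ 4 * (4 / 3 : ℝ) ^ ((d : ℝ) / 2) := by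
  have h1 : (1 : ℝ) ≤ d := by exact_mod_cast hd
  have h2 : (1 : ℝ) ≤ (4 / 3 : ℝ) ^ ((d : ℝ) / 2) := Real.one_le_rpow (by norm_num) (by positivity)
  rw [mul_assoc]
  exact ceil_le_two_mul (one_le_mul_of_one_le_of_one_le (one_le_pow₀ h1) h2)

lemma le_listSize (d : ℕ) : (d : ℝ) ^ 4 * (4 / 3 : ℝ) ^ ((d : ℝ) / 2) ≤ listSize d :=
  Nat.le_ceil _

lemma two_pow_numBlocks_le {d : ℕ} (hd : 0 < d) : 2 ^ numBlocks d ≤ 2 * d := by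
  rw [numBlocks, pow_succ, mul_comm]
  exact Nat.mul_le_mul_left _ (Nat.pow_log_le_self 2 hd.ne')

lemma blockSize_le (d : ℕ) :
    (blockSize d : ℝ) ≤ 2 * (4 / 3 : ℝ) ^ ((d : ℝ) / (2 * numBlocks d)) :=
  ceil_le_two_mul (Real.one_le_rpow (by norm_num) (by positivity))

lemma codeSize_le {d : ℕ} (hd : 0 < d) :
    (blockSize d : ℝ) ^ numBlocks d ≤ 2 * d * (4 / 3 : ℝ) ^ ((d : ℝ) / 2) := by
  have hm : (numBlocks d : ℝ) ≠ 0 := by exact_mod_cast numBlocks_pos.ne'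
  have h2 : (2 : ℝ) ^ numBlocks d ≤ 2 * d := by exact_mod_cast two_pow_numBlocks_le hd
  calc (blockSize d : ℝ) ^ numBlocks d
      ≤ (2 * (4 / 3 : ℝ) ^ ((d : ℝ) / (2 * numBlocks d))) ^ numBlocks d := by
        gcongr; exact blockSize_le d
    _ = 2 ^ numBlocks d * (4 / 3 : ℝ) ^ ((d : ℝ) / 2) := by
        rw [mul_pow, ← Real.rpow_natCast ((4 / 3 : ℝ) ^ _), ← Real.rpow_mul (by norm_num)]
        congr 2; field_simp
    _ ≤ _ := by gcongr

lemma numRounds_le (d : ℕ) : (numRounds d : ℝ) ≤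
    2 * (2 : ℝ) ^ ((d : ℝ) ^ (3 / 4 : ℝ)) * (9 / 8 : ℝ) ^ ((d : ℝ) / 2) := by
  have h1 : (1 : ℝ) ≤ (9 / 8 : ℝ) ^ ((d : ℝ) / 2) := Real.one_le_rpow (by norm_num) (by positivity)
  have h2 : (1 : ℝ) ≤ (2 : ℝ) ^ ((d : ℝ) ^ (3 / 4 : ℝ)) :=
    Real.one_le_rpow (by norm_num) (by positivity)
  have := ceil_le_two_mul (one_le_mul_of_one_le_of_one_le h1 h2)
  rw [mul_assoc, mul_comm ((2 : ℝ) ^ _)]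
  exact this

lemma rpow_half_le_exp (d : ℕ) {a : ℝ} (ha : 0 < a) : a ^ ((d : ℝ) / 2) ≤
    Real.exp ((a - 1) / 2 * d) := by
  rw [Real.rpow_def_of_pos ha]
  refine Real.exp_le_exp.2 ?_
  have := Real.log_le_sub_one_of_pos ha
  have h0 : (0 : ℝ) ≤ d / 2 := by positivity
  nlinarith

/-- Crude bounds that suffice for union bounds, since the failure probabilities decay much faster
than exp(-d) where needed. -/
lemma eventually_sizes_le : ∀ᶠ d : ℕ in atTop, (listSize d : ℝ) ≤ Real.exp d ∧
    (blockSize d : ℝ) ^ numBlocks d ≤ Real.exp d ∧ (numRounds d : ℝ) ≤ Real.exp d := by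
  have h1 : Subexp fun d : ℕ => 2 * (d : ℝ) ^ 4 :=
    (Subexp.const 2).mul (Subexp.natCast.pow (fun _ => by positivity) 4) fun _ => by positivity
  have h2 : Subexp fun d : ℕ => 2 * (d : ℝ) :=
    (Subexp.const 2).mul Subexp.natCast fun _ => by positivity
  have h3 : Subexp fun d : ℕ => 2 * (2 : ℝ) ^ ((d : ℝ) ^ (3 / 4 : ℝ)) :=
    (Subexp.const 2).mul Subexp.two_rpow fun _ => by positivity
  filter_upwards [h1 (1 / 2) (by norm_num), h2 (1 / 2) (by norm_num), h3 (1 / 2) (by norm_num),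
    eventually_gt_atTop 0] with d e1 e2 e3 hd
  have hd' : (0 : ℝ) ≤ d := by positivity
  have key : ∀ a : ℝ, 0 < a → a ≤ 2 → Real.exp (1 / 2 * d) * a ^ ((d : ℝ) / 2) ≤ Real.exp d := by
    intro a ha ha2
    calc _ ≤ Real.exp (1 / 2 * d) * Real.exp ((a - 1) / 2 * d) := by
          gcongr; exact rpow_half_le_exp d ha
      _ ≤ Real.exp d := by
          rw [← Real.exp_add]
          exact Real.exp_le_exp.2 (by nlinarith)
  refine ⟨(listSize_le hd).trans (le_trans (by gcongr) (key (4 / 3) (by norm_num) (by norm_num))),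
    (codeSize_le hd).trans (le_trans (by gcongr) (key (4 / 3) (by norm_num) (by norm_num))),
    (numRounds_le d).trans (le_trans (by gcongr) (key (9 / 8) (by norm_num) (by norm_num)))⟩

end sizes

/-! ## The failure probabilities -/

section failure

/-- A bound for the number of elements of a bucket. -/
def bucketBound (d : ℕ) : ℕ := 8 * (d ^ 4 + 1)

/-- With s = `bucketBound d`, the expected bucket size Nq is at most d⁴ + 1 = s/8. Hence C(N, s)q^s
≤ (s/8)^s/s! ≤ e^s/8^s ≤ e^(-s), because 8 ≥ e². This is the reason for the 8 in `bucketBound`. -/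
lemma choose_mul_pow_le (d : ℕ) : ((listSize d).choose (bucketBound d) : ℝ≥0∞) *
    ENNReal.ofReal (Real.sqrt (3 / 4) ^ d) ^ bucketBound d ≤
    ENNReal.ofReal (Real.exp (-(bucketBound d : ℝ))) := by
  set q := Real.sqrt (3 / 4) ^ d with hq
  have hq' : q = (3 / 4 : ℝ) ^ ((d : ℝ) / 2) := by
    rw [hq, Real.sqrt_eq_rpow, ← Real.rpow_natCast, ← Real.rpow_mul (by norm_num)]
    congr 1; ring
  have hq0 : 0 ≤ q := by positivity
  have hNq : listSize d * q ≤ d ^ 4 + 1 := by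
    have h1 : (listSize d : ℝ) ≤ (d : ℝ) ^ 4 * (4 / 3 : ℝ) ^ ((d : ℝ) / 2) + 1 :=
      (Nat.ceil_lt_add_one (by positivity)).le
    have h2 : (4 / 3 : ℝ) ^ ((d : ℝ) / 2) * q = 1 := by
      rw [hq', ← Real.mul_rpow (by norm_num) (by norm_num)]; norm_num
    have h3 : q ≤ 1 := by
      rw [hq']; exact Real.rpow_le_one (by norm_num) (by norm_num) (by positivity)
    calc listSize d * q ≤ ((d : ℝ) ^ 4 * (4 / 3 : ℝ) ^ ((d : ℝ) / 2) + 1) * q := by gcongr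
      _ = (d : ℝ) ^ 4 * ((4 / 3 : ℝ) ^ ((d : ℝ) / 2) * q) + q := by ring
      _ ≤ _ := by rw [h2]; linarith
  set s := bucketBound d with hs
  have hs' : (s : ℝ) = 8 * (d ^ 4 + 1) := by rw [hs, bucketBound]; push_cast; ring
  have hs0 : (0 : ℝ) ≤ s := by positivity
  rw [← ENNReal.ofReal_pow hq0, ← ENNReal.ofReal_natCast, ← ENNReal.ofReal_mul (by positivity)]
  refine ENNReal.ofReal_le_ofReal ?_
  have he : Real.exp 2 ≤ 8 := by
    have : Real.exp 2 = Real.exp 1 * Real.exp 1 := by rw [← Real.exp_add]; norm_num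
    rw [this]; nlinarith [Real.exp_one_lt_d9, Real.exp_pos 1]
  calc ((listSize d).choose s : ℝ) * q ^ s ≤ (listSize d : ℝ) ^ s / s.factorial * q ^ s := by
        gcongr; exact Nat.choose_le_pow_div s _
    _ = (listSize d * q) ^ s / s.factorial := by rw [mul_pow]; ring
    _ ≤ (s / 8 : ℝ) ^ s / s.factorial := by
        gcongr
        rw [hs']; linarith
    _ = ((s : ℝ) ^ s / s.factorial) / 8 ^ s := by rw [div_pow]; ring
    _ ≤ Real.exp s / (Real.exp 2) ^ s := by
        gcongr
        exact Real.pow_div_factorial_le_exp _ hs0 _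
    _ = Real.exp (-(s : ℝ)) := by
        rw [← Real.exp_nat_mul, ← Real.exp_sub]; congr 1; ring

lemma le_capMeasure {d : ℕ} (hd : 0 < d) {h r : ℝ} (hh : 0 < h) (hr : 0 < r)
    (hhr : h ^ 2 + 2 * h / d + r ^ 2 ≤ 1) :
    ENNReal.ofReal (r ^ d / (2 * d)) ≤ capMeasure d h := by
  have : Nonempty (Fin d) := ⟨⟨0, hd⟩⟩
  have : Nontrivial (E d) := inferInstance
  obtain ⟨e, he⟩ := exists_norm_eq (E d) zero_le_one
  rw [← uniformSphere_cap hd h ⟨e, by simp [he]⟩]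
  have h1 := le_sphereUniform_cap (V := E d) he hh hr hd hhr
  rw [← uniformSphere_apply hd (measurableSet_cap h e), finrank_euclideanSpace,
    Fintype.card_fin] at h1
  rw [ENNReal.ofReal_div_of_pos (by positivity)]
  refine ENNReal.div_le_of_le_mul' ?_
  convert h1
  rw [ENNReal.ofReal_mul (by norm_num), ENNReal.ofReal_natCast]
  · push_cast
    simp
  · exact Iff.rfl

lemma exp_neg_two_mul_le {x : ℝ} (h0 : 0 ≤ x) (h1 : x ≤ 1 / 2) : Real.exp (-(2 * x)) ≤ 1 - x := by
  have := Real.add_one_le_exp (2 * x)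
  rw [Real.exp_neg, inv_le_comm₀ (Real.exp_pos _) (by linarith)]
  refine le_trans ?_ this
  rw [inv_le_iff_one_le_mul₀ (by linarith)]
  nlinarith

/-- The inner product from which on two unit vectors are close enough for the sieve. -/
noncomputable def neighbourBound (d : ℕ) : ℝ := 1 / 2 + 1 / d

/-- Moving from 1/2 to 1/2 + 1/d shrinks the cap by a constant factor and the slab argument costs
2d. So the d⁴ in the list size leaves at least d³/108 expected neighbours. -/
lemma eventually_le_mul_capMeasure : ∀ᶠ d : ℕ in atTop, ∃ p : ℝ, 0 ≤ p ∧
    ENNReal.ofReal p ≤ capMeasure d (neighbourBound d) ∧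
    3 * (d : ℝ) ≤ ((listSize d - 1 : ℕ) : ℝ) * p := by
  filter_upwards [eventually_ge_atTop 2000] with d hd
  have hd0 : (2000 : ℝ) ≤ d := by exact_mod_cast hd
  have hdp : (0 : ℝ) < d := by linarith
  -- Solves h² + 2h/d + r² = 1 for h = 1/2 + 1/d with r² = (3/4)(1 - x). As xd ≤ 3, the loss (1 -
  -- x)^(d/2) is at least e⁻³.
  set x : ℝ := 8 / (3 * d) + 4 / d ^ 2 with hx
  have hx0 : 0 ≤ x := by positivity
  have hxd : x * d ≤ 3 := by
    have : x * d = 8 / 3 + 4 / d := by rw [hx]; field_simp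
    have : (4 : ℝ) / d ≤ 4 / 2000 := by gcongr
    linarith
  have hx1 : x ≤ 1 / 2 := by nlinarith
  set r := Real.sqrt (3 / 4 * (1 - x)) with hr
  have hr0 : 0 < r := Real.sqrt_pos.2 (by nlinarith)
  have hr2 : r ^ 2 = 3 / 4 * (1 - x) := Real.sq_sqrt (by nlinarith)
  have hrd : (3 / 4 : ℝ) ^ ((d : ℝ) / 2) * Real.exp (-3) ≤ r ^ d := by
    have h1 : r ^ d = (3 / 4 * (1 - x)) ^ ((d : ℝ) / 2) := by
      rw [hr, Real.sqrt_eq_rpow, ← Real.rpow_natCast, ← Real.rpow_mul (by nlinarith)]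
      congr 1; ring
    rw [h1, Real.mul_rpow (by norm_num) (by linarith)]
    gcongr
    calc Real.exp (-3) ≤ Real.exp (-(2 * x)) ^ ((d : ℝ) / 2) := by
          rw [← Real.exp_mul]; exact Real.exp_le_exp.2 (by linarith)
      _ ≤ _ := Real.rpow_le_rpow (Real.exp_pos _).le (exp_neg_two_mul_le hx0 hx1) (by positivity)
  refine ⟨r ^ d / (2 * d), by positivity, le_capMeasure (by omega)
    (by unfold neighbourBound; positivity) hr0 ?_, ?_⟩
  · rw [hr2, hx, neighbourBound]
    refine le_of_eq ?_
    field_simp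
    ring
  · have hN := le_listSize d
    have h43 : (1 : ℝ) ≤ (4 / 3 : ℝ) ^ ((d : ℝ) / 2) :=
      Real.one_le_rpow (by norm_num) (by positivity)
    have hcancel : (4 / 3 : ℝ) ^ ((d : ℝ) / 2) * (3 / 4 : ℝ) ^ ((d : ℝ) / 2) = 1 := by
      rw [← Real.mul_rpow (by norm_num) (by norm_num)]; norm_num
    have hd4 : (2 : ℝ) ≤ (d : ℝ) ^ 4 := by
      calc (2 : ℝ) ≤ (d : ℝ) ^ 1 := by linarith
        _ ≤ (d : ℝ) ^ 4 := pow_le_pow_right₀ (by linarith) (by norm_num)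
    have hN2 : (2 : ℝ) ≤ listSize d := by nlinarith
    have hN1 : (listSize d : ℝ) / 2 ≤ ((listSize d - 1 : ℕ) : ℝ) := by
      have : 1 ≤ listSize d := by
        have : (1 : ℝ) ≤ listSize d := by linarith
        exact_mod_cast this
      rw [Nat.cast_sub this]
      push_cast; linarith
    have he : (1 / 27 : ℝ) ≤ Real.exp (-3) := by
      have h3 : Real.exp 3 ≤ 27 := by
        have : Real.exp 3 = Real.exp 1 * Real.exp 1 * Real.exp 1 := by
          rw [← Real.exp_add, ← Real.exp_add]; norm_num
        have h1 := Real.exp_one_lt_d9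
        have h2 := Real.exp_pos 1
        have h4 : Real.exp 1 * Real.exp 1 ≤ 9 := by nlinarith
        rw [this]; nlinarith
      rw [Real.exp_neg, one_div]
      exact inv_anti₀ (Real.exp_pos _) h3
    set b := (3 / 4 : ℝ) ^ ((d : ℝ) / 2)
    set a := (4 / 3 : ℝ) ^ ((d : ℝ) / 2)
    have hb0 : 0 < b := by positivity
    calc 3 * (d : ℝ) ≤ (d : ℝ) ^ 3 / 108 := by
          have : (d : ℝ) ^ 2 ≥ 2000 * 2000 := by nlinarith
          have : (d : ℝ) ^ 3 = d ^ 2 * d := by ring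
          nlinarith
      _ = (d : ℝ) ^ 4 * (a * b) / 2 * (1 / 27) / (2 * d) := by rw [hcancel]; field_simp; norm_num
      _ = ((d : ℝ) ^ 4 * a / 2) * (b * (1 / 27) / (2 * d)) := by ring
      _ ≤ (listSize d / 2) * (b * Real.exp (-3) / (2 * d)) := by gcongr
      _ ≤ ((listSize d - 1 : ℕ) : ℝ) * (r ^ d / (2 * d)) := by gcongr

lemma one_sub_capMeasure_pow_le {d n : ℕ} {h p y : ℝ} (hp : 0 ≤ p)
    (hc : ENNReal.ofReal p ≤ capMeasure d h) (hy : y ≤ n * p) :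
    (1 - capMeasure d h) ^ n ≤ ENNReal.ofReal (Real.exp (-y)) := by
  have h1 : 1 - capMeasure d h ≤ ENNReal.ofReal (Real.exp (-p)) := by
    refine (tsub_le_tsub_left hc 1).trans ?_
    rw [← ENNReal.ofReal_one, ← ENNReal.ofReal_sub _ hp]
    exact ENNReal.ofReal_le_ofReal (Real.one_sub_le_exp_neg p)
  refine (pow_le_pow_left₀ zero_le h1 _).trans ?_
  rw [← ENNReal.ofReal_pow (Real.exp_pos _).le, ← Real.exp_nat_mul]
  exact ENNReal.ofReal_le_ofReal (Real.exp_le_exp.2 (by linarith))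

lemma eventually_not_typical_le : ∀ᶠ d : ℕ in atTop,
    modelMeasure d {p | ¬ Typical (bucketBound d) (neighbourBound d) p} ≤
      ENNReal.ofReal (Real.exp (-(d : ℝ))) := by
  filter_upwards [eventually_sizes_le, eventually_le_mul_capMeasure, eventually_ge_atTop 8,
    eventually_stepMeasure_not_collide_le] with d ⟨hN, hB, hr⟩ ⟨p, hp, hcap, hNp⟩ hd hε
  have hd8 : (8 : ℝ) ≤ d := by exact_mod_cast hd
  refine (modelMeasure_not_typical_le (by omega) (bucketBound d) (neighbourBound d) hε).trans ?_
  have hN' : (listSize d : ℝ≥0∞) ≤ ENNReal.ofReal (Real.exp d) := by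
    rw [← ENNReal.ofReal_natCast]; exact ENNReal.ofReal_le_ofReal hN
  have hB' : ((blockSize d ^ numBlocks d : ℕ) : ℝ≥0∞) ≤ ENNReal.ofReal (Real.exp d) := by
    rw [← ENNReal.ofReal_natCast]; exact ENNReal.ofReal_le_ofReal (by push_cast; exact hB)
  have hr' : (numRounds d : ℝ≥0∞) ≤ ENNReal.ofReal (Real.exp d) := by
    rw [← ENNReal.ofReal_natCast]; exact ENNReal.ofReal_le_ofReal hr
  have h1 := choose_mul_pow_le d
  have h2 := one_sub_capMeasure_pow_le hp hcap hNp
  have hs : 8 * (d : ℝ) ≤ bucketBound d := by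
    rw [bucketBound]; push_cast
    have : (d : ℝ) ^ 1 ≤ (d : ℝ) ^ 4 := pow_le_pow_right₀ (by linarith) (by norm_num)
    linarith
  have two : (2 : ℝ≥0∞) = ENNReal.ofReal 2 := by simp
  calc _ ≤ 2 * (ENNReal.ofReal (Real.exp d) * (ENNReal.ofReal (Real.exp d) *
        ENNReal.ofReal (Real.exp (-(bucketBound d : ℝ))))) +
      2 * (ENNReal.ofReal (Real.exp d) * ENNReal.ofReal (Real.exp (-(3 * (d : ℝ))))) +
      2 * (ENNReal.ofReal (Real.exp d) * (ENNReal.ofReal (Real.exp d) *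
        ENNReal.ofReal (Real.exp (-(d : ℝ) ^ 2)))) := by gcongr
    _ = ENNReal.ofReal (2 * (Real.exp d * (Real.exp d * Real.exp (-(bucketBound d : ℝ)))) +
        2 * (Real.exp d * Real.exp (-(3 * (d : ℝ)))) +
        2 * (Real.exp d * (Real.exp d * Real.exp (-(d : ℝ) ^ 2)))) := by
        rw [two, ← ENNReal.ofReal_mul (Real.exp_pos _).le, ← ENNReal.ofReal_mul (Real.exp_pos _).le,
          ← ENNReal.ofReal_mul (Real.exp_pos _).le, ← ENNReal.ofReal_mul (Real.exp_pos _).le,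
          ← ENNReal.ofReal_mul (Real.exp_pos _).le, ← ENNReal.ofReal_mul (by norm_num),
          ← ENNReal.ofReal_mul (by norm_num), ← ENNReal.ofReal_mul (by norm_num),
          ← ENNReal.ofReal_add (by positivity) (by positivity),
          ← ENNReal.ofReal_add (by positivity) (by positivity)]
    _ ≤ ENNReal.ofReal (Real.exp (-(d : ℝ))) := by
        refine ENNReal.ofReal_le_ofReal ?_
        simp only [← Real.exp_add]
        -- Every term is at most exp(-2d); there are six of them with multiplicity, and 6 exp(-d) ≤
        -- 1.
        have e1 : Real.exp (d + (d + -(bucketBound d : ℝ))) ≤ Real.exp (-(2 * d)) :=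
          Real.exp_le_exp.2 (by linarith)
        have e2 : Real.exp (d + -(3 * (d : ℝ))) ≤ Real.exp (-(2 * d)) :=
          Real.exp_le_exp.2 (by linarith)
        have e3 : Real.exp (d + (d + -(d : ℝ) ^ 2)) ≤ Real.exp (-(2 * d)) :=
          Real.exp_le_exp.2 (by nlinarith)
        have e4 : Real.exp (-(2 * (d : ℝ))) = Real.exp (-(d : ℝ)) * Real.exp (-(d : ℝ)) := by
          rw [← Real.exp_add]; congr 1; ring
        have e5 : 6 * Real.exp (-(d : ℝ)) ≤ 1 := by
          have := Real.add_one_le_exp (d : ℝ)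
          rw [Real.exp_neg, ← div_eq_mul_inv, div_le_one (Real.exp_pos _)]
          linarith
        have e6 := Real.exp_pos (-(d : ℝ))
        nlinarith

/-- The value 57/100 is slightly below 1 - (13/20)² = 0.5775, so such a cap has measure about
(57/100)^(d/2). The expected number of pairs grows, as (4/3)² · 57/100 > e^(1/100). The bound 13/20
belongs to distance √(2 - 13/10) = √(7/10). -/
lemma eventually_no_pair_le : ∀ᶠ d : ℕ in atTop,
    modelMeasure d {p | ∀ i j, ¬ 13 / 20 ≤ inner ℝ (p.1.1 j : E d) (p.1.2 i)} ≤
      ENNReal.ofReal (Real.exp (-(d / 200 : ℝ))) := by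
  filter_upwards [eventually_ge_atTop 200] with d hd
  have hd0 : (200 : ℝ) ≤ d := by exact_mod_cast hd
  have hdp : 0 < d := by omega
  set r := Real.sqrt (57 / 100) with hr
  have hr0 : 0 < r := Real.sqrt_pos.2 (by norm_num)
  have hr2 : r ^ 2 = 57 / 100 := Real.sq_sqrt (by norm_num)
  have hcap := le_capMeasure hdp (h := 13 / 20) (r := r) (by norm_num) hr0 (by
    rw [hr2]
    have : (2 * (13 / 20) : ℝ) / d ≤ 2 * (13 / 20) / 200 := by gcongr
    linarith)
  refine (modelMeasure_fst_le hdp {p | ∀ i j, ¬ 13 / 20 ≤ inner ℝ (p.1 j : E d) (p.2 i)}).trans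
    ((listMeasure_prod_no_pair hdp (by positivity) hcap).trans (ENNReal.ofReal_le_ofReal ?_))
  have hrd : r ^ d = (57 / 100 : ℝ) ^ ((d : ℝ) / 2) := by
    rw [hr, Real.sqrt_eq_rpow, ← Real.rpow_natCast, ← Real.rpow_mul (by norm_num)]
    congr 1; ring
  have hN := le_listSize d
  have hd4 : 2 * (d : ℝ) ≤ ((d : ℝ) ^ 4) ^ 2 := by
    calc 2 * (d : ℝ) ≤ (d : ℝ) ^ 2 := by nlinarith
      _ ≤ (d : ℝ) ^ 8 := pow_le_pow_right₀ (by linarith) (by norm_num)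
      _ = _ := by ring
  rw [Real.exp_neg, one_div]
  refine inv_anti₀ (Real.exp_pos _) ?_
  have hexp : Real.exp (1 / 100) ≤ 4 / 3 * (4 / 3) * (57 / 100) := by
    have := Real.one_sub_le_exp_neg (1 / 100)
    rw [Real.exp_neg, le_inv_comm₀ (by norm_num) (Real.exp_pos _)] at this
    exact this.trans (by norm_num)
  calc Real.exp (d / 200) = Real.exp (1 / 100) ^ ((d : ℝ) / 2) := by
        rw [← Real.exp_mul]; congr 1; ring
    _ ≤ (4 / 3 * (4 / 3) * (57 / 100)) ^ ((d : ℝ) / 2) :=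
        Real.rpow_le_rpow (Real.exp_pos _).le hexp (by positivity)
    _ = ((4 / 3 : ℝ) ^ ((d : ℝ) / 2)) ^ 2 * r ^ d := by
        rw [Real.mul_rpow (by norm_num) (by norm_num), Real.mul_rpow (by norm_num) (by norm_num),
          hrd]
        ring
    _ = ((4 / 3 : ℝ) ^ ((d : ℝ) / 2)) ^ 2 * r ^ d * ((2 * d) / (2 * d)) := by
        rw [div_self (by positivity), mul_one]
    _ ≤ ((4 / 3 : ℝ) ^ ((d : ℝ) / 2)) ^ 2 * r ^ d * (((d : ℝ) ^ 4) ^ 2 / (2 * d)) := by gcongr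
    _ = ((d : ℝ) ^ 4 * (4 / 3 : ℝ) ^ ((d : ℝ) / 2)) ^ 2 * (r ^ d / (2 * d)) := by ring
    _ ≤ _ := by gcongr

lemma shrink_bounds {d : ℕ} (hd : 8 ≤ d) : 7 / 8 ≤ shrink d ∧ shrink d < 1 := by
  have hd0 : (8 : ℝ) ≤ d := by exact_mod_cast hd
  have h1 : (1 : ℝ) / d ≤ 1 / 8 := by gcongr
  have h2 : (0 : ℝ) < 1 / d := by positivity
  rw [shrink]
  constructor <;> linarith

/-- The time within which one application of the sieve to typical lists succeeds. -/
noncomputable def stepTime (d : ℕ) : ℕ := numRounds d * roundTime d (bucketBound d)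

/-- The space within which one application of the sieve to typical lists succeeds. -/
noncomputable def stepSpace (d : ℕ) : ℕ := 2 * d * listSize d + roundSpace d (bucketBound d)

/-- One application of the sieve to random lists succeeds with overwhelming probability. -/
lemma eventually_not_productive_le : ∀ᶠ d : ℕ in atTop, ∀ (R : ℝ) (t : E d), 0 < R →
    modelMeasure d {u | ¬ Productive (modelStep R t u) (stepTime d) (stepSpace d)} ≤
      ENNReal.ofReal (Real.exp (-(d : ℝ))) := by
  filter_upwards [eventually_not_typical_le, eventually_ge_atTop 8] with d h hd R t hR
  obtain ⟨s1, -⟩ := shrink_bounds hd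
  have hd0 : (8 : ℝ) ≤ d := by exact_mod_cast hd
  refine le_trans (measure_mono fun u hu => ?_) h
  intro hc
  refine hu (productive_of_typical hR (by linarith) t ?_ ?_ hc)
  · rw [neighbourBound]
    have : (0 : ℝ) < 1 / d := by positivity
    linarith
  -- The reason for the offset 1/d: 2 - 2(1/2 + 1/d) = 1 - 2/d ≤ (1 - 1/d)².
  · rw [neighbourBound, shrink]
    nlinarith [sq_nonneg ((1 : ℝ) / d)]

/-- One application of the sieve to random lists finds a vector close to the target with
overwhelming probability. -/
lemma eventually_far_le : ∀ᶠ d : ℕ in atTop, ∀ (R : ℝ) (t : E d), 0 < R →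
    modelMeasure d {u | ¬ ‖(modelStep R t u).val.best - t‖ ≤ Real.sqrt (7 / 10) * R} ≤
      ENNReal.ofReal (Real.exp (-(d / 200 : ℝ))) + ENNReal.ofReal (Real.exp (-(d : ℝ))) := by
  filter_upwards [eventually_not_typical_le, eventually_no_pair_le, eventually_ge_atTop 8]
    with d h1 h2 hd R t hR
  obtain ⟨s1, -⟩ := shrink_bounds hd
  refine le_trans (measure_mono fun u hu => ?_) ((measure_union_le _ _).trans (add_le_add h2 h1))
  by_contra hc
  simp only [Set.mem_union, Set.mem_ofPred_eq, not_or, not_not] at hc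
  obtain ⟨hpair, htyp⟩ := hc
  push Not at hpair
  obtain ⟨i, j, hij⟩ := hpair
  refine hu (norm_best_sub_le_of_typical hR t htyp (Real.sqrt_nonneg _) ?_ (h' := 13 / 20)
    (by norm_num) ?_ hij)
  · refine le_trans ?_ s1
    rw [Real.sqrt_le_left (by norm_num)]; norm_num
  · rw [Real.sq_sqrt (by norm_num)]; norm_num

end failure

end Sieve

namespace Sieve

/-! ## Exponential growth up to subexponential factors -/

section growth

/-- The function is bounded by `b ^ (d / 2)` up to a subexponential factor. -/
def Growth (b : ℝ) (f : ℕ → ℝ) : Prop :=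
  ∃ F : ℕ → ℝ, (∀ d, 0 ≤ F d) ∧ Subexp F ∧ ∀ᶠ d : ℕ in atTop, f d ≤ F d * b ^ ((d : ℝ) / 2)

namespace Growth

variable {a b : ℝ} {f g : ℕ → ℝ}

lemma mono (hg : Growth b g) (h : ∀ᶠ d in atTop, f d ≤ g d) : Growth b f := by
  obtain ⟨F, h0, h1, h2⟩ := hg
  exact ⟨F, h0, h1, by filter_upwards [h, h2] with d h3 h4 using h3.trans h4⟩

lemma weaken (ha : 0 ≤ a) (hab : a ≤ b) (hf : Growth a f) : Growth b f := by
  obtain ⟨F, h0, h1, h2⟩ := hf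
  refine ⟨F, h0, h1, ?_⟩
  filter_upwards [h2] with d h
  exact h.trans (mul_le_mul_of_nonneg_left (Real.rpow_le_rpow ha hab (by positivity)) (h0 d))

lemma of_subexp (h0 : ∀ d, 0 ≤ f d) (hf : Subexp f) : Growth 1 f :=
  ⟨f, h0, hf, by simp⟩

lemma subexp (hf : Growth 1 f) : Subexp f := by
  obtain ⟨F, -, h1, h2⟩ := hf
  exact h1.mono (by simpa using h2)

lemma add (hf : Growth b f) (hg : Growth b g) : Growth b fun d => f d + g d := by
  obtain ⟨F, h0, h1, h2⟩ := hf
  obtain ⟨G, h0', h1', h2'⟩ := hg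
  refine ⟨fun d => F d + G d, fun d => add_nonneg (h0 d) (h0' d), h1.add h1', ?_⟩
  filter_upwards [h2, h2'] with d h3 h4
  rw [add_mul]; exact add_le_add h3 h4

lemma mul (ha : 0 ≤ a) (hb : 0 ≤ b) (hf : Growth a f) (hg : Growth b g) (hg0 : ∀ d, 0 ≤ g d) :
    Growth (a * b) fun d => f d * g d := by
  obtain ⟨F, h0, h1, h2⟩ := hf
  obtain ⟨G, h0', h1', h2'⟩ := hg
  refine ⟨fun d => F d * G d, fun d => mul_nonneg (h0 d) (h0' d), h1.mul h1' h0', ?_⟩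
  filter_upwards [h2, h2'] with d h3 h4
  rw [Real.mul_rpow ha hb]
  calc f d * g d ≤ (F d * a ^ ((d : ℝ) / 2)) * (G d * b ^ ((d : ℝ) / 2)) :=
        mul_le_mul h3 h4 (hg0 d) (mul_nonneg (h0 d) (by positivity))
    _ = _ := by ring

lemma mul_left (hb : 0 ≤ b) (hf : Growth 1 f) (hg : Growth b g) (hg0 : ∀ d, 0 ≤ g d) :
    Growth b fun d => f d * g d := by
  simpa using mul zero_le_one hb hf hg hg0

/-- The exponent is the logarithm to base b of the subexponential factor; the maximum with 1 keeps
it nonnegative. -/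
lemma exists_isLittleO (hb : 1 < b) (hf : Growth b f) : ∃ e : ℕ → ℝ, (∀ d, 0 ≤ e d) ∧
    e =o[atTop] (fun d : ℕ => (d : ℝ)) ∧ ∀ᶠ d : ℕ in atTop, f d ≤ b ^ ((d : ℝ) / 2 + e d) := by
  obtain ⟨F, h0, h1, h2⟩ := hf
  have hl := Real.log_pos hb
  have he0 : ∀ d, 0 ≤ Real.log (max 1 (F d)) / Real.log b := fun d =>
    div_nonneg (Real.log_nonneg (le_max_left _ _)) hl.le
  refine ⟨fun d => Real.log (max 1 (F d)) / Real.log b, he0, ?_, ?_⟩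
  · refine isLittleO_iff.2 fun ε hε => ?_
    filter_upwards [h1 (ε * Real.log b) (mul_pos hε hl)] with d hd
    rw [Real.norm_of_nonneg (he0 d), Real.norm_natCast, div_le_iff₀ hl,
      Real.log_le_iff_le_exp (lt_max_of_lt_left one_pos)]
    refine max_le ?_ (hd.trans (Real.exp_le_exp.2 (by linarith)))
    exact Real.one_le_exp (by positivity)
  · filter_upwards [h2] with d hd
    have hb0 : 0 < b := by linarith
    have h3 : b ^ (Real.log (max 1 (F d)) / Real.log b) = max 1 (F d) := by
      rw [Real.rpow_def_of_pos hb0, mul_div_cancel₀ _ hl.ne',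
        Real.exp_log (lt_max_of_lt_left one_pos)]
    rw [Real.rpow_add hb0, h3, mul_comm]
    exact hd.trans (mul_le_mul_of_nonneg_right (le_max_right _ _) (by positivity))

variable {p q : ℕ → ℕ}

lemma natCast_add (hp : Growth b fun d => (p d : ℝ)) (hq : Growth b fun d => (q d : ℝ)) :
    Growth b fun d => ((p d + q d : ℕ) : ℝ) := by
  push_cast; exact hp.add hq

lemma natCast_mul (hb : 0 ≤ b) (hp : Growth 1 fun d => (p d : ℝ))
    (hq : Growth b fun d => (q d : ℝ)) : Growth b fun d => ((p d * q d : ℕ) : ℝ) := by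
  push_cast; exact mul_left hb hp hq fun _ => by positivity

lemma natCast_const (n : ℕ) : Growth 1 fun _ => (n : ℝ) :=
  of_subexp (fun _ => by positivity) (Subexp.const n)

lemma natCast_id : Growth 1 fun d : ℕ => (d : ℝ) :=
  of_subexp (fun _ => by positivity) Subexp.natCast

lemma natCast_pow (hp : Growth 1 fun d => (p d : ℝ)) (k : ℕ) :
    Growth 1 fun d => ((p d ^ k : ℕ) : ℝ) := by
  push_cast
  exact of_subexp (fun _ => by positivity) (hp.subexp.pow (fun _ => by positivity) k)

end Growth

end growth

/-! ## The costs of one application of the sieve -/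

section costs

lemma growth_two_pow_numBlocks : Growth 1 fun d => ((2 ^ numBlocks d : ℕ) : ℝ) := by
  have h1 : Growth 1 fun d => ((2 * d : ℕ) : ℝ) :=
    (Growth.natCast_const 2).natCast_mul zero_le_one Growth.natCast_id
  refine h1.mono ?_
  filter_upwards [eventually_gt_atTop 0] with d hd
  exact_mod_cast two_pow_numBlocks_le hd

lemma growth_numBlocks : Growth 1 fun d => (numBlocks d : ℝ) :=
  growth_two_pow_numBlocks.mono (Eventually.of_forall fun d => by
    exact_mod_cast Nat.lt_two_pow_self.le)

/-- The number of blocks tends to infinity, so d/(2m) = o(d). Logarithmically many blocks are the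
compromise: the words per block become subexponential while 2^m stays polynomial. -/
lemma growth_blockSize : Growth 1 fun d => (blockSize d : ℝ) := by
  have h1 : Subexp fun d : ℕ => (4 / 3 : ℝ) ^ ((d : ℝ) / (2 * numBlocks d)) := by
    intro ε hε
    obtain ⟨K, hK⟩ := exists_nat_gt (1 / ε)
    filter_upwards [eventually_ge_atTop (2 ^ K)] with d hd
    have hm : K ≤ numBlocks d := (Nat.le_log_of_pow_le one_lt_two hd).trans (Nat.le_succ _)
    have hm' : (K : ℝ) ≤ numBlocks d := by exact_mod_cast hm
    have hK0 : (0 : ℝ) < K := (by positivity : (0 : ℝ) < 1 / ε).trans hK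
    have hm0 : (0 : ℝ) < numBlocks d := hK0.trans_le hm'
    rw [Real.rpow_def_of_pos (by norm_num)]
    refine Real.exp_le_exp.2 ?_
    have hlog := Real.log_le_sub_one_of_pos (show (0 : ℝ) < 4 / 3 by norm_num)
    have h2 : 1 ≤ ε * numBlocks d := by
      rw [div_lt_iff₀ hε] at hK
      nlinarith
    have h3 : (d : ℝ) / (2 * numBlocks d) ≤ ε * d := by
      rw [div_le_iff₀ (by positivity)]
      have : (0 : ℝ) ≤ d := by positivity
      nlinarith
    have h4 : (0 : ℝ) ≤ d / (2 * numBlocks d) := by positivity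
    nlinarith
  have h2 : Subexp fun d : ℕ => 2 * (4 / 3 : ℝ) ^ ((d : ℝ) / (2 * numBlocks d)) :=
    (Subexp.const 2).mul h1 fun _ => by positivity
  exact Growth.of_subexp (fun _ => by positivity)
    (h2.mono (Eventually.of_forall fun d => blockSize_le d))

lemma growth_decodeTime : Growth 1 fun d => (decodeTime d : ℝ) := by
  have hM := growth_blockSize
  have hm := growth_numBlocks
  have hd := Growth.natCast_id
  have c := Growth.natCast_const
  have h0 := zero_le_one (α := ℝ)
  -- The term repeats the shape of `decodeTime`, one rule for each sum and product.
  exact (((growth_two_pow_numBlocks.natCast_mul h0 ((hM.natCast_mul h0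
    ((hm.natCast_mul h0 hM).natCast_add (c 3))).natCast_add (c 2))).natCast_add
    ((c 4).natCast_mul h0 hd)).natCast_add ((((c 2).natCast_mul h0 hd).natCast_add
    (c 2)).natCast_mul h0 (hm.natCast_mul h0 hM))).natCast_add hm

lemma growth_listSize : Growth (4 / 3) fun d => (listSize d : ℝ) := by
  refine ⟨fun d => 2 * (d : ℝ) ^ 4, fun d => by positivity, (Subexp.const 2).mul
    (Subexp.natCast.pow (fun _ => by positivity) 4) fun _ => by positivity, ?_⟩
  filter_upwards [eventually_gt_atTop 0] with d hd using listSize_le hd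

lemma growth_codeSize : Growth (4 / 3) fun d => ((blockSize d ^ numBlocks d : ℕ) : ℝ) := by
  refine ⟨fun d => 2 * (d : ℝ), fun d => by positivity, (Subexp.const 2).mul
    Subexp.natCast fun _ => by positivity, ?_⟩
  filter_upwards [eventually_gt_atTop 0] with d hd
  push_cast
  exact codeSize_le hd

lemma growth_numRounds : Growth (9 / 8) fun d => (numRounds d : ℝ) :=
  ⟨fun d => 2 * (2 : ℝ) ^ ((d : ℝ) ^ (3 / 4 : ℝ)), fun d => by positivity, (Subexp.const 2).mul
    Subexp.two_rpow fun _ => by positivity, Eventually.of_forall numRounds_le⟩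

lemma growth_bucketBound : Growth 1 fun d => (bucketBound d : ℝ) :=
  (Growth.natCast_const 8).natCast_mul zero_le_one
    ((Growth.natCast_id.natCast_pow 4).natCast_add (Growth.natCast_const 1))

lemma growth_pairTime : Growth 1 fun d => (pairTime d : ℝ) := by
  have hd := Growth.natCast_id
  have c := Growth.natCast_const
  have h0 := zero_le_one (α := ℝ)
  have hlog : Growth 1 fun d => ((Nat.log 2 (listSize d) : ℕ) : ℝ) := by
    have h1 : Growth 1 fun d => ((2 * d : ℕ) : ℝ) := (c 2).natCast_mul h0 hd
    refine h1.mono ?_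
    filter_upwards [eventually_sizes_le] with d ⟨hN, _, _⟩
    have hN0 : (0 : ℝ) < listSize d ∨ listSize d = 0 := by
      rcases Nat.eq_zero_or_pos (listSize d) with h | h
      · exact Or.inr h
      · exact Or.inl (by exact_mod_cast h)
    rcases hN0 with hN0 | hN0
    · refine (Real.natLog_le_logb _ _).trans ?_
      have h2 : Real.log (listSize d) ≤ d := (Real.log_le_iff_le_exp hN0).2 hN
      rw [Real.logb, div_le_iff₀ (by push_cast; exact Real.log_pos (by norm_num))]
      push_cast
      have : (0 : ℝ) ≤ d := by positivity
      nlinarith [Real.log_two_gt_d9]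
    · rw [hN0]; simp
  exact (((c 9).natCast_mul h0 hd).natCast_add (c 3)).natCast_add
    (hd.natCast_mul h0 (hlog.natCast_add (c 2)))

lemma growth_roundSpace : Growth (4 / 3) fun d => (roundSpace d (bucketBound d) : ℝ) := by
  have hM := growth_blockSize
  have hm := growth_numBlocks
  have hd := Growth.natCast_id
  have hB := growth_codeSize
  have hs := growth_bucketBound
  have h0 := zero_le_one (α := ℝ)
  have hb : (0 : ℝ) ≤ 4 / 3 := by norm_num
  have w : ∀ {f : ℕ → ℝ}, Growth 1 f → Growth (4 / 3) f := fun h => h.weaken h0 (by norm_num)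
  exact ((((w ((hd.natCast_pow 2).natCast_add ((hd.natCast_mul h0 hm).natCast_mul h0
    hM))).natCast_add hB).natCast_add (hs.natCast_mul hb hB)).natCast_add
    ((w (hd.natCast_add (hm.natCast_mul h0 hM))).natCast_add (hm.natCast_mul hb hB)))

lemma growth_roundTime : Growth (4 / 3) fun d => (roundTime d (bucketBound d) : ℝ) := by
  have hM := growth_blockSize
  have hm := growth_numBlocks
  have hd := Growth.natCast_id
  have hB := growth_codeSize
  have hs := growth_bucketBound
  have hD := growth_decodeTime
  have c := Growth.natCast_const
  have h0 := zero_le_one (α := ℝ)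
  have hb : (0 : ℝ) ≤ 4 / 3 := by norm_num
  have w : ∀ {f : ℕ → ℝ}, Growth 1 f → Growth (4 / 3) f := fun h => h.weaken h0 (by norm_num)
  have h1 : Growth 1 fun d => ((3 * d ^ 3 + 3 * d ^ 2 * numBlocks d * blockSize d +
      (d ^ 2 + d * numBlocks d * blockSize d) : ℕ) : ℝ) :=
    (((c 3).natCast_mul h0 (hd.natCast_pow 3)).natCast_add
      (((((c 3).natCast_mul h0 (hd.natCast_pow 2)).natCast_mul h0 hm).natCast_mul h0
        hM))).natCast_add ((hd.natCast_pow 2).natCast_add ((hd.natCast_mul h0 hm).natCast_mul h0 hM))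
  have h2 : Growth (4 / 3) fun d => ((listSize d + bucketBound d * blockSize d ^ numBlocks d : ℕ) :
      ℝ) := growth_listSize.natCast_add (hs.natCast_mul hb hB)
  exact (((w h1).natCast_add hB).natCast_add
    (((hD.natCast_add hm).natCast_add (c 1)).natCast_mul hb h2)).natCast_add
    ((c 2).natCast_mul hb (((hD.natCast_add hm).natCast_add
      (growth_pairTime.natCast_mul h0 hs)).natCast_mul hb h2))

/-- The rates multiply to 9/8 · 4/3 = 3/2. -/
lemma growth_stepTime : Growth (3 / 2) fun d => (stepTime d : ℝ) := by
  have h1 := Growth.mul (by norm_num) (by norm_num) growth_numRounds growth_roundTime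
    fun _ => by positivity
  norm_num at h1
  unfold stepTime
  push_cast
  exact h1

lemma growth_mul_listSize : Growth (4 / 3) fun d => ((2 * d * listSize d : ℕ) : ℝ) :=
  ((Growth.natCast_const 2).natCast_mul zero_le_one Growth.natCast_id).natCast_mul (by norm_num)
    growth_listSize

lemma growth_stepSpace : Growth (4 / 3) fun d => (stepSpace d : ℝ) :=
  growth_mul_listSize.natCast_add growth_roundSpace

end costs

/-! ## Negligible probabilities -/

section negligible

variable {p q : ℕ → ℝ≥0∞}

lemma Negligible.mono (hq : Negligible q) (h : ∀ᶠ d in atTop, p d ≤ q d) : Negligible p := fun c => by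
  refine tendsto_of_tendsto_of_tendsto_of_le_of_le' tendsto_const_nhds (hq c)
    (Eventually.of_forall fun _ => zero_le) ?_
  filter_upwards [h] with d hd using mul_le_mul_right hd _

lemma Negligible.add (hp : Negligible p) (hq : Negligible q) : Negligible fun d => p d + q d :=
  fun c => by
    simp_rw [mul_add]
    simpa using (hp c).add (hq c)

lemma Negligible.pow_mul (hp : Negligible p) (k : ℕ) :
    Negligible fun d : ℕ => (d : ℝ≥0∞) ^ k * p d := fun c => by
  simp_rw [← mul_assoc, ← pow_add]
  exact hp (c + k)

lemma negligible_exp {ε : ℝ} (hε : 0 < ε) :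
    Negligible fun d : ℕ => ENNReal.ofReal (Real.exp (-(ε * d))) := fun c => by
  have h1 : Tendsto (fun d : ℕ => ENNReal.ofReal (Real.exp (-(ε / 2 * d)))) atTop (𝓝 0) := by
    rw [← ENNReal.ofReal_zero]
    refine ENNReal.tendsto_ofReal ?_
    have h2 : Tendsto (fun d : ℕ => ε / 2 * (d : ℝ)) atTop atTop :=
      tendsto_natCast_atTop_atTop.const_mul_atTop (half_pos hε)
    exact Real.tendsto_exp_neg_atTop_nhds_zero.comp h2
  refine tendsto_of_tendsto_of_tendsto_of_le_of_le' tendsto_const_nhds h1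
    (Eventually.of_forall fun _ => zero_le) ?_
  filter_upwards [Subexp.natCast.pow (fun _ => by positivity) c (ε / 2) (half_pos hε)] with d hd
  rw [← ENNReal.ofReal_natCast, ← ENNReal.ofReal_pow (by positivity),
    ← ENNReal.ofReal_mul (by positivity)]
  refine ENNReal.ofReal_le_ofReal ?_
  calc (d : ℝ) ^ c * Real.exp (-(ε * d)) ≤ Real.exp (ε / 2 * d) * Real.exp (-(ε * d)) := by gcongr
    _ = _ := by rw [← Real.exp_add]; congr 1; ring

end negligible

/-! ### Union bounds for the actual run -/

namespace CVPInstance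

section prob

variable {d : ℕ} (I : CVPInstance d) {P Q : List (E d) × List (E d) → Coins d → Prop}

lemma prob_mono (h : ∀ l ∈ I.sampler.support, ∀ ω, P l ω → Q l ω) : I.prob P ≤ I.prob Q := by
  refine ENNReal.tsum_le_tsum fun l => ?_
  by_cases hl : l ∈ I.sampler.support
  · exact mul_le_mul_right (measure_mono fun ω => h l hl ω) _
  · rw [PMF.mem_support_iff, not_not] at hl
    simp [hl]

lemma prob_or_le : I.prob (fun l ω => P l ω ∨ Q l ω) ≤ I.prob P + I.prob Q := by
  rw [prob, prob, prob, ← ENNReal.tsum_add]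
  refine ENNReal.tsum_le_tsum fun l => ?_
  rw [← mul_add]
  exact mul_le_mul_right (measure_union_le _ _) _

lemma prob_exists_lt_le {A : ℕ → List (E d) × List (E d) → Coins d → Prop} {c : ℝ≥0∞} (n : ℕ)
    (h : ∀ k < n, I.prob (A k) ≤ c) : I.prob (fun l ω => ∃ k < n, A k l ω) ≤ n * c := by
  induction n with
  | zero => simp [prob]
  | succ n ih =>
    calc _ ≤ I.prob (fun l ω => (∃ k < n, A k l ω) ∨ A n l ω) := I.prob_mono fun l _ ω => by
          rintro ⟨k, hk, hA⟩
          rcases Nat.lt_succ_iff_lt_or_eq.1 hk with hk | rfl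
          · exact Or.inl ⟨k, hk, hA⟩
          · exact Or.inr hA
      _ ≤ _ := I.prob_or_le
      _ ≤ n * c + c := add_le_add (ih fun k hk => h k (Nat.lt_succ_of_lt hk)) (h n n.lt_succ_self)
      _ = _ := by push_cast; ring

end prob

end CVPInstance

end Sieve

namespace Sieve

/-! ## The number of applications of the sieve -/

namespace CVPInstance

section iterations

variable {d : ℕ} (I : CVPInstance d)

lemma gaussRadius_nonneg : 0 ≤ I.gaussRadius :=
  Real.rpow_nonneg (div_nonneg ENNReal.toReal_nonneg ENNReal.toReal_nonneg) _

lemma gaussRadius_le_stopRadius : I.gaussRadius ≤ I.stopRadius := by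
  have h1 : (1 : ℝ) ≤ Real.sqrt (4 / 3) := Real.one_le_sqrt.2 (by norm_num)
  have h2 : (1 : ℝ) ≤ 1 + (d : ℝ) ^ (-(1 / 2) : ℝ) := by
    have : (0 : ℝ) ≤ (d : ℝ) ^ (-(1 / 2) : ℝ) := by positivity
    linarith
  exact le_mul_of_one_le_left I.gaussRadius_nonneg (one_le_mul_of_one_le_of_one_le h1 h2)

/-- The shrinking factor accumulated over d^(c+2) steps is at most exp(-d^(c+1)), which beats the
initial excess 2^(d^c) over the Gaussian radius. -/
lemma radius_pow_lt_stopRadius {c : ℕ} (hd : 8 ≤ d) (hg : 0 < I.gaussRadius)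
    (hR : I.R ≤ (2 : ℝ) ^ (d ^ c) * I.gaussRadius) :
    I.radius (d ^ (c + 2)) < I.stopRadius := by
  refine lt_of_lt_of_le ?_ I.gaussRadius_le_stopRadius
  have hd0 : (8 : ℝ) ≤ d := by exact_mod_cast hd
  obtain ⟨s1, -⟩ := shrink_bounds hd
  have hs : shrink d ≤ Real.exp (-(1 / d)) := Real.one_sub_le_exp_neg _
  have hdc : (1 : ℝ) ≤ (d : ℝ) ^ c := one_le_pow₀ (by linarith)
  have h2 : (2 : ℝ) ^ (d ^ c) ≤ Real.exp ((d : ℝ) ^ c) := by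
    calc (2 : ℝ) ^ (d ^ c) ≤ (Real.exp 1) ^ (d ^ c) := by
          gcongr; linarith [Real.exp_one_gt_d9]
      _ = _ := by rw [← Real.exp_nat_mul]; congr 1; push_cast; ring
  have h3 : shrink d ^ (d ^ (c + 2)) ≤ Real.exp (-((d : ℝ) ^ c * d)) := by
    calc shrink d ^ (d ^ (c + 2)) ≤ Real.exp (-(1 / d)) ^ (d ^ (c + 2)) := by gcongr
      _ = _ := by
        rw [← Real.exp_nat_mul]; congr 1; push_cast
        field_simp
        ring
  calc I.radius (d ^ (c + 2)) ≤ Real.exp (-((d : ℝ) ^ c * d)) *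
        (Real.exp ((d : ℝ) ^ c) * I.gaussRadius) := by
        rw [radius]
        have h4 : I.R ≤ Real.exp ((d : ℝ) ^ c) * I.gaussRadius := hR.trans (by gcongr)
        have h5 : 0 ≤ shrink d ^ (d ^ (c + 2)) := by positivity
        calc _ ≤ shrink d ^ (d ^ (c + 2)) * (Real.exp ((d : ℝ) ^ c) * I.gaussRadius) := by gcongr
          _ ≤ _ := by gcongr
    _ = Real.exp (-((d : ℝ) ^ c * d) + (d : ℝ) ^ c) * I.gaussRadius := by
        rw [Real.exp_add]; ring
    _ < 1 * I.gaussRadius := by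
        gcongr
        rw [Real.exp_lt_one_iff]
        nlinarith
    _ = I.gaussRadius := one_mul _

variable {I}

lemma numIter_le {k : ℕ} (h : I.radius k < I.stopRadius) : I.numIter ≤ k := Nat.sInf_le h

lemma radius_numIter_lt {k : ℕ} (h : I.radius k < I.stopRadius) :
    I.radius I.numIter < I.stopRadius :=
  Nat.sInf_mem (s := {k | I.radius k < I.stopRadius}) ⟨k, h⟩

lemma stopRadius_le_radius {k : ℕ} (h : k < I.numIter) : I.stopRadius ≤ I.radius k :=
  not_lt.1 (Nat.notMem_of_lt_sInf h)

lemma numIter_pos {k : ℕ} (h : I.radius k < I.stopRadius) (hR : I.stopRadius ≤ I.R) :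
    0 < I.numIter := by
  rw [Nat.pos_iff_ne_zero]
  intro h0
  have h1 := radius_numIter_lt h
  rw [h0, radius, pow_zero, one_mul] at h1
  exact absurd h1 (not_lt.2 hR)

/-- At the last application of the sieve, the radius is small compared with the distance of the
target. -/
lemma sqrt_mul_radius_le_dist (hd : 10000 ≤ d) (hdist : 99 / 100 * I.gaussRadius ≤ I.dist) {k : ℕ}
    (h : I.radius (k + 1) < I.stopRadius) : Real.sqrt (7 / 10) * I.radius k ≤ I.dist := by
  have hd0 : (10000 : ℝ) ≤ d := by exact_mod_cast hd
  have hs : (9999 / 10000 : ℝ) ≤ shrink d := by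
    rw [shrink]
    have : (1 : ℝ) / d ≤ 1 / 10000 := by gcongr
    linarith
  have hp : (d : ℝ) ^ (-(1 / 2) : ℝ) ≤ 1 / 100 := by
    rw [Real.rpow_neg (by positivity), ← Real.sqrt_eq_rpow, ← one_div]
    have : (100 : ℝ) ≤ Real.sqrt d := Real.le_sqrt_of_sq_le (by linarith)
    gcongr
  have hg := I.gaussRadius_nonneg
  have h1 : shrink d * I.radius k < I.stopRadius := by
    rw [radius] at h ⊢
    rwa [← mul_assoc, ← pow_succ']
  have h2 : I.stopRadius ≤ Real.sqrt (4 / 3) * (101 / 100) * I.gaussRadius := by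
    rw [stopRadius]
    gcongr
    linarith
  -- √(14/15) is about 0.966. The gap to 99/100 absorbs the factor 101/100 from the stopping radius
  -- and the last shrinking step.
  have h3 : Real.sqrt (7 / 10) * Real.sqrt (4 / 3) ≤ 967 / 1000 := by
    rw [← Real.sqrt_mul (by norm_num), Real.sqrt_le_left (by norm_num)]
    norm_num
  have hq : 0 ≤ Real.sqrt (7 / 10) := Real.sqrt_nonneg _
  by_cases hr : I.radius k < 0
  · calc _ ≤ 0 := mul_nonpos_of_nonneg_of_nonpos hq hr.le
      _ ≤ _ := Metric.infDist_nonneg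
  · push Not at hr
    have h4 : 9999 / 10000 * I.radius k ≤ Real.sqrt (4 / 3) * (101 / 100) * I.gaussRadius :=
      (mul_le_mul_of_nonneg_right hs hr).trans (h1.le.trans h2)
    have h5 : 9999 / 10000 * (Real.sqrt (7 / 10) * I.radius k) ≤
        967 / 1000 * (101 / 100) * I.gaussRadius := by
      calc _ = Real.sqrt (7 / 10) * (9999 / 10000 * I.radius k) := by ring
        _ ≤ Real.sqrt (7 / 10) * (Real.sqrt (4 / 3) * (101 / 100) * I.gaussRadius) := by gcongr
        _ = (Real.sqrt (7 / 10) * Real.sqrt (4 / 3)) * (101 / 100 * I.gaussRadius) := by ring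
        _ ≤ 967 / 1000 * (101 / 100 * I.gaussRadius) := by gcongr
        _ = _ := by ring
    linarith

end iterations

/-! ## The complete algorithm -/

section run

variable {d : ℕ} {I : CVPInstance d} {l : List (E d) × List (E d)} {ω : Coins d}

lemma peak_solveCVP_le (hl : l ∈ I.sampler.support) {τ σ : ℝ} (hσ : 0 ≤ σ)
    (h : ∀ k < I.numIter, Productive (I.actualStep k l ω) τ σ) :
    ((I.solveCVP l ω).peak : ℝ) ≤ 2 * d * listSize d + d + σ := by
  have h1 := I.peak_sieveIter_le ω hl hσ fun k hk => (h k hk).2.2.2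
  obtain ⟨hfit, -, -, -, hnet⟩ := I.sieveIter_invariant ω hl I.numIter
  rw [peak_solveCVP, add_zero, Int.cast_max]
  refine max_le h1 ?_
  have h5 : (I.sieveIter l ω I.numIter).net ≤ 2 * d * listSize d + d := by
    rw [hnet]; linarith [cells_le hfit]
  have h6 : ((I.sieveIter l ω I.numIter).net : ℝ) ≤ 2 * d * listSize d + d := by exact_mod_cast h5
  linarith

lemma isClosest_solveCVP (hl : l ∈ I.sampler.support) {n : ℕ} (hn : I.numIter = n + 1)
    (h : I.Finds (I.actualStep n l ω)) : I.IsClosest (I.solveCVP l ω).val := by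
  rw [val_solveCVP]
  refine I.isClosest_of_norm_le (I.sieveIter_invariant ω hl _).2.2.2.1 ?_
  rw [hn, val_sieveIter_succ]
  exact h

end run

end CVPInstance

/-! ### Numerical values of the exponents -/

/-- Both numerical claims amount to 1.583 < log₂ 3 < 1.585. The true value is about 1.58496, so the
upper bound needs a comparison of large powers. -/
lemma logb_two_three_bounds : 19 / 12 < Real.logb 2 3 ∧ Real.logb 2 3 < 317 / 200 := by
  have h1 : ∀ n : ℕ, Real.logb 2 ((3 : ℝ) ^ n) = n * Real.logb 2 3 := fun n =>
    Real.logb_pow 2 3 n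
  have h2 : ∀ n : ℕ, Real.logb 2 ((2 : ℝ) ^ n) = n := fun n => by
    rw [Real.logb_pow, Real.logb_self_eq_one (by norm_num), mul_one]
  constructor
  · have := Real.logb_lt_logb (b := 2) (by norm_num) (by norm_num)
      (show (2 : ℝ) ^ 19 < 3 ^ 12 by norm_num)
    rw [h1, h2] at this
    push_cast at this
    linarith
  · have := Real.logb_lt_logb (b := 2) (by norm_num) (by norm_num)
      (show (3 : ℝ) ^ 200 < 2 ^ 317 by
        calc (3 : ℝ) ^ 200 < (2 ^ 100) ^ 3 * 2 ^ 17 := by norm_num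
          _ = 2 ^ 317 := by rw [← pow_mul, ← pow_add])
    rw [h1, h2] at this
    push_cast at this
    linarith

lemma abs_logb_four_thirds_sub_lt : abs (Real.logb 2 (4 / 3) / 2 - 0.208) < 0.0005 := by
  obtain ⟨h1, h2⟩ := logb_two_three_bounds
  have h3 : Real.logb 2 (4 / 3) = 2 - Real.logb 2 3 := by
    rw [Real.logb_div (by norm_num) (by norm_num)]
    congr 1
    rw [show (4 : ℝ) = 2 ^ 2 by norm_num, Real.logb_pow, Real.logb_self_eq_one (by norm_num)]
    norm_num
  rw [h3, abs_lt]
  constructor <;> norm_num <;> linarith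

lemma abs_logb_three_halves_sub_lt : abs (Real.logb 2 (3 / 2) / 2 - 0.292) < 0.0005 := by
  obtain ⟨h1, h2⟩ := logb_two_three_bounds
  have h3 : Real.logb 2 (3 / 2) = Real.logb 2 3 - 1 := by
    rw [Real.logb_div (by norm_num) (by norm_num), Real.logb_self_eq_one (by norm_num)]
  rw [h3, abs_lt]
  constructor <;> norm_num <;> linarith

/-! ### From the heuristic assumption to all steps of a run -/

section main

variable (I : ∀ d : ℕ, CVPInstance d) {c : ℕ}

/-- What holds for the instances in all large dimensions. -/
structure Regular {d : ℕ} (I : CVPInstance d) (c : ℕ) : Prop where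
  numIter_pos : 0 < I.numIter
  numIter_le : I.numIter ≤ d ^ (c + 2)
  radius_pos : ∀ k < I.numIter, 0 < I.radius k
  radius_le : Real.sqrt (7 / 10) * I.radius (I.numIter - 1) ≤ I.dist

lemma eventually_regular
    (hR_lower : ∀ᶠ d in atTop, (I d).stopRadius ≤ (I d).R)
    (hR_upper : ∀ᶠ d : ℕ in atTop, (I d).R ≤ (2 : ℝ) ^ (d ^ c) * (I d).gaussRadius)
    (hgauss : Tendsto (fun d => (I d).dist / (I d).gaussRadius) atTop (𝓝 1)) :
    ∀ᶠ d in atTop, Regular (I d) c := by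
  filter_upwards [hR_lower, hR_upper, hgauss.eventually_const_lt (show (99 / 100 : ℝ) < 1 by norm_num),
    eventually_ge_atTop 10000] with d h1 h2 h3 hd
  have hg : 0 < (I d).gaussRadius := by
    -- With a vanishing Gaussian radius the quotient would be 0, division by zero being 0, and not
    -- close to 1.
    refine lt_of_le_of_ne (I d).gaussRadius_nonneg fun h0 => ?_
    rw [← h0, div_zero] at h3
    norm_num at h3
  have hrad := (I d).radius_pow_lt_stopRadius (by omega) hg h2
  have hpos := CVPInstance.numIter_pos hrad h1
  refine ⟨hpos, CVPInstance.numIter_le hrad, fun k hk => ?_, ?_⟩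
  · exact (hg.trans_le (I d).gaussRadius_le_stopRadius).trans_le
      (CVPInstance.stopRadius_le_radius hk)
  · refine CVPInstance.sqrt_mul_radius_le_dist hd ?_ ?_
    · exact ((lt_div_iff₀ hg).1 h3).le
    · rw [Nat.sub_add_cancel hpos]
      exact CVPInstance.radius_numIter_lt hrad

variable {I}

/-- (H) speaks of one step per dimension. It is applied to the step with the largest failure
probability in each dimension; the union over all steps then costs a polynomial factor only, which
negligibility tolerates. -/
lemma negligible_not_productive (hreg : ∀ᶠ d in atTop, Regular (I d) c) {e : ℕ → ℝ}
    (H : ∀ k : ℕ → ℕ, (∀ᶠ d in atTop, k d < (I d).numIter) → ∀ τ σ : ℕ → ℝ,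
        Negligible (fun d => modelMeasure d
          {u | ¬ Productive (modelStep ((I d).radius (k d)) (I d).target u) (τ d) (σ d)}) →
        Negligible (fun d => (I d).prob fun l ω =>
          ¬ Productive ((I d).actualStep (k d) l ω) (2 ^ e d * τ d) (2 ^ e d * σ d))) :
    Negligible fun d => (I d).prob fun l ω => ∃ k < (I d).numIter,
      ¬ Productive ((I d).actualStep k l ω) (2 ^ e d * stepTime d) (2 ^ e d * stepSpace d) := by
  set f : ℕ → ℕ → ℝ≥0∞ := fun d k => (I d).prob fun l ω =>
    ¬ Productive ((I d).actualStep k l ω) (2 ^ e d * stepTime d) (2 ^ e d * stepSpace d) with hf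
  have hmax : ∀ d, ∃ k, 0 < (I d).numIter → k < (I d).numIter ∧
      ∀ j < (I d).numIter, f d j ≤ f d k := by
    intro d
    by_cases h0 : 0 < (I d).numIter
    · obtain ⟨k, hk, hmax⟩ := Finset.exists_max_image (Finset.range (I d).numIter) (f d)
        ⟨0, Finset.mem_range.2 h0⟩
      exact ⟨k, fun _ => ⟨Finset.mem_range.1 hk, fun j hj => hmax j (Finset.mem_range.2 hj)⟩⟩
    · exact ⟨0, fun h => absurd h h0⟩
  choose k hk using hmax
  have h1 : Negligible fun d => f d (k d) := by
    refine H k (hreg.mono fun d h => (hk d h.numIter_pos).1) (fun d => stepTime d)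
      (fun d => stepSpace d) ((negligible_exp one_pos).mono ?_)
    filter_upwards [hreg, eventually_not_productive_le] with d h h'
    rw [one_mul]
    exact h' _ _ (h.radius_pos _ (hk d h.numIter_pos).1)
  refine (h1.pow_mul (c + 2)).mono ?_
  filter_upwards [hreg] with d h
  refine ((I d).prob_exists_lt_le _ (hk d h.numIter_pos).2).trans ?_
  gcongr
  exact_mod_cast h.numIter_le

/-- Only the last step matters: its radius is so small that finding a vector within √(7/10) of it
reaches the distance to the lattice. -/
lemma negligible_not_finds (hreg : ∀ᶠ d in atTop, Regular (I d) c)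
    (H : ∀ k : ℕ → ℕ, (∀ᶠ d in atTop, k d < (I d).numIter) →
      Negligible (fun d => modelMeasure d
          {u | ¬ (I d).Finds (modelStep ((I d).radius (k d)) (I d).target u)}) →
        Negligible (fun d => (I d).prob fun l ω => ¬ (I d).Finds ((I d).actualStep (k d) l ω))) :
    Negligible fun d => (I d).prob fun l ω =>
      ¬ (I d).Finds ((I d).actualStep ((I d).numIter - 1) l ω) := by
  have hlt : ∀ᶠ d in atTop, (I d).numIter - 1 < (I d).numIter :=
    hreg.mono fun d h => Nat.sub_lt h.numIter_pos one_pos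
  refine H (fun d => (I d).numIter - 1) hlt
    (((negligible_exp (show (0 : ℝ) < 1 / 200 by norm_num)).add
    (negligible_exp one_pos)).mono ?_)
  filter_upwards [hreg, hlt, eventually_far_le] with d h hlt' h'
  refine le_trans (measure_mono fun u hu => ?_)
    ((h' _ (I d).target (h.radius_pos _ hlt')).trans (le_of_eq ?_))
  · exact fun hc => hu (hc.trans h.radius_le)
  congr 4 <;> ring

end main

end Sieve

namespace Sieve

/-! ## The running time and the space of the complete algorithm -/

section total

/-- A bound for the running time of the complete algorithm. -/
noncomputable def totalTime (c : ℕ) (e : ℕ → ℝ) (d : ℕ) : ℝ :=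
  3 * d ^ 3 + 2 * listSize d * d ^ c + (2 * d * listSize d + d) +
    d ^ (c + 2) * (2 + 2 ^ e d * stepTime d)

/-- A bound for the space of the complete algorithm. -/
noncomputable def totalSpace (e : ℕ → ℝ) (d : ℕ) : ℝ :=
  2 * d * listSize d + d + 2 ^ e d * stepSpace d

variable {e : ℕ → ℝ}

lemma growth_totalTime (he : e =o[atTop] fun d : ℕ => (d : ℝ)) (c : ℕ) :
    Growth (3 / 2) (totalTime c e) := by
  have hd := Growth.natCast_id
  have k := Growth.natCast_const
  have h0 := zero_le_one (α := ℝ)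
  have w : ∀ {f : ℕ → ℝ}, Growth 1 f → Growth (3 / 2) f := fun h => h.weaken h0 (by norm_num)
  have h2e : Growth 1 fun d => (2 : ℝ) ^ e d :=
    .of_subexp (fun _ => by positivity) (Subexp.two_rpow_isLittleO he)
  have hN : Growth (3 / 2) fun d => (listSize d : ℝ) :=
    growth_listSize.weaken (by norm_num) (by norm_num)
  have h1 : Growth (3 / 2) fun d => ((3 * d ^ 3 + 2 * d ^ c * listSize d +
      (2 * d * listSize d + d) : ℕ) : ℝ) :=
    ((w ((k 3).natCast_mul h0 (hd.natCast_pow 3))).natCast_add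
      (((k 2).natCast_mul h0 (hd.natCast_pow c)).natCast_mul (by norm_num) hN)).natCast_add
      ((((k 2).natCast_mul h0 hd).natCast_mul (by norm_num) hN).natCast_add (w hd))
  have h2 : Growth (3 / 2) fun d => ((2 : ℕ) : ℝ) + 2 ^ e d * (stepTime d : ℝ) :=
    (w (k 2)).add (h2e.mul_left (by norm_num) growth_stepTime fun _ => by positivity)
  have h3 := h1.add ((hd.natCast_pow (c + 2)).mul_left (by norm_num) h2 fun _ => by positivity)
  refine h3.mono (Eventually.of_forall fun d => le_of_eq ?_)
  rw [totalTime]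
  push_cast
  ring

lemma growth_totalSpace (he : e =o[atTop] fun d : ℕ => (d : ℝ)) :
    Growth (4 / 3) (totalSpace e) := by
  have h2e : Growth 1 fun d => (2 : ℝ) ^ e d :=
    .of_subexp (fun _ => by positivity) (Subexp.two_rpow_isLittleO he)
  have h1 := (growth_mul_listSize.add (Growth.natCast_id.weaken zero_le_one (by norm_num))).add
    (h2e.mul_left (by norm_num) growth_stepSpace fun _ => by positivity)
  refine h1.mono (Eventually.of_forall fun d => le_of_eq ?_)
  rw [totalSpace]
  push_cast
  ring

lemma rpow_le_numRounds_mul (d : ℕ) : (3 / 2 : ℝ) ^ ((d : ℝ) / 2) ≤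
    ((numRounds d * blockSize d ^ numBlocks d : ℕ) : ℝ) := by
  have h1 : (9 / 8 : ℝ) ^ ((d : ℝ) / 2) ≤ numRounds d := by
    refine le_trans (le_mul_of_one_le_right (by positivity) ?_) (Nat.le_ceil _)
    exact Real.one_le_rpow (by norm_num) (by positivity)
  have h2 := rpow_le_codeSize d
  push_cast
  calc (3 / 2 : ℝ) ^ ((d : ℝ) / 2) = (9 / 8 : ℝ) ^ ((d : ℝ) / 2) * (4 / 3 : ℝ) ^ ((d : ℝ) / 2) := by
        rw [← Real.mul_rpow (by norm_num) (by norm_num)]; norm_num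
    _ ≤ _ := by gcongr

lemma rpow_le_mul_listSize {d : ℕ} (hd : 0 < d) : (4 / 3 : ℝ) ^ ((d : ℝ) / 2) ≤
    2 * d * listSize d := by
  have h1 : (1 : ℝ) ≤ d := by exact_mod_cast hd
  have h2 : (4 / 3 : ℝ) ^ ((d : ℝ) / 2) ≤ listSize d :=
    le_trans (le_mul_of_one_le_left (by positivity) (one_le_pow₀ h1)) (le_listSize d)
  exact h2.trans (le_mul_of_one_le_left (by positivity) (by linarith))

end total

end Sieve

theorem theorem1 (I : ∀ d : ℕ, Sieve.CVPInstance d) (c : ℕ)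
    (hR_lower : ∀ᶠ d in atTop, (I d).stopRadius ≤ (I d).R)
    (hR_upper : ∀ᶠ d : ℕ in atTop, (I d).R ≤ (2 : ℝ) ^ (d ^ c) * (I d).gaussRadius)
    (hsampler : ∀ᶠ d : ℕ in atTop, (I d).sampleCost ≤ d ^ c)
    (hgauss : Tendsto (fun d => (I d).dist / (I d).gaussRadius) atTop (𝓝 1))
    (hheuristic : Sieve.ListsBehaveUniformly I) :
    (∃ e : ℕ → ℝ, e =o[atTop] (fun d => (d : ℝ)) ∧
      Sieve.Negligible (fun d => (I d).prob fun l ω =>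
        ¬ ((I d).IsClosest ((I d).solveCVP l ω).val ∧
          (3 / 2 : ℝ) ^ ((d : ℝ) / 2 - e d) ≤ ((I d).solveCVP l ω).time ∧
          (((I d).solveCVP l ω).time : ℝ) ≤ (3 / 2 : ℝ) ^ ((d : ℝ) / 2 + e d) ∧
          (4 / 3 : ℝ) ^ ((d : ℝ) / 2 - e d) ≤ ((I d).solveCVP l ω).peak ∧
          (((I d).solveCVP l ω).peak : ℝ) ≤ (4 / 3 : ℝ) ^ ((d : ℝ) / 2 + e d)))) ∧
    abs (Real.logb 2 (4 / 3) / 2 - 0.208) < 0.0005 ∧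
    abs (Real.logb 2 (3 / 2) / 2 - 0.292) < 0.0005 := by
  refine ⟨?_, Sieve.abs_logb_four_thirds_sub_lt, Sieve.abs_logb_three_halves_sub_lt⟩
  obtain ⟨e, he, H⟩ := hheuristic
  have hreg := Sieve.eventually_regular I hR_lower hR_upper hgauss
  have hprod := Sieve.negligible_not_productive hreg (e := e) fun k hk => (H k hk).1
  have hfind := Sieve.negligible_not_finds hreg fun k hk => (H k hk).2
  obtain ⟨e₁, he₁0, he₁, ht⟩ := (Sieve.growth_totalTime he c).exists_isLittleO (by norm_num)
  obtain ⟨e₂, he₂0, he₂, hs⟩ := (Sieve.growth_totalSpace he).exists_isLittleO (by norm_num)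
  -- Both summands are nonnegative, so their sum serves for time and space at once. The lower bounds
  -- hold even without it.
  refine ⟨fun d => e₁ d + e₂ d, he₁.add he₂, (hprod.add hfind).mono ?_⟩
  filter_upwards [hreg, hsampler, ht, hs, eventually_gt_atTop 0] with d hreg hcost ht hs hd
  -- A run can fail only if some step is not productive or the last step does not find a close
  -- vector.
  refine le_trans ((I d).prob_mono fun l hl ω hbad => ?_) (I d).prob_or_le
  by_contra hgood
  rw [not_or, not_not] at hgood
  obtain ⟨hprod, hfind⟩ := hgood
  push Not at hprod
  have hn : (I d).numIter = ((I d).numIter - 1) + 1 := (Nat.sub_add_cancel hreg.numIter_pos).symm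
  have hpow : ∀ {b x y : ℝ}, 1 < b → x ≤ y → b ^ x ≤ b ^ y := fun hb hxy =>
    Real.rpow_le_rpow_of_exponent_le hb.le hxy
  have h₁ := he₁0 d
  have h₂ := he₂0 d
  refine hbad ⟨Sieve.CVPInstance.isClosest_solveCVP hl hn hfind, ?_, ?_, ?_, ?_⟩
  · refine (hpow (by norm_num) (by linarith)).trans ((Sieve.rpow_le_numRounds_mul d).trans ?_)
    rw [Sieve.CVPInstance.time_solveCVP, hn]
    exact_mod_cast (I d).le_time_sieveIter_succ ω _
  · rw [Sieve.CVPInstance.time_solveCVP]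
    refine ((I d).time_sieveIter_le ω hl fun k hk => (hprod k hk).2.2.1).trans
      (le_trans ?_ (ht.trans (hpow (by norm_num) (by linarith))))
    have hc : ((I d).sampleCost : ℝ) ≤ (d : ℝ) ^ c := by exact_mod_cast hcost
    have hi : ((I d).numIter : ℝ) ≤ (d : ℝ) ^ (c + 2) := by exact_mod_cast hreg.numIter_le
    rw [Sieve.totalTime]
    gcongr
  · refine (hpow (by norm_num) (by linarith)).trans ((Sieve.rpow_le_mul_listSize hd).trans ?_)
    rw [Sieve.CVPInstance.peak_solveCVP, Int.cast_max]
    exact ((I d).le_peak_sieveIter ω hl (I d).numIter).trans (le_max_left _ _)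
  · refine (Sieve.CVPInstance.peak_solveCVP_le hl (by positivity) hprod).trans
      (le_trans ?_ (hs.trans (hpow (by norm_num) (by linarith))))
    rw [Sieve.totalSpace]
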